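/- Let $(\Omega,\mathcal F,\mathbb P)$ be a probability space with a filtration $\mathbb F=(\mathcal F_s)_{s\ge 0}$ (any filtration is allowed: for instance the augmented filtration generated by a Brownian motion, or a trivial one). Let $0<T<\infty$, let $A,Q\in L^\infty(0,T;\mathbb R^{n\times n})$, $B_i\in L^\infty(0,T;\mathbb R^{n\times m_i})$, $S_i\in L^\infty(0,T;\mathbb R^{m_i\times n})$, $R_{ij}\in L^\infty(0,T;\mathbb R^{m_i\times m_j})$ ($i,j=1,2$) be deterministic with $Q^\top=Q$ and $R_{ij}^\top=R_{ji}$ a.e., and let $G\in\mathbb R^{n\times n}$ be symmetric. Put $$B=(B_1,B_2),\qquad S=\begin{pmatrix}S_1\\S_2\end{pmatrix},\qquad R=\begin{pmatrix}R_{11}&R_{12}\\R_{21}&R_{22}\end{pmatrix}.$$ For $t\in[0,T]$ let $\mathcal U_i[t,T]$ be the set of $\mathbb F$-progressively measurable processes $u_i:[t,T]\times\Omega\to\mathbb R^{m_i}$ with $\mathbb E\int_t^T|u_i(s)|^2ds<\infty$, two controls being identified if they agree $ds\otimes\mathbb P$-a.e. For an initial pair $(t,x)\in[0,T]\times\mathbb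 R^n$ and $u_i\in\mathcal U_i[t,T]$ let $X$ be the solution of the state equation without diffusion part $$dX(s)=[A(s)X(s)+B_1(s)u_1(s)+B_2(s)u_2(s)]\,ds,\quad s\in[t,T],\qquad X(t)=x,$$ and let $$J(t,x;u_1,u_2)=\mathbb E\left\{\langle GX(T),X(T)\rangle+\int_t^T\left\langle\begin{pmatrix}Q&S^\top\\S&R\end{pmatrix}\begin{pmatrix}X\\u\end{pmatrix},\begin{pmatrix}X\\u\end{pmatrix}\right\rangle ds\right\},\qquad u=\begin{pmatrix}u_1\\u_2\end{pmatrix}.$$ The open-loop lower and upper values are $$V^-(t,x)=\sup_{u_2\in\mathcal U_2[t,T]}\inf_{u_1\in\mathcal U_1[t,T]}J(t,x;u_1,u_2),\qquad V^+(t,x)=\inf_{u_1\in\mathcal U_1[t,T]}\sup_{u_2\in\mathcal U_2[t,T]}J(t,x;u_1,u_2),$$ and an open-loop saddle point for $(t,x)$ is a pair $(u_1^*,u_2^*)\in\mathcal U_1[t,T]\times\mathcal U_2[t,T]$ such that $J(t,x;u_1^*,u_2)\le J(t,x;u_1^*,u_2^*)\le J(t,x;u_1,u_2^*)$ for all $(u_1,u_2)\in\mathcal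 U_1[t,T]\times\mathcal U_2[t,T]$. Suppose that $R_{11}\gg0$ and $R_{22}\ll0$, i.e. there is $\alpha>0$ such that $R_{11}(s)-\alpha I$ and $-R_{22}(s)-\alpha I$ are positive semidefinite for a.e. $s\in[0,T]$. Then the following are equivalent: (i) $V^-(t,x)$ and $V^+(t,x)$ are finite for every initial pair $(t,x)\in[0,T]\times\mathbb R^n$; (ii) a unique open-loop saddle point exists for every initial pair $(t,x)\in[0,T]\times\mathbb R^n$. Moreover, if these statements hold, then the Riccati equation $$\dot P+PA+A^\top P+Q-(PB+S^\top)R^{-1}(B^\top P+S)=0,\qquad P(T)=G$$ (understood in integrated form, i.e. $P$ is absolutely continuous and the equation holds a.e.) has a unique solution $P\in C([0,T];\mathbb S^n)$, where $\mathbb S^n$ denotes the symmetric $n\times n$ real matrices; and, with $\Theta=-R^{-1}(B^\top P+S)$, for every initial pair $(t,x)$ the closed-loop system $$dX^*(s)=[A(s)+B(s)\Theta(s)]X^*(s)\,ds,\quad s\in[t,T],\qquad X^*(t)=x,$$ has a unique solution $X^*$ and the unique open-loop saddle point $u^*=(u_1^*,u_2^*)$ is given by $u^*(s)=\Theta(s)X^*(s)$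 ($ds\otimes\mathbb P$-a.e. on $[t,T]\times\Omega$). -/

import Mathlib

open MeasureTheory Set Matrix
open scoped NNReal

noncomputable section

/-- The data of a two-person zero-sum linear-quadratic differential game without diffusion part
on the horizon `[0,T]`: the state equation is `dX = (A X + B₁ u₁ + B₂ u₂) ds`, and the criterion
has terminal weight `G` and running weights `Q, S₁, S₂, R₁₁, R₁₂, R₂₁, R₂₂`.
Only the values of the coefficients on `[0,T]` matter. -/
structure LQGame (n m₁ m₂ : ℕ) where
  T : ℝ
  A : ℝ → Matrix (Fin n) (Fin n) ℝ
  B₁ : ℝ → Matrix (Fin n) (Fin m₁) ℝ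
  B₂ : ℝ → Matrix (Fin n) (Fin m₂) ℝ
  G : Matrix (Fin n) (Fin n) ℝ
  Q : ℝ → Matrix (Fin n) (Fin n) ℝ
  S₁ : ℝ → Matrix (Fin m₁) (Fin n) ℝ
  S₂ : ℝ → Matrix (Fin m₂) (Fin n) ℝ
  R₁₁ : ℝ → Matrix (Fin m₁) (Fin m₁) ℝ
  R₁₂ : ℝ → Matrix (Fin m₁) (Fin m₂) ℝ
  R₂₁ : ℝ → Matrix (Fin m₂) (Fin m₁) ℝ
  R₂₂ : ℝ → Matrix (Fin m₂) (Fin m₂) ℝ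

/-- `M ∈ L^∞(0,T; ℝ^{p×q})`: every entry is Lebesgue measurable and essentially bounded. -/
def IsLInfty {p q : ℕ} (T : ℝ) (M : ℝ → Matrix (Fin p) (Fin q) ℝ) : Prop :=
  ∀ i j, MemLp (fun s => M s i j) ⊤ (volume.restrict (Icc 0 T))

/-- `M ≫ 0` on `[0,T]`: for some `α > 0`, `M(s) - α I` is positive semidefinite for a.e. `s`. -/
def IsUniformlyPos {p : ℕ} (T : ℝ) (M : ℝ → Matrix (Fin p) (Fin p) ℝ) : Prop :=
  ∃ α : ℝ, 0 < α ∧ ∀ᵐ s ∂(volume.restrict (Icc 0 T)),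
    (M s - α • (1 : Matrix (Fin p) (Fin p) ℝ)).PosSemidef

/-- `M ≪ 0` on `[0,T]`: for some `α > 0`, `-M(s) - α I` is positive semidefinite for a.e. `s`. -/
def IsUniformlyNeg {p : ℕ} (T : ℝ) (M : ℝ → Matrix (Fin p) (Fin p) ℝ) : Prop :=
  IsUniformlyPos T (fun s => -M s)

/-- The set `𝒰[t,T]` of `ℝ^m`-valued controls: processes on `[t,T]` that are progressively
measurable with respect to the filtration `𝓕` and satisfy `E ∫_t^T |u(s)|² ds < ∞`.
The values of `u` outside `[t,T]` are irrelevant. -/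
def controls {Ω : Type*} {mΩ : MeasurableSpace Ω} (μ : Measure Ω) (𝓕 : Filtration ℝ≥0 mΩ)
    (m : ℕ) (t T : ℝ) : Set (ℝ → Ω → Fin m → ℝ) :=
  {u | (∀ s ∈ Icc t T,
          Measurable[(inferInstance : MeasurableSpace (Icc t s)).prod (𝓕 s.toNNReal)]
            (fun p : Icc t s × Ω => u p.1 p.2)) ∧
        ∫⁻ ω, ∫⁻ s in Icc t T, ENNReal.ofReal (u s ω ⬝ᵥ u s ω) ∂volume ∂μ < ⊤}

namespace LQGame

variable {n m₁ m₂ : ℕ} (g : LQGame n m₁ m₂)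

/-- The standing assumptions: bounded Lebesgue measurable coefficients and symmetric weights. -/
structure IsRegular : Prop where
  T_pos : 0 < g.T
  A_mem : IsLInfty g.T g.A
  B₁_mem : IsLInfty g.T g.B₁
  B₂_mem : IsLInfty g.T g.B₂
  G_symm : g.G.IsSymm
  Q_mem : IsLInfty g.T g.Q
  Q_symm : ∀ᵐ s ∂(volume.restrict (Icc 0 g.T)), (g.Q s).IsSymm
  S₁_mem : IsLInfty g.T g.S₁
  S₂_mem : IsLInfty g.T g.S₂
  R₁₁_mem : IsLInfty g.T g.R₁₁
  R₁₂_mem : IsLInfty g.T g.R₁₂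
  R₂₁_mem : IsLInfty g.T g.R₂₁
  R₂₂_mem : IsLInfty g.T g.R₂₂
  R₁₁_symm : ∀ᵐ s ∂(volume.restrict (Icc 0 g.T)), (g.R₁₁ s).IsSymm
  R₁₂_transpose : ∀ᵐ s ∂(volume.restrict (Icc 0 g.T)), (g.R₁₂ s)ᵀ = g.R₂₁ s
  R₂₂_symm : ∀ᵐ s ∂(volume.restrict (Icc 0 g.T)), (g.R₂₂ s).IsSymm

/-- `B = (B₁, B₂)`. -/
def B (s : ℝ) : Matrix (Fin n) (Fin m₁ ⊕ Fin m₂) ℝ := fromCols (g.B₁ s) (g.B₂ s)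

/-- `S` is the block column with blocks `S₁`, `S₂`. -/
def S (s : ℝ) : Matrix (Fin m₁ ⊕ Fin m₂) (Fin n) ℝ := fromRows (g.S₁ s) (g.S₂ s)

/-- `R` is the block matrix with blocks `R₁₁, R₁₂, R₂₁, R₂₂`. -/
def R (s : ℝ) : Matrix (Fin m₁ ⊕ Fin m₂) (Fin m₁ ⊕ Fin m₂) ℝ :=
  fromBlocks (g.R₁₁ s) (g.R₁₂ s) (g.R₂₁ s) (g.R₂₂ s)

/-- `X` solves `dX = (A X + B₁ u₁ + B₂ u₂) ds` on `[t,T]`, `X(t) = x` (along one path), i.e. `X` is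
continuous on `[t,T]` and satisfies the integrated equation. -/
def IsStatePath (t : ℝ) (x : Fin n → ℝ) (u₁ : ℝ → Fin m₁ → ℝ) (u₂ : ℝ → Fin m₂ → ℝ)
    (X : ℝ → Fin n → ℝ) : Prop :=
  ContinuousOn X (Icc t g.T) ∧
  ∀ s ∈ Icc t g.T,
    X s = x + ∫ r in t..s, (g.A r *ᵥ X r + g.B₁ r *ᵥ u₁ r + g.B₂ r *ᵥ u₂ r)

open Classical in
/-- The state path driven by the control paths `u₁, u₂`. For square-integrable control paths it
exists and is unique on `[t,T]`; the fallback value only concerns other paths. -/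
def statePath (t : ℝ) (x : Fin n → ℝ) (u₁ : ℝ → Fin m₁ → ℝ) (u₂ : ℝ → Fin m₂ → ℝ) :
    ℝ → Fin n → ℝ :=
  if h : ∃ X, g.IsStatePath t x u₁ u₂ X then h.choose else 0

/-- The running cost: the quadratic form with matrix `(Q, Sᵀ; S, R)` at `(X, u₁, u₂)`. -/
def runningCost (s : ℝ) (X : Fin n → ℝ) (v₁ : Fin m₁ → ℝ) (v₂ : Fin m₂ → ℝ) : ℝ :=
  Sum.elim X (Sum.elim v₁ v₂) ⬝ᵥ
    (fromBlocks (g.Q s) (g.S s)ᵀ (g.S s) (g.R s) *ᵥ Sum.elim X (Sum.elim v₁ v₂))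

/-- The cost along one path: `⟨G X(T), X(T)⟩ + ∫_t^T (running cost) ds`. -/
def pathCost (t : ℝ) (u₁ : ℝ → Fin m₁ → ℝ) (u₂ : ℝ → Fin m₂ → ℝ) (X : ℝ → Fin n → ℝ) : ℝ :=
  X g.T ⬝ᵥ (g.G *ᵥ X g.T) + ∫ s in t..g.T, g.runningCost s (X s) (u₁ s) (u₂ s)

section Game

variable {Ω : Type*} {mΩ : MeasurableSpace Ω} (μ : Measure Ω) (𝓕 : Filtration ℝ≥0 mΩ)

/-- The criterion `J(t,x;u₁,u₂)`: the expected cost. -/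
def J (t : ℝ) (x : Fin n → ℝ) (u₁ : ℝ → Ω → Fin m₁ → ℝ) (u₂ : ℝ → Ω → Fin m₂ → ℝ) : ℝ :=
  ∫ ω, g.pathCost t (fun s => u₁ s ω) (fun s => u₂ s ω)
    (g.statePath t x (fun s => u₁ s ω) (fun s => u₂ s ω)) ∂μ

/-- The open-loop lower value `V⁻(t,x) = sup_{u₂} inf_{u₁} J(t,x;u₁,u₂)`, in `[-∞,∞]`. -/
def lowerValue (t : ℝ) (x : Fin n → ℝ) : EReal :=
  ⨆ u₂ ∈ controls μ 𝓕 m₂ t g.T, ⨅ u₁ ∈ controls μ 𝓕 m₁ t g.T, (g.J μ t x u₁ u₂ : EReal)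

/-- The open-loop upper value `V⁺(t,x) = inf_{u₁} sup_{u₂} J(t,x;u₁,u₂)`, in `[-∞,∞]`. -/
def upperValue (t : ℝ) (x : Fin n → ℝ) : EReal :=
  ⨅ u₁ ∈ controls μ 𝓕 m₁ t g.T, ⨆ u₂ ∈ controls μ 𝓕 m₂ t g.T, (g.J μ t x u₁ u₂ : EReal)

/-- Both open-loop values are finite at every initial pair `(t,x) ∈ [0,T] × ℝⁿ`. -/
def FiniteValues : Prop :=
  ∀ t ∈ Icc 0 g.T, ∀ x : Fin n → ℝ,
    (g.lowerValue μ 𝓕 t x ≠ ⊥ ∧ g.lowerValue μ 𝓕 t x ≠ ⊤) ∧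
    (g.upperValue μ 𝓕 t x ≠ ⊥ ∧ g.upperValue μ 𝓕 t x ≠ ⊤)

/-- `(u₁, u₂)` is an open-loop saddle point for the initial pair `(t,x)`. -/
def IsSaddlePoint (t : ℝ) (x : Fin n → ℝ)
    (u₁ : ℝ → Ω → Fin m₁ → ℝ) (u₂ : ℝ → Ω → Fin m₂ → ℝ) : Prop :=
  u₁ ∈ controls μ 𝓕 m₁ t g.T ∧ u₂ ∈ controls μ 𝓕 m₂ t g.T ∧
  ∀ v₁ ∈ controls μ 𝓕 m₁ t g.T, ∀ v₂ ∈ controls μ 𝓕 m₂ t g.T,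
    g.J μ t x u₁ v₂ ≤ g.J μ t x u₁ u₂ ∧ g.J μ t x u₁ u₂ ≤ g.J μ t x v₁ u₂

/-- `(u₁, u₂)` is the unique open-loop saddle point for `(t,x)`; controls are identified when they
agree `ds ⊗ P`-almost everywhere on `[t,T] × Ω`. -/
def IsUniqueSaddlePoint (t : ℝ) (x : Fin n → ℝ)
    (u₁ : ℝ → Ω → Fin m₁ → ℝ) (u₂ : ℝ → Ω → Fin m₂ → ℝ) : Prop :=
  g.IsSaddlePoint μ 𝓕 t x u₁ u₂ ∧
  ∀ v₁ v₂, g.IsSaddlePoint μ 𝓕 t x v₁ v₂ →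
    ∀ᵐ p ∂((volume.restrict (Icc t g.T)).prod μ),
      v₁ p.1 p.2 = u₁ p.1 p.2 ∧ v₂ p.1 p.2 = u₂ p.1 p.2

end Game

/-- `PA + AᵀP + Q - (PB + Sᵀ) R⁻¹ (BᵀP + S)` at time `s`. -/
def riccatiRHS (s : ℝ) (P : Matrix (Fin n) (Fin n) ℝ) : Matrix (Fin n) (Fin n) ℝ :=
  P * g.A s + (g.A s)ᵀ * P + g.Q s
    - (P * g.B s + (g.S s)ᵀ) * (g.R s)⁻¹ * ((g.B s)ᵀ * P + g.S s)

/-- `P ∈ C([0,T]; 𝕊ⁿ)` solves `Ṗ + PA + AᵀP + Q - (PB + Sᵀ) R⁻¹ (BᵀP + S) = 0`, `P(T) = G`.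
As the coefficients are merely measurable, the equation is understood in the usual integrated
form `P(t) = G + ∫_t^T (…) ds` (entrywise), i.e. `P` is absolutely continuous and satisfies the
differential equation a.e. -/
def IsRiccatiSolution (P : ℝ → Matrix (Fin n) (Fin n) ℝ) : Prop :=
  ContinuousOn P (Icc 0 g.T) ∧ (∀ t ∈ Icc 0 g.T, (P t).IsSymm) ∧
  ∀ t ∈ Icc 0 g.T, ∀ i j,
    P t i j = g.G i j + ∫ s in t..g.T, g.riccatiRHS s (P s) i j

/-- The feedback gain `Θ = -R⁻¹ (BᵀP + S)`. -/
def feedback (P : ℝ → Matrix (Fin n) (Fin n) ℝ) (s : ℝ) : Matrix (Fin m₁ ⊕ Fin m₂) (Fin n) ℝ :=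
  -((g.R s)⁻¹ * ((g.B s)ᵀ * P s + g.S s))

/-- `X` solves the closed-loop system `dX = (A + B Θ) X ds` on `[t,T]`, `X(t) = x`. -/
def IsClosedLoopPath (P : ℝ → Matrix (Fin n) (Fin n) ℝ) (t : ℝ) (x : Fin n → ℝ)
    (X : ℝ → Fin n → ℝ) : Prop :=
  ContinuousOn X (Icc t g.T) ∧
  ∀ s ∈ Icc t g.T, X s = x + ∫ r in t..s, (g.A r + g.B r * g.feedback P r) *ᵥ X r

end LQGame

end

/-!
The cost along a path is a quadratic form in the pair (control, state); its polarization `costForm`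
is a symmetric bilinear form on trajectories of the controlled linear equation, and the criterion is
quadratic along lines of controls (`J_line`).

If the lower value is finite, then for some control of the second player the criterion is bounded
below in the control of the first player. Hence the cost form is nonnegative on the trajectories
from `0` driven by the first player alone, and where it vanishes the linear term vanishes as well
(`costForm_nonneg_of_lowerValue`); the upper value gives the same with the opposite sign for the
second player (`costForm_nonpos_of_upperValue`).

Since `⟨R u, (u₁, -u₂)⟩ ≥ α |u|²`, the weight `R` is invertible, and the Hamiltonian system has a
matrix solution `(M, N)` with terminal value `(I, G)`. The cost form of a trajectory `X` against a
solution of the Hamiltonian system with costate `η` is `⟨X(t), η(t)⟩`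
(`IsHamiltonian.costForm_eq`). If `M(t) ξ = 0`, the Hamiltonian solution starting from `M(t) ξ`
is therefore orthogonal, for the cost form, to all trajectories from `0`; splitting its control into
the parts of the two players, the sign conditions and finiteness force its costate to vanish
(`IsHamiltonian.costate_eq_zero`), so `ξ = 0`. Thus `M` is invertible on `[0,T]`, and `P = N M⁻¹`
solves the Riccati equation.

Completing the square with a Riccati solution `P` and `Θ = -R⁻¹ (Bᵀ P + S)`
(`IsRiccati.costForm_eq`) gives
`costForm = ⟨X(t), P(t) Y(t)⟩ + ∫ ⟨U - Θ X, R (V - Θ Y)⟩`.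
Evaluated at the closed-loop trajectories of two Riccati solutions, the same cost is expressed by
either of them, which gives uniqueness (`IsRiccati.unique`). The formula also shows
that the closed-loop control is a critical point of the criterion, hence a saddle point by the sign
conditions. Conversely, a saddle point is a critical point; testing with the direction whose
deviation from the feedback is `(z₁, -z₂)`, where `z = (z₁, z₂)` is the deviation of the saddle
point, gives `E ∫ |z|² = 0` (`IsRiccati.eq_feedback_of_expForm_eq_zero`), so the saddle point is the
closed-loop control.

All of this is carried out for Borel coefficients that satisfy the conditions at every time; a
game with essentially bounded coefficients agrees with such a game at almost every time
(`IsRegular.exists_isNormalized`), which changes neither the criterion nor the equations.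
-/

noncomputable section

/-! ### Primitives of integrable functions -/

/-- `F` is absolutely continuous on `[a,b]` with almost everywhere derivative `f`, in integrated
form: `f` is integrable and `F(s) = F(a) + ∫_a^s f` on `[a,b]`. -/
def IsPrimitiveOn (a b : ℝ) (F f : ℝ → ℝ) : Prop :=
  IntervalIntegrable f volume a b ∧ ∀ s ∈ Icc a b, F s = F a + ∫ r in a..s, f r

namespace IsPrimitiveOn

variable {a b : ℝ} {F G f g : ℝ → ℝ}

theorem intervalIntegrable_left (h : IsPrimitiveOn a b F f) {s : ℝ} (hs : s ∈ Icc a b) :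
    IntervalIntegrable f volume a s :=
  h.1.mono_set (by
    rw [uIcc_of_le hs.1, uIcc_of_le (hs.1.trans hs.2)]; exact Icc_subset_Icc_right hs.2)

theorem absolutelyContinuous (h : IsPrimitiveOn a b F f) :
    AbsolutelyContinuousOnInterval (fun s => F a + ∫ r in a..s, f r) a b := by
  have h1 := h.1.absolutelyContinuousOnInterval_intervalIntegral (c := a) (by simp)
  have h2 : AbsolutelyContinuousOnInterval (fun _ : ℝ => F a) a b :=
    (LipschitzOnWith.absolutelyContinuousOnInterval (K := 0)
      (LipschitzWith.const (F a)).lipschitzOnWith)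
  exact h2.add h1

theorem continuousOn (h : IsPrimitiveOn a b F f) (hab : a ≤ b) : ContinuousOn F (Icc a b) := by
  have := (h.absolutelyContinuous).continuousOn
  rw [uIcc_of_le hab] at this
  exact this.congr h.2

theorem mono (h : IsPrimitiveOn a b F f) {c : ℝ} (hc : c ∈ Icc a b) : IsPrimitiveOn c b F f := by
  have hcb : IntervalIntegrable f volume c b := h.1.mono_set (by
    rw [uIcc_of_le hc.2, uIcc_of_le (hc.1.trans hc.2)]; exact Icc_subset_Icc_left hc.1)
  refine ⟨hcb, fun s hs => ?_⟩
  have hs' : s ∈ Icc a b := ⟨hc.1.trans hs.1, hs.2⟩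
  rw [h.2 s hs', h.2 c hc, add_assoc, intervalIntegral.integral_add_adjacent_intervals
    (h.intervalIntegrable_left hc)]
  exact (h.intervalIntegrable_left hc).symm.trans (h.intervalIntegrable_left hs')

theorem sub_eq (h : IsPrimitiveOn a b F f) (hab : a ≤ b) : ∫ r in a..b, f r = F b - F a := by
  rw [h.2 b ⟨hab, le_rfl⟩]; ring

theorem congr (h : IsPrimitiveOn a b F f) (hab : a ≤ b) (hF : EqOn F G (Icc a b))
    (hf : ∀ᵐ s, s ∈ Icc a b → f s = g s) : IsPrimitiveOn a b G g := by
  refine ⟨h.1.congr_ae ?_, fun s hs => ?_⟩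
  · rw [uIoc_of_le hab]
    filter_upwards [ae_restrict_of_ae hf, ae_restrict_mem measurableSet_Ioc] with s h1 h2
    exact h1 (Ioc_subset_Icc_self h2)
  · rw [← hF hs, ← hF ⟨le_rfl, hab⟩, h.2 s hs]
    congr 1
    refine intervalIntegral.integral_congr_ae ?_
    filter_upwards [hf] with r hr hrs
    rw [uIoc_of_le hs.1] at hrs
    exact hr ⟨hrs.1.le, hrs.2.trans hs.2⟩

theorem congr_deriv (h : IsPrimitiveOn a b F f) (hf : ∀ s ∈ Icc a b, f s = g s) (hab : a ≤ b) :
    IsPrimitiveOn a b F g :=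
  h.congr hab (fun _ _ => rfl) (.of_forall hf)

theorem const (c : ℝ) : IsPrimitiveOn a b (fun _ => c) (fun _ => 0) :=
  ⟨by simp, fun s _ => by simp⟩

theorem add (hF : IsPrimitiveOn a b F f) (hG : IsPrimitiveOn a b G g) :
    IsPrimitiveOn a b (fun s => F s + G s) (fun s => f s + g s) :=
  ⟨hF.1.add hG.1, fun s hs => by
    rw [intervalIntegral.integral_add (hF.intervalIntegrable_left hs)
      (hG.intervalIntegrable_left hs)]
    beta_reduce
    rw [hF.2 s hs, hG.2 s hs]; ring⟩

theorem const_mul (c : ℝ) (hF : IsPrimitiveOn a b F f) :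
    IsPrimitiveOn a b (fun s => c * F s) (fun s => c * f s) :=
  ⟨hF.1.const_mul c, fun s hs => by
    rw [intervalIntegral.integral_const_mul]
    beta_reduce
    rw [hF.2 s hs]; ring⟩

theorem sum {ι : Type*} (t : Finset ι) {F f : ι → ℝ → ℝ}
    (h : ∀ i ∈ t, IsPrimitiveOn a b (F i) (f i)) :
    IsPrimitiveOn a b (fun s => ∑ i ∈ t, F i s) (fun s => ∑ i ∈ t, f i s) := by
  classical
  induction t using Finset.induction_on with
  | empty => simpa using const 0
  | insert i t hi ih =>
    simp only [Finset.sum_insert hi]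
    exact (h i (Finset.mem_insert_self i t)).add
      (ih fun j hj => h j (Finset.mem_insert_of_mem hj))

/-- The product rule for absolutely continuous functions. -/
theorem mul (hF : IsPrimitiveOn a b F f) (hG : IsPrimitiveOn a b G g) (hab : a ≤ b) :
    IsPrimitiveOn a b (fun s => F s * G s) (fun s => f s * G s + F s * g s) := by
  have cF := hF.continuousOn hab
  have cG := hG.continuousOn hab
  rw [← uIcc_of_le hab] at cF cG
  refine ⟨(hF.1.mul_continuousOn cG).add (hG.1.continuousOn_mul cF), fun s hs => ?_⟩
  have hsub : uIcc a s ⊆ uIcc a b := by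
    rw [uIcc_of_le hs.1, uIcc_of_le hab]; exact Icc_subset_Icc_right hs.2
  have key := ((hF.absolutelyContinuous).mono hsub).integral_deriv_mul_eq_sub
    ((hG.absolutelyContinuous).mono hsub)
  have e : ∫ x in a..s, (deriv (fun s => F a + ∫ r in a..s, f r) x * (G a + ∫ r in a..x, g r) +
      (F a + ∫ r in a..x, f r) * deriv (fun s => G a + ∫ r in a..s, g r) x) =
      ∫ x in a..s, (f x * G x + F x * g x) := by
    refine intervalIntegral.integral_congr_ae ?_
    filter_upwards [hF.1.ae_hasDerivAt_integral, hG.1.ae_hasDerivAt_integral] with x h1 h2 hx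
    have hx' : x ∈ Icc a b := by
      rw [uIoc_of_le hs.1] at hx; exact ⟨hx.1.le, hx.2.trans hs.2⟩
    have hx'' : x ∈ uIcc a b := by rwa [uIcc_of_le hab]
    rw [((h1 hx'' a (by simp)).const_add (F a)).deriv,
      ((h2 hx'' a (by simp)).const_add (G a)).deriv, ← hF.2 x hx', ← hG.2 x hx']
  rw [← e, key, ← hF.2 s hs, ← hG.2 s hs]
  simp

theorem eqOn_of_zero (hF : IsPrimitiveOn a b F (fun _ => 0)) : ∀ s ∈ Icc a b, F s = F a :=
  fun s hs => by rw [hF.2 s hs]; simp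

end IsPrimitiveOn

/-! ### Bounded measurable coefficients -/

/-- `f` is Borel measurable and bounded on `[0,T]`. -/
def IsBddMeas (T : ℝ) (f : ℝ → ℝ) : Prop :=
  Measurable f ∧ ∃ C, ∀ s ∈ Icc 0 T, |f s| ≤ C

namespace IsBddMeas

variable {T : ℝ} {f g : ℝ → ℝ}

theorem const (c : ℝ) : IsBddMeas T (fun _ => c) := ⟨measurable_const, |c|, fun _ _ => le_rfl⟩

theorem add (hf : IsBddMeas T f) (hg : IsBddMeas T g) : IsBddMeas T (fun s => f s + g s) := by
  obtain ⟨hf, C, hC⟩ := hf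
  obtain ⟨hg, D, hD⟩ := hg
  exact ⟨hf.add hg, C + D, fun s hs => (abs_add_le _ _).trans (add_le_add (hC s hs) (hD s hs))⟩

theorem mul (hf : IsBddMeas T f) (hg : IsBddMeas T g) : IsBddMeas T (fun s => f s * g s) := by
  obtain ⟨hf, C, hC⟩ := hf
  obtain ⟨hg, D, hD⟩ := hg
  refine ⟨hf.mul hg, C * D, fun s hs => ?_⟩
  rw [abs_mul]
  exact mul_le_mul (hC s hs) (hD s hs) (abs_nonneg _) ((abs_nonneg _).trans (hC s hs))

theorem neg (hf : IsBddMeas T f) : IsBddMeas T (fun s => -f s) := by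
  simpa using (const (-1)).mul hf

theorem sub (hf : IsBddMeas T f) (hg : IsBddMeas T g) : IsBddMeas T (fun s => f s - g s) := by
  simpa [sub_eq_add_neg] using hf.add hg.neg

theorem sum {ι : Type*} (t : Finset ι) {f : ι → ℝ → ℝ} (h : ∀ i ∈ t, IsBddMeas T (f i)) :
    IsBddMeas T (fun s => ∑ i ∈ t, f i s) := by
  classical
  induction t using Finset.induction_on with
  | empty => simpa using const 0
  | insert i t hi ih =>
    simp only [Finset.sum_insert hi]
    exact (h i (Finset.mem_insert_self i t)).add
      (ih fun j hj => h j (Finset.mem_insert_of_mem hj))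

theorem of_continuous (hf : Continuous f) : IsBddMeas T f := by
  obtain ⟨C, hC⟩ := isCompact_Icc.exists_bound_of_continuousOn (s := Icc 0 T) hf.continuousOn
  exact ⟨hf.measurable, C, fun s hs => hC s hs⟩

theorem ae_bound (hf : IsBddMeas T f) {t : ℝ} (ht : 0 ≤ t) :
    ∃ C, ∀ᵐ s ∂(volume.restrict (Icc t T)), ‖f s‖ ≤ C := by
  obtain ⟨_, C, hC⟩ := hf
  refine ⟨C, ?_⟩
  filter_upwards [ae_restrict_mem measurableSet_Icc] with s hs
  exact hC s ⟨ht.trans hs.1, hs.2⟩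

end IsBddMeas

/-- Every entry of the matrix function `M` is Borel measurable and bounded on `[0,T]`. -/
def IsBddMeasMat {p q : Type*} (T : ℝ) (M : ℝ → Matrix p q ℝ) : Prop :=
  ∀ i j, IsBddMeas T (fun s => M s i j)

namespace IsBddMeasMat

variable {p q r : Type*} {T : ℝ}

theorem const (M : Matrix p q ℝ) : IsBddMeasMat T (fun _ => M) := fun _ _ => IsBddMeas.const _

theorem add {M N : ℝ → Matrix p q ℝ} (hM : IsBddMeasMat T M) (hN : IsBddMeasMat T N) :
    IsBddMeasMat T (fun s => M s + N s) := fun i j => (hM i j).add (hN i j)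

theorem sub {M N : ℝ → Matrix p q ℝ} (hM : IsBddMeasMat T M) (hN : IsBddMeasMat T N) :
    IsBddMeasMat T (fun s => M s - N s) := fun i j => (hM i j).sub (hN i j)

theorem neg {M : ℝ → Matrix p q ℝ} (hM : IsBddMeasMat T M) :
    IsBddMeasMat T (fun s => -M s) := fun i j => (hM i j).neg

theorem transpose {M : ℝ → Matrix p q ℝ} (hM : IsBddMeasMat T M) :
    IsBddMeasMat T (fun s => (M s)ᵀ) := fun i j => hM j i

theorem mul [Fintype q] {M : ℝ → Matrix p q ℝ} {N : ℝ → Matrix q r ℝ} (hM : IsBddMeasMat T M)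
    (hN : IsBddMeasMat T N) : IsBddMeasMat T (fun s => M s * N s) := fun i j => by
  simp only [Matrix.mul_apply]
  exact IsBddMeas.sum _ fun k _ => (hM i k).mul (hN k j)

theorem of_continuous {M : ℝ → Matrix p q ℝ} (hM : ∀ i j, Continuous fun s => M s i j) :
    IsBddMeasMat T M := fun i j => IsBddMeas.of_continuous (hM i j)

theorem fromBlocks {p' q' : Type*} {A : ℝ → Matrix p q ℝ} {B : ℝ → Matrix p q' ℝ}
    {C : ℝ → Matrix p' q ℝ} {D : ℝ → Matrix p' q' ℝ} (hA : IsBddMeasMat T A)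
    (hB : IsBddMeasMat T B) (hC : IsBddMeasMat T C) (hD : IsBddMeasMat T D) :
    IsBddMeasMat T (fun s => Matrix.fromBlocks (A s) (B s) (C s) (D s)) := by
  rintro (i | i) (j | j)
  exacts [hA i j, hB i j, hC i j, hD i j]

/-- A uniform bound in the supremum norm: `‖M(s) v‖ ≤ L ‖v‖` on `[0,T]`. -/
theorem exists_norm_mulVec_le [Fintype p] [Fintype q] {M : ℝ → Matrix p q ℝ}
    (hM : IsBddMeasMat T M) :
    ∃ L : ℝ, 0 ≤ L ∧ ∀ s ∈ Icc 0 T, ∀ v : q → ℝ, ‖M s *ᵥ v‖ ≤ L * ‖v‖ := by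
  choose hm C hC using hM
  refine ⟨∑ i, ∑ j, |C i j|, by positivity, fun s hs v => ?_⟩
  refine (pi_norm_le_iff_of_nonneg (by positivity)).2 fun i => ?_
  calc ‖(M s *ᵥ v) i‖ ≤ ∑ j, ‖M s i j * v j‖ := norm_sum_le _ _
    _ ≤ ∑ j, |C i j| * ‖v‖ := by
      refine Finset.sum_le_sum fun j _ => ?_
      rw [norm_mul]
      exact mul_le_mul ((hC i j s hs).trans (le_abs_self _)) (norm_le_pi_norm v j) (norm_nonneg _)
        (abs_nonneg _)
    _ = (∑ j, |C i j|) * ‖v‖ := by rw [Finset.sum_mul]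
    _ ≤ (∑ i, ∑ j, |C i j|) * ‖v‖ := by
      refine mul_le_mul_of_nonneg_right ?_ (norm_nonneg _)
      exact Finset.single_le_sum (f := fun i => ∑ j, |C i j|)
        (fun k _ => by positivity) (Finset.mem_univ i)

theorem measurable_mulVec [Fintype q] {M : ℝ → Matrix p q ℝ} (hM : IsBddMeasMat T M)
    {v : ℝ → q → ℝ} (hv : Measurable v) : Measurable fun s => M s *ᵥ v s := by
  refine measurable_pi_lambda _ fun i => ?_
  simp only [Matrix.mulVec, dotProduct]
  exact Finset.measurable_sum _ fun j _ => (hM i j).1.mul ((measurable_pi_apply j).comp hv)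

end IsBddMeasMat

/-! ### Linear differential equations with bounded measurable coefficients -/

section LinearODE

variable {ι : Type*} [Fintype ι] {T : ℝ}

/-- Carathéodory existence for `X' = K X`. With the weight `e^{-λs}` on the solution, the Picard
operator is a contraction of `C([0,T])` as soon as `λ` exceeds the bound on `K`. -/
theorem exists_linearODE_solution (hT : 0 ≤ T) {K : ℝ → Matrix ι ι ℝ} (hK : IsBddMeasMat T K)
    (x : ι → ℝ) :
    ∃ X : ℝ → ι → ℝ, Continuous X ∧ X 0 = x ∧
      ∀ s ∈ Icc 0 T, X s = x + ∫ r in (0:ℝ)..s, K r *ᵥ X r := by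
  obtain ⟨L, hL0, hL⟩ := hK.exists_norm_mulVec_le
  set l : ℝ := L + 1 with hl
  have hl0 : 0 < l := by positivity
  let ext : C(Icc 0 T, ι → ℝ) → ℝ → ι → ℝ := fun Z => IccExtend hT Z
  have hext : ∀ Z, Continuous (ext Z) := fun Z => Z.continuous.Icc_extend'
  let φ : C(Icc 0 T, ι → ℝ) → ℝ → ι → ℝ := fun Z r => Real.exp (l * r) • (K r *ᵥ ext Z r)
  have hφm : ∀ Z, Measurable (φ Z) := fun Z =>
    (by fun_prop : Measurable fun r : ℝ => Real.exp (l * r)).smul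
      (hK.measurable_mulVec (hext Z).measurable)
  have hφb : ∀ Z, ∀ r ∈ Icc 0 T, ‖φ Z r‖ ≤ Real.exp (l * T) * (L * ‖Z‖) := by
    intro Z r hr
    simp only [φ, norm_smul, Real.norm_eq_abs, Real.abs_exp]
    refine mul_le_mul (Real.exp_le_exp.2 (mul_le_mul_of_nonneg_left hr.2 hl0.le)) ?_
      (norm_nonneg _) (Real.exp_pos _).le
    exact (hL r hr _).trans (mul_le_mul_of_nonneg_left (Z.norm_coe_le_norm _) hL0)
  have hφi : ∀ Z, IntegrableOn (φ Z) (Icc 0 T) := fun Z =>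
    Measure.integrableOn_of_bounded (M := Real.exp (l * T) * (L * ‖Z‖)) (by simp)
      (hφm Z).aestronglyMeasurable
      (by filter_upwards [ae_restrict_mem measurableSet_Icc] with r hr using hφb Z r hr)
  have hφs : ∀ Z, ∀ s ∈ Icc 0 T, IntervalIntegrable (φ Z) volume 0 s := fun Z s hs =>
    (intervalIntegrable_iff_integrableOn_Icc_of_le hs.1).2
      ((hφi Z).mono_set (Icc_subset_Icc_right hs.2))
  let Φ : C(Icc 0 T, ι → ℝ) → C(Icc 0 T, ι → ℝ) := fun Z =>
    { toFun := fun s => Real.exp (-(l * s)) • (x + ∫ r in (0:ℝ)..s, φ Z r)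
      continuous_toFun := by
        have h1 : ContinuousOn (fun s => ∫ r in (0:ℝ)..s, φ Z r) (Icc 0 T) := by
          have := intervalIntegral.continuousOn_primitive_interval (f := φ Z) (a := 0) (b := T)
            (μ := volume) (by rw [uIcc_of_le hT]; exact hφi Z)
          rwa [uIcc_of_le hT] at this
        have h2 := continuousOn_iff_continuous_domRestrict.1 h1
        exact (by fun_prop : Continuous fun s : Icc 0 T => Real.exp (-(l * s))).smul
          (continuous_const.add h2) }
  have hcontr : ContractingWith (Real.toNNReal (L / l)) Φ := by
    refine ⟨?_, ?_⟩
    · rw [Real.toNNReal_lt_one, div_lt_one hl0]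
      simp [hl]
    · refine LipschitzWith.of_dist_le_mul fun Z W => ?_
      rw [Real.coe_toNNReal _ (by positivity)]
      refine (ContinuousMap.dist_le (by positivity)).2 fun s => ?_
      obtain ⟨s, hs⟩ := s
      have e : Φ Z ⟨s, hs⟩ - Φ W ⟨s, hs⟩ =
          Real.exp (-(l * s)) • ∫ r in (0:ℝ)..s, (φ Z r - φ W r) := by
        rw [intervalIntegral.integral_sub (hφs Z s hs) (hφs W s hs)]
        simp only [Φ, ContinuousMap.coe_mk]
        rw [← smul_sub]; congr 1; abel
      have hb : ∀ r ∈ Icc 0 T, ‖φ Z r - φ W r‖ ≤ L * dist Z W * Real.exp (l * r) := by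
        intro r hr
        simp only [φ]
        rw [← smul_sub, ← Matrix.mulVec_sub, norm_smul, Real.norm_eq_abs, Real.abs_exp, mul_comm]
        refine mul_le_mul_of_nonneg_right ((hL r hr _).trans ?_) (Real.exp_pos _).le
        refine mul_le_mul_of_nonneg_left ?_ hL0
        rw [← dist_eq_norm]
        exact ContinuousMap.dist_apply_le_dist _
      have hi : ‖∫ r in (0:ℝ)..s, (φ Z r - φ W r)‖ ≤
          ∫ r in (0:ℝ)..s, L * dist Z W * Real.exp (l * r) := by
        refine intervalIntegral.norm_integral_le_of_norm_le hs.1 (.of_forall fun r hr => ?_) ?_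
        · exact hb r ⟨hr.1.le, hr.2.trans hs.2⟩
        · exact Continuous.intervalIntegrable (by fun_prop) _ _
      have hint : ∫ r in (0:ℝ)..s, L * dist Z W * Real.exp (l * r) =
          L * dist Z W * ((Real.exp (l * s) - 1) / l) := by
        rw [intervalIntegral.integral_const_mul,
          intervalIntegral.integral_comp_mul_left (f := Real.exp) hl0.ne', integral_exp]
        rw [mul_zero, Real.exp_zero, smul_eq_mul, inv_mul_eq_div]
      rw [dist_eq_norm, e, norm_smul, Real.norm_eq_abs, Real.abs_exp]
      calc Real.exp (-(l * s)) * ‖∫ r in (0:ℝ)..s, (φ Z r - φ W r)‖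
          ≤ Real.exp (-(l * s)) * (L * dist Z W * ((Real.exp (l * s) - 1) / l)) :=
            mul_le_mul_of_nonneg_left (hi.trans_eq hint) (Real.exp_pos _).le
        _ = L / l * dist Z W * (1 - Real.exp (-(l * s))) := by
            have : Real.exp (-(l * s)) * Real.exp (l * s) = 1 := by
              rw [← Real.exp_add]; simp
            field_simp
            linear_combination L * dist Z W * this
        _ ≤ L / l * dist Z W * 1 := by
            refine mul_le_mul_of_nonneg_left ?_ (by positivity)
            linarith [Real.exp_pos (-(l * s))]
        _ = L / l * dist Z W := mul_one _
  have hfix : Φ (hcontr.fixedPoint Φ) = hcontr.fixedPoint Φ := hcontr.fixedPoint_isFixedPt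
  set Z := hcontr.fixedPoint Φ with hZ
  have hval : ∀ s ∈ Icc 0 T, Real.exp (l * s) • ext Z s = x + ∫ r in (0:ℝ)..s, φ Z r := by
    intro s hs
    have h1 : ext Z s = Real.exp (-(l * s)) • (x + ∫ r in (0:ℝ)..s, φ Z r) := by
      simp only [ext]
      rw [IccExtend_of_mem hT _ hs]
      conv_lhs => rw [← hfix]
      rfl
    rw [h1, smul_smul, ← Real.exp_add]; simp
  refine ⟨fun s => Real.exp (l * s) • ext Z s,
    (by fun_prop : Continuous fun s => Real.exp (l * s)).smul (hext Z), ?_, fun s hs => ?_⟩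
  · exact (hval 0 ⟨le_rfl, hT⟩).trans (by simp)
  · refine (hval s hs).trans ?_
    simp only [φ, Matrix.mulVec_smul]

end LinearODE

namespace IsPrimitiveOn

variable {p q r : Type*} [Fintype q] {a b : ℝ}

theorem matrix_mul {M m : ℝ → Matrix p q ℝ} {N k : ℝ → Matrix q r ℝ}
    (hM : ∀ i j, IsPrimitiveOn a b (fun s => M s i j) (fun s => m s i j))
    (hN : ∀ i j, IsPrimitiveOn a b (fun s => N s i j) (fun s => k s i j)) (hab : a ≤ b) (i : p)
    (j : r) : IsPrimitiveOn a b (fun s => (M s * N s) i j)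
      (fun s => (m s * N s + M s * k s) i j) := by
  simp only [Matrix.add_apply, Matrix.mul_apply, ← Finset.sum_add_distrib]
  exact sum _ fun l _ => (hM i l).mul (hN l j) hab

theorem matrix_mul_const {M m : ℝ → Matrix p q ℝ}
    (hM : ∀ i j, IsPrimitiveOn a b (fun s => M s i j) (fun s => m s i j)) (C : Matrix q r ℝ)
    (i : p) (j : r) : IsPrimitiveOn a b (fun s => (M s * C) i j) (fun s => (m s * C) i j) := by
  simp only [Matrix.mul_apply]
  exact sum _ fun l _ => by simpa only [mul_comm] using (hM i l).const_mul (C l j)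

theorem const_matrix_mul (C : Matrix p q ℝ) {M m : ℝ → Matrix q r ℝ}
    (hM : ∀ i j, IsPrimitiveOn a b (fun s => M s i j) (fun s => m s i j))
    (i : p) (j : r) : IsPrimitiveOn a b (fun s => (C * M s) i j) (fun s => (C * m s) i j) := by
  simp only [Matrix.mul_apply]
  exact sum _ fun l _ => (hM l j).const_mul (C i l)

theorem mulVec {M m : ℝ → Matrix p q ℝ} {X x : ℝ → q → ℝ}
    (hM : ∀ i j, IsPrimitiveOn a b (fun s => M s i j) (fun s => m s i j))
    (hX : ∀ i, IsPrimitiveOn a b (fun s => X s i) (fun s => x s i)) (hab : a ≤ b) (i : p) :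
    IsPrimitiveOn a b (fun s => (M s *ᵥ X s) i) (fun s => (m s *ᵥ X s + M s *ᵥ x s) i) := by
  simp only [Pi.add_apply, Matrix.mulVec, dotProduct, ← Finset.sum_add_distrib]
  exact sum _ fun l _ => (hM i l).mul (hX l) hab

theorem dotProduct {X x Y y : ℝ → q → ℝ}
    (hX : ∀ i, IsPrimitiveOn a b (fun s => X s i) (fun s => x s i))
    (hY : ∀ i, IsPrimitiveOn a b (fun s => Y s i) (fun s => y s i)) (hab : a ≤ b) :
    IsPrimitiveOn a b (fun s => X s ⬝ᵥ Y s) (fun s => x s ⬝ᵥ Y s + X s ⬝ᵥ y s) := by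
  simp only [_root_.dotProduct, ← Finset.sum_add_distrib]
  exact sum _ fun l _ => (hX l).mul (hY l) hab

end IsPrimitiveOn

section LinearODE

variable {ι : Type*} [Fintype ι] [DecidableEq ι] {T : ℝ}

/-- `Φ` is a fundamental matrix of `X' = K X` on `[0,T]`, and `Ψ` is its inverse, which solves
`Ψ' = -Ψ K`. Both are taken continuous on the whole line. -/
structure IsFundamentalPair (T : ℝ) (K Φ Ψ : ℝ → Matrix ι ι ℝ) : Prop where
  continuous_left : ∀ i j, Continuous fun s => Φ s i j
  continuous_right : ∀ i j, Continuous fun s => Ψ s i j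
  left : ∀ i j, IsPrimitiveOn 0 T (fun s => Φ s i j) (fun s => (K s * Φ s) i j)
  right : ∀ i j, IsPrimitiveOn 0 T (fun s => Ψ s i j) (fun s => (-(Ψ s * K s)) i j)
  right_mul_left : ∀ s ∈ Icc 0 T, Ψ s * Φ s = 1

theorem exists_fundamentalMatrix (hT : 0 ≤ T) {K : ℝ → Matrix ι ι ℝ} (hK : IsBddMeasMat T K) :
    ∃ Φ : ℝ → Matrix ι ι ℝ, (∀ i j, Continuous fun s => Φ s i j) ∧ Φ 0 = 1 ∧
      ∀ i j, IsPrimitiveOn 0 T (fun s => Φ s i j) (fun s => (K s * Φ s) i j) := by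
  choose X hXc hX0 hX using fun j : ι => exists_linearODE_solution hT hK (Pi.single j 1)
  have hXc' : ∀ i j, Continuous fun s => X j s i := fun i j => (continuous_apply i).comp (hXc j)
  refine ⟨fun s => Matrix.of fun i j => X j s i, hXc', ?_, fun i j => ?_⟩
  · ext i j
    simp [hX0, Matrix.one_apply, Pi.single_apply]
  · have hb : IsBddMeasMat T fun s => K s * Matrix.of fun i j => X j s i :=
      hK.mul (IsBddMeasMat.of_continuous hXc')
    have hi : ∀ i, IntegrableOn (fun s => (K s *ᵥ X j s) i) (Icc 0 T) := fun i => by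
      obtain ⟨C, hC⟩ := (hb i j).ae_bound le_rfl
      exact Measure.integrableOn_of_bounded (M := C) (by simp) (hb i j).1.aestronglyMeasurable hC
    refine ⟨(intervalIntegrable_iff_integrableOn_Icc_of_le hT).2 (hi i), fun s hs => ?_⟩
    have := congrFun (hX j s hs) i
    rw [Pi.add_apply, intervalIntegral.integral_of_le hs.1,
      eval_integral fun k => (hi k).mono_set (Ioc_subset_Icc_self.trans
        (Icc_subset_Icc_right hs.2)), ← intervalIntegral.integral_of_le hs.1] at this
    refine this.trans ?_
    simp only [Matrix.of_apply, hX0]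
    rfl

theorem exists_fundamentalPair (hT : 0 ≤ T) {K : ℝ → Matrix ι ι ℝ} (hK : IsBddMeasMat T K) :
    ∃ Φ Ψ, IsFundamentalPair T K Φ Ψ := by
  obtain ⟨Φ, hΦc, hΦ0, hΦ⟩ := exists_fundamentalMatrix hT hK
  obtain ⟨Y, hYc, hY0, hY⟩ := exists_fundamentalMatrix hT hK.transpose.neg
  have hΨ : ∀ i j, IsPrimitiveOn 0 T (fun s => (Y s)ᵀ i j) (fun s => (-((Y s)ᵀ * K s)) i j) := by
    intro i j
    refine (hY j i).congr_deriv (fun s _ => ?_) hT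
    change ((-(K s)ᵀ * Y s)ᵀ) i j = _
    rw [Matrix.transpose_mul, Matrix.transpose_neg, Matrix.transpose_transpose, Matrix.mul_neg]
  refine ⟨Φ, fun s => (Y s)ᵀ, hΦc, fun i j => hYc j i, hΦ, hΨ, fun s hs => ?_⟩
  ext i j
  have h0 : IsPrimitiveOn 0 T (fun s => ((Y s)ᵀ * Φ s) i j) (fun _ => 0) := by
    refine (IsPrimitiveOn.matrix_mul hΨ hΦ hT i j).congr_deriv (fun s _ => ?_) hT
    simp [Matrix.mul_assoc]
  rw [h0.eqOn_of_zero s hs, hΦ0, hY0]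
  simp

namespace IsFundamentalPair

variable {K Φ Ψ : ℝ → Matrix ι ι ℝ}

theorem left_mul_right (h : IsFundamentalPair T K Φ Ψ) {s : ℝ} (hs : s ∈ Icc 0 T) :
    Φ s * Ψ s = 1 := mul_eq_one_comm.1 (h.right_mul_left s hs)

/-- Variation of constants: a solution of `X' = K X + f` satisfies `(Ψ X)' = Ψ f`. -/
theorem variation_of_constants (h : IsFundamentalPair T K Φ Ψ) {t : ℝ} (ht : t ∈ Icc 0 T)
    {X f : ℝ → ι → ℝ}
    (hX : ∀ i, IsPrimitiveOn t T (fun s => X s i) (fun s => (K s *ᵥ X s + f s) i)) (i : ι) :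
    IsPrimitiveOn t T (fun s => (Ψ s *ᵥ X s) i) (fun s => (Ψ s *ᵥ f s) i) := by
  refine (IsPrimitiveOn.mulVec (fun i j => (h.right i j).mono ht) hX ht.2 i).congr_deriv
    (fun s _ => ?_) ht.2
  rw [Matrix.mulVec_add, Matrix.mulVec_mulVec, Matrix.neg_mulVec, neg_add_cancel_left]

theorem eq_of_isPrimitiveOn (h : IsFundamentalPair T K Φ Ψ) {t : ℝ} (ht : t ∈ Icc 0 T)
    {X f : ℝ → ι → ℝ}
    (hX : ∀ i, IsPrimitiveOn t T (fun s => X s i) (fun s => (K s *ᵥ X s + f s) i)) {s : ℝ}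
    (hs : s ∈ Icc t T) :
    X s = Φ s *ᵥ (Ψ t *ᵥ X t + fun i => ∫ r in t..s, (Ψ r *ᵥ f r) i) := by
  have hs0 : s ∈ Icc 0 T := ⟨ht.1.trans hs.1, hs.2⟩
  have e : Ψ s *ᵥ X s = Ψ t *ᵥ X t + fun i => ∫ r in t..s, (Ψ r *ᵥ f r) i := by
    ext i
    exact (h.variation_of_constants ht hX i).2 s hs
  rw [← e, Matrix.mulVec_mulVec, h.left_mul_right hs0, Matrix.one_mulVec]

/-- The variation of constants formula does define a solution. -/
theorem isPrimitiveOn_formula (h : IsFundamentalPair T K Φ Ψ) {t : ℝ} (ht : t ∈ Icc 0 T)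
    (c : ι → ℝ) {f : ℝ → ι → ℝ} (hf : ∀ i, IntervalIntegrable (fun s => f s i) volume t T) (i : ι) :
    IsPrimitiveOn t T (fun s => (Φ s *ᵥ (c + fun i => ∫ r in t..s, (Ψ r *ᵥ f r) i)) i)
      (fun s => (K s *ᵥ (Φ s *ᵥ (c + fun i => ∫ r in t..s, (Ψ r *ᵥ f r) i)) + f s) i) := by
  have hg : ∀ i, IsPrimitiveOn t T (fun s => (c + fun i => ∫ r in t..s, (Ψ r *ᵥ f r) i) i)
      (fun s => (Ψ s *ᵥ f s) i) := by
    intro i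
    refine ⟨?_, fun s _ => by simp⟩
    simp only [Matrix.mulVec, dotProduct]
    have := IntervalIntegrable.sum Finset.univ fun j _ =>
      (hf j).continuousOn_mul (h.continuous_right i j).continuousOn
    simpa only [Finset.sum_fn] using this
  refine (IsPrimitiveOn.mulVec (fun i j => (h.left i j).mono ht) hg ht.2 i).congr_deriv
    (fun s hs => ?_) ht.2
  have hs0 : s ∈ Icc 0 T := ⟨ht.1.trans hs.1, hs.2⟩
  rw [Matrix.mulVec_mulVec, h.left_mul_right hs0, Matrix.one_mulVec, Matrix.mulVec_mulVec]

end IsFundamentalPair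

end LinearODE

/-! ### Games with Borel coefficients -/

theorem measurable_matrix_det {ι : Type*} [Fintype ι] [DecidableEq ι] {M : ℝ → Matrix ι ι ℝ}
    (hM : ∀ i j, Measurable fun s => M s i j) : Measurable fun s => (M s).det := by
  simp only [Matrix.det_apply]
  exact Finset.measurable_sum _ fun σ _ =>
    (Finset.measurable_prod _ fun k _ => hM _ _).const_smul _

theorem measurable_matrix_inv_apply {ι : Type*} [Fintype ι] [DecidableEq ι]
    {M : ℝ → Matrix ι ι ℝ} (hM : ∀ i j, Measurable fun s => M s i j) (i j : ι) :
    Measurable fun s => (M s)⁻¹ i j := by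
  simp only [Matrix.inv_def, Matrix.smul_apply, Ring.inverse_eq_inv', smul_eq_mul,
    Matrix.adjugate_apply]
  refine (measurable_matrix_det hM).inv.mul (measurable_matrix_det fun k l => ?_)
  simp only [Matrix.updateRow_apply]
  split_ifs
  · exact measurable_const
  · exact hM k l

namespace LQGame

variable {n m₁ m₂ : ℕ}

/-- A game whose coefficients are Borel measurable and bounded on `[0,T]` and satisfy the symmetry
and definiteness conditions at every time, with `α` as the constant of definiteness. Every regular
game with `R₁₁ ≫ 0` and `R₂₂ ≪ 0` agrees almost everywhere with such a game. -/
structure IsNormalized (g : LQGame n m₁ m₂) (α : ℝ) : Prop where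
  T_pos : 0 < g.T
  A_bdd : IsBddMeasMat g.T g.A
  B₁_bdd : IsBddMeasMat g.T g.B₁
  B₂_bdd : IsBddMeasMat g.T g.B₂
  G_symm : g.Gᵀ = g.G
  Q_bdd : IsBddMeasMat g.T g.Q
  Q_symm : ∀ s, (g.Q s)ᵀ = g.Q s
  S₁_bdd : IsBddMeasMat g.T g.S₁
  S₂_bdd : IsBddMeasMat g.T g.S₂
  R₁₁_bdd : IsBddMeasMat g.T g.R₁₁
  R₁₂_bdd : IsBddMeasMat g.T g.R₁₂
  R₂₁_bdd : IsBddMeasMat g.T g.R₂₁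
  R₂₂_bdd : IsBddMeasMat g.T g.R₂₂
  R₁₁_symm : ∀ s, (g.R₁₁ s)ᵀ = g.R₁₁ s
  R₁₂_transpose : ∀ s, (g.R₁₂ s)ᵀ = g.R₂₁ s
  R₂₂_symm : ∀ s, (g.R₂₂ s)ᵀ = g.R₂₂ s
  α_pos : 0 < α
  R₁₁_pos : ∀ s, (g.R₁₁ s - α • (1 : Matrix (Fin m₁) (Fin m₁) ℝ)).PosSemidef
  R₂₂_neg : ∀ s, (-g.R₂₂ s - α • (1 : Matrix (Fin m₂) (Fin m₂) ℝ)).PosSemidef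

/-- The sign change `diag(I, -I)` on the control space of the two players. -/
def flip (u : Fin m₁ ⊕ Fin m₂ → ℝ) : Fin m₁ ⊕ Fin m₂ → ℝ :=
  Sum.elim (fun i => u (.inl i)) (fun i => -u (.inr i))

/-- The symmetric block matrix of the running cost. -/
def costMatrix (g : LQGame n m₁ m₂) (s : ℝ) :
    Matrix (Fin n ⊕ (Fin m₁ ⊕ Fin m₂)) (Fin n ⊕ (Fin m₁ ⊕ Fin m₂)) ℝ :=
  fromBlocks (g.Q s) (g.S s)ᵀ (g.S s) (g.R s)

theorem dotProduct_costMatrix_mulVec (g : LQGame n m₁ m₂) (s : ℝ) (X Y : Fin n → ℝ)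
    (U V : Fin m₁ ⊕ Fin m₂ → ℝ) :
    Sum.elim X U ⬝ᵥ (g.costMatrix s *ᵥ Sum.elim Y V) =
      X ⬝ᵥ (g.Q s *ᵥ Y + (g.S s)ᵀ *ᵥ V) + U ⬝ᵥ (g.S s *ᵥ Y + g.R s *ᵥ V) := by
  rw [costMatrix, Matrix.fromBlocks_mulVec, sumElim_dotProduct_sumElim]
  rfl

namespace IsNormalized

variable {g : LQGame n m₁ m₂} {α : ℝ}

theorem B_bdd (hg : g.IsNormalized α) : IsBddMeasMat g.T g.B := by
  rintro i (j | j)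
  exacts [hg.B₁_bdd i j, hg.B₂_bdd i j]

theorem S_bdd (hg : g.IsNormalized α) : IsBddMeasMat g.T g.S := by
  rintro (i | i) j
  exacts [hg.S₁_bdd i j, hg.S₂_bdd i j]

theorem R_bdd (hg : g.IsNormalized α) : IsBddMeasMat g.T g.R :=
  IsBddMeasMat.fromBlocks hg.R₁₁_bdd hg.R₁₂_bdd hg.R₂₁_bdd hg.R₂₂_bdd

theorem costMatrix_bdd (hg : g.IsNormalized α) : IsBddMeasMat g.T g.costMatrix :=
  IsBddMeasMat.fromBlocks hg.Q_bdd hg.S_bdd.transpose hg.S_bdd hg.R_bdd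

theorem R_symm (hg : g.IsNormalized α) (s : ℝ) : (g.R s)ᵀ = g.R s := by
  rw [R, Matrix.fromBlocks_transpose, hg.R₁₁_symm, hg.R₁₂_transpose, hg.R₂₂_symm,
    ← hg.R₁₂_transpose, Matrix.transpose_transpose]

theorem costMatrix_symm (hg : g.IsNormalized α) (s : ℝ) :
    (g.costMatrix s)ᵀ = g.costMatrix s := by
  rw [costMatrix, Matrix.fromBlocks_transpose, hg.Q_symm, hg.R_symm, Matrix.transpose_transpose]

/-- The off-diagonal blocks cancel in `⟨R u, (u₁, -u₂)⟩`, which is therefore coercive. -/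
theorem R_coercive (hg : g.IsNormalized α) (s : ℝ) (u : Fin m₁ ⊕ Fin m₂ → ℝ) :
    α * (u ⬝ᵥ u) ≤ flip u ⬝ᵥ (g.R s *ᵥ u) := by
  obtain ⟨u₁, u₂, rfl⟩ : ∃ u₁ u₂, u = Sum.elim u₁ u₂ :=
    ⟨u ∘ .inl, u ∘ .inr, (Sum.elim_comp_inl_inr u).symm⟩
  have h1 := (hg.R₁₁_pos s).dotProduct_mulVec_nonneg u₁
  have h2 := (hg.R₂₂_neg s).dotProduct_mulVec_nonneg u₂
  have h3 : u₁ ⬝ᵥ (g.R₁₂ s *ᵥ u₂) = u₂ ⬝ᵥ (g.R₂₁ s *ᵥ u₁) := by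
    rw [← hg.R₁₂_transpose, Matrix.mulVec_transpose, Matrix.dotProduct_mulVec, dotProduct_comm]
  have hf : flip (Sum.elim u₁ u₂) = Sum.elim u₁ (-u₂) := rfl
  rw [hf, R, Matrix.fromBlocks_mulVec, sumElim_dotProduct_sumElim, sumElim_dotProduct_sumElim]
  simp only [Sum.elim_comp_inl, Sum.elim_comp_inr, dotProduct_add, neg_dotProduct,
    star_trivial, Matrix.sub_mulVec, Matrix.smul_mulVec, Matrix.one_mulVec, dotProduct_sub,
    dotProduct_smul, smul_eq_mul, Matrix.neg_mulVec, dotProduct_neg] at *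
  linarith

theorem R_det_ne_zero (hg : g.IsNormalized α) (s : ℝ) : (g.R s).det ≠ 0 := by
  intro h
  obtain ⟨v, hv, hv0⟩ := Matrix.exists_mulVec_eq_zero_iff.2 h
  have h1 := hg.R_coercive s v
  rw [hv0, dotProduct_zero] at h1
  have h2 : 0 < v ⬝ᵥ v := lt_of_le_of_ne
    (Finset.sum_nonneg fun i _ => mul_self_nonneg _) fun h => hv (dotProduct_self_eq_zero.1 h.symm)
  nlinarith [hg.α_pos]

theorem R_mul_inv (hg : g.IsNormalized α) (s : ℝ) : g.R s * (g.R s)⁻¹ = 1 :=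
  Matrix.mul_nonsing_inv _ (hg.R_det_ne_zero s).isUnit

theorem inv_mul_R (hg : g.IsNormalized α) (s : ℝ) : (g.R s)⁻¹ * g.R s = 1 :=
  Matrix.nonsing_inv_mul _ (hg.R_det_ne_zero s).isUnit

theorem R_inv_symm (hg : g.IsNormalized α) (s : ℝ) : ((g.R s)⁻¹)ᵀ = (g.R s)⁻¹ := by
  rw [Matrix.transpose_nonsing_inv, hg.R_symm]

/-- Coercivity of `R`, tested with a column of `R⁻¹`. -/
theorem abs_R_inv_le (hg : g.IsNormalized α) (s : ℝ) (i j : Fin m₁ ⊕ Fin m₂) :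
    |(g.R s)⁻¹ i j| ≤ 1 / α := by
  set v : Fin m₁ ⊕ Fin m₂ → ℝ := (g.R s)⁻¹ *ᵥ Pi.single j 1 with hv
  have hvi : (g.R s)⁻¹ i j = v i := by simp [hv]
  have h1 := hg.R_coercive s v
  have hRv : g.R s *ᵥ v = Pi.single j 1 := by
    rw [hv, Matrix.mulVec_mulVec, hg.R_mul_inv, Matrix.one_mulVec]
  rw [hRv, dotProduct_single, mul_one] at h1
  have h2 : flip v j ≤ |v j| := by
    rcases j with j | j
    exacts [le_abs_self _, neg_le_abs _]
  have h3 : ∀ k, v k ^ 2 ≤ v ⬝ᵥ v := fun k => by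
    rw [sq]
    exact Finset.single_le_sum (f := fun k => v k * v k) (fun k _ => mul_self_nonneg _)
      (Finset.mem_univ k)
  have hα := hg.α_pos
  have h4 : |v j| ≤ 1 / α := by
    rw [le_div_iff₀ hα]
    have h5 : α * |v j| ^ 2 ≤ |v j| := by
      rw [sq_abs]; nlinarith [h3 j]
    by_contra! h6
    have h7 : 0 < |v j| := by
      by_contra! h8
      have : |v j| = 0 := le_antisymm h8 (abs_nonneg _)
      rw [this] at h6; linarith
    nlinarith
  rw [hvi]
  have h5 : α * (v ⬝ᵥ v) ≤ 1 / α := h1.trans (h2.trans h4)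
  have h6 : v ⬝ᵥ v ≤ (1 / α) ^ 2 := by
    rw [sq, ← div_eq_mul_one_div, le_div_iff₀ hα, mul_comm]
    exact h5
  exact abs_le_of_sq_le_sq ((h3 i).trans h6) (by positivity)

theorem R_inv_bdd (hg : g.IsNormalized α) : IsBddMeasMat g.T (fun s => (g.R s)⁻¹) :=
  fun i j => ⟨measurable_matrix_inv_apply (fun i j => (hg.R_bdd i j).1) i j, 1 / α,
    fun s _ => hg.abs_R_inv_le s i j⟩

end IsNormalized

end LQGame

/-! ### Trajectories and the cost form along one path -/

theorem mulVec_dotProduct_eq {p q : Type*} [Fintype p] [Fintype q] (M : Matrix p q ℝ) (v : q → ℝ)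
    (w : p → ℝ) : (M *ᵥ v) ⬝ᵥ w = v ⬝ᵥ (Mᵀ *ᵥ w) := by
  rw [Matrix.mulVec_transpose, dotProduct_comm v, ← Matrix.dotProduct_mulVec, dotProduct_comm]

/-- Every component of `z` is square integrable on `[t,T]`. -/
def IsL2Path {ι : Type*} (t T : ℝ) (z : ℝ → ι → ℝ) : Prop :=
  ∀ i, MemLp (fun s => z s i) 2 (volume.restrict (Icc t T))

theorem IsL2Path.mulVec {p q : Type*} [Fintype q] {t T : ℝ} (ht : 0 ≤ t)
    {M : ℝ → Matrix p q ℝ} (hM : IsBddMeasMat T M) {z : ℝ → q → ℝ} (hz : IsL2Path t T z) :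
    IsL2Path t T (fun s => M s *ᵥ z s) := by
  intro i
  simp only [Matrix.mulVec, dotProduct]
  refine memLp_finsetSum _ fun j _ => ?_
  obtain ⟨C, hC⟩ := (hM i j).ae_bound ht
  exact (hz j).mul (p := ⊤) (q := 2) (r := 2)
    (memLp_top_of_bound (hM i j).1.aestronglyMeasurable C hC)

theorem IsL2Path.add {ι : Type*} {t T : ℝ} {z w : ℝ → ι → ℝ} (hz : IsL2Path t T z)
    (hw : IsL2Path t T w) : IsL2Path t T (fun s => z s + w s) := fun i => (hz i).add (hw i)

theorem IsL2Path.const_smul {ι : Type*} {t T : ℝ} {z : ℝ → ι → ℝ} (hz : IsL2Path t T z) (c : ℝ) :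
    IsL2Path t T (fun s => c • z s) := fun i => (hz i).const_smul c

theorem IsL2Path.intervalIntegrable {ι : Type*} {t T : ℝ} (htT : t ≤ T) {z : ℝ → ι → ℝ}
    (hz : IsL2Path t T z) (i : ι) : IntervalIntegrable (fun s => z s i) volume t T :=
  (intervalIntegrable_iff_integrableOn_Icc_of_le htT).2 ((hz i).integrable (by norm_num))

theorem IsL2Path.intervalIntegrable_dotProduct {ι : Type*} [Fintype ι] {t T : ℝ} (htT : t ≤ T)
    {z w : ℝ → ι → ℝ} (hz : IsL2Path t T z) (hw : IsL2Path t T w) :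
    IntervalIntegrable (fun s => z s ⬝ᵥ w s) volume t T := by
  refine (intervalIntegrable_iff_integrableOn_Icc_of_le htT).2 ?_
  simp only [dotProduct]
  exact integrable_finsetSum _ fun i _ => (hz i).integrable_mul (hw i)

theorem isL2Path_of_continuousOn {ι : Type*} {t T : ℝ} {z : ℝ → ι → ℝ}
    (hz : ∀ i, ContinuousOn (fun s => z s i) (Icc t T)) : IsL2Path t T z := by
  intro i
  obtain ⟨C, hC⟩ := isCompact_Icc.exists_bound_of_continuousOn (hz i)
  refine MemLp.of_bound ((hz i).aestronglyMeasurable measurableSet_Icc) C ?_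
  filter_upwards [ae_restrict_mem measurableSet_Icc] with s hs using hC s hs

namespace LQGame

variable {n m₁ m₂ : ℕ}

/-- `X` is a solution of `X' = A X + B U` on `[t,T]`, with `U = (u₁, u₂)` square integrable. -/
structure IsTraj (g : LQGame n m₁ m₂) (t : ℝ) (U : ℝ → Fin m₁ ⊕ Fin m₂ → ℝ)
    (X : ℝ → Fin n → ℝ) : Prop where
  control : IsL2Path t g.T U
  state : ∀ i, IsPrimitiveOn t g.T (fun s => X s i) (fun s => (g.A s *ᵥ X s + g.B s *ᵥ U s) i)

/-- The symmetric bilinear form whose diagonal is the cost along one path. -/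
def costForm (g : LQGame n m₁ m₂) (t : ℝ) (U : ℝ → Fin m₁ ⊕ Fin m₂ → ℝ) (X : ℝ → Fin n → ℝ)
    (V : ℝ → Fin m₁ ⊕ Fin m₂ → ℝ) (Y : ℝ → Fin n → ℝ) : ℝ :=
  X g.T ⬝ᵥ (g.G *ᵥ Y g.T) +
    ∫ s in t..g.T, Sum.elim (X s) (U s) ⬝ᵥ (g.costMatrix s *ᵥ Sum.elim (Y s) (V s))

namespace IsTraj

variable {g : LQGame n m₁ m₂} {α t : ℝ} {U V W : ℝ → Fin m₁ ⊕ Fin m₂ → ℝ}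
  {X Y Z : ℝ → Fin n → ℝ}

theorem add (hX : g.IsTraj t U X) (hY : g.IsTraj t V Y) :
    g.IsTraj t (fun s => U s + V s) (fun s => X s + Y s) := by
  refine ⟨hX.control.add hY.control, fun i => ?_⟩
  convert (hX.state i).add (hY.state i) using 2 with s
  · rfl
  · simp only [Matrix.mulVec_add, Pi.add_apply]
    ring

theorem const_smul (hX : g.IsTraj t U X) (c : ℝ) :
    g.IsTraj t (fun s => c • U s) (fun s => c • X s) := by
  refine ⟨hX.control.const_smul c, fun i => ?_⟩
  convert (hX.state i).const_mul c using 2 with s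
  · rfl
  · simp only [Matrix.mulVec_smul, Pi.add_apply, Pi.smul_apply, smul_eq_mul]
    ring

theorem state_memLp (hX : g.IsTraj t U X) (htT : t ≤ g.T) : IsL2Path t g.T X :=
  isL2Path_of_continuousOn fun i => (hX.state i).continuousOn htT

theorem sumElim_memLp (hX : g.IsTraj t U X) (htT : t ≤ g.T) :
    IsL2Path t g.T (fun s => Sum.elim (X s) (U s)) := by
  rintro (i | i)
  exacts [hX.state_memLp htT i, hX.control i]

theorem intervalIntegrable_cost (hg : g.IsNormalized α) (ht : t ∈ Icc 0 g.T)
    (hX : g.IsTraj t U X) (hY : g.IsTraj t V Y) :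
    IntervalIntegrable (fun s => Sum.elim (X s) (U s) ⬝ᵥ
      (g.costMatrix s *ᵥ Sum.elim (Y s) (V s))) volume t g.T :=
  (hX.sumElim_memLp ht.2).intervalIntegrable_dotProduct ht.2
    ((hY.sumElim_memLp ht.2).mulVec ht.1 hg.costMatrix_bdd)

theorem costForm_add_left (hg : g.IsNormalized α) (ht : t ∈ Icc 0 g.T)
    (hX : g.IsTraj t U X) (hY : g.IsTraj t V Y) (hZ : g.IsTraj t W Z) :
    g.costForm t (fun s => U s + V s) (fun s => X s + Y s) W Z =
      g.costForm t U X W Z + g.costForm t V Y W Z := by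
  have e : ∀ s, Sum.elim (X s + Y s) (U s + V s) = Sum.elim (X s) (U s) + Sum.elim (Y s) (V s) :=
    fun s => by ext (i | i) <;> rfl
  simp only [costForm, e, add_dotProduct]
  rw [intervalIntegral.integral_add (intervalIntegrable_cost hg ht hX hZ)
    (intervalIntegrable_cost hg ht hY hZ)]
  ring

theorem costForm_smul_left (c : ℝ) :
    g.costForm t (fun s => c • U s) (fun s => c • X s) W Z = c * g.costForm t U X W Z := by
  have e : ∀ s, Sum.elim (c • X s) (c • U s) = c • Sum.elim (X s) (U s) :=
    fun s => by ext (i | i) <;> rfl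
  simp only [costForm, e, smul_dotProduct, smul_eq_mul, intervalIntegral.integral_const_mul]
  ring

theorem costForm_comm (hg : g.IsNormalized α) :
    g.costForm t U X V Y = g.costForm t V Y U X := by
  simp only [costForm]
  congr 1
  · rw [dotProduct_comm, mulVec_dotProduct_eq, hg.G_symm]
  · refine intervalIntegral.integral_congr fun s _ => ?_
    rw [dotProduct_comm, mulVec_dotProduct_eq, hg.costMatrix_symm]

theorem costForm_add_right (hg : g.IsNormalized α) (ht : t ∈ Icc 0 g.T)
    (hX : g.IsTraj t U X) (hY : g.IsTraj t V Y) (hZ : g.IsTraj t W Z) :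
    g.costForm t W Z (fun s => U s + V s) (fun s => X s + Y s) =
      g.costForm t W Z U X + g.costForm t W Z V Y := by
  rw [costForm_comm hg, costForm_add_left hg ht hX hY hZ, costForm_comm hg,
    costForm_comm (V := W) hg]

/-- Expansion of the cost along a line of trajectories. -/
theorem costForm_line (hg : g.IsNormalized α) (ht : t ∈ Icc 0 g.T)
    (hX : g.IsTraj t U X) (hY : g.IsTraj t V Y) (c : ℝ) :
    g.costForm t (fun s => U s + c • V s) (fun s => X s + c • Y s)
        (fun s => U s + c • V s) (fun s => X s + c • Y s) =
      g.costForm t U X U X + 2 * c * g.costForm t U X V Y + c ^ 2 * g.costForm t V Y V Y := by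
  have hcY := hY.const_smul c
  rw [costForm_add_left hg ht hX hcY (hX.add hcY), costForm_add_right hg ht hX hcY hX,
    costForm_add_right hg ht hX hcY hcY, costForm_smul_left,
    costForm_comm hg (U := U) (V := fun s => c • V s), costForm_smul_left, costForm_smul_left,
    costForm_comm hg (U := V) (V := fun s => c • V s), costForm_smul_left,
    costForm_comm hg (U := V) (V := U)]
  ring

theorem costForm_congr {U' V' : ℝ → Fin m₁ ⊕ Fin m₂ → ℝ} {X' Y' : ℝ → Fin n → ℝ} (ht : t ≤ g.T)
    (hU : ∀ᵐ s ∂(volume.restrict (Icc t g.T)), U s = U' s) (hX : EqOn X X' (Icc t g.T))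
    (hV : ∀ᵐ s ∂(volume.restrict (Icc t g.T)), V s = V' s) (hY : EqOn Y Y' (Icc t g.T)) :
    g.costForm t U X V Y = g.costForm t U' X' V' Y' := by
  simp only [costForm]
  rw [hX ⟨ht, le_rfl⟩, hY ⟨ht, le_rfl⟩]
  congr 1
  refine intervalIntegral.integral_congr_ae ?_
  filter_upwards [(ae_restrict_iff' measurableSet_Icc).1 hU,
    (ae_restrict_iff' measurableSet_Icc).1 hV] with s h1 h2 hs
  rw [uIoc_of_le ht] at hs
  have hs' := Ioc_subset_Icc_self hs
  rw [h1 hs', h2 hs', hX hs', hY hs']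

theorem congr_control (ht : t ≤ g.T) (hX : g.IsTraj t U X)
    (hU : ∀ᵐ s ∂(volume.restrict (Icc t g.T)), U s = V s) : g.IsTraj t V X := by
  refine ⟨fun i => (hX.control i).ae_eq ?_, fun i => ?_⟩
  · filter_upwards [hU] with s hs using congrFun hs i
  · refine (hX.state i).congr ht (fun _ _ => rfl) ?_
    filter_upwards [(ae_restrict_iff' measurableSet_Icc).1 hU] with s hs hs'
    rw [hs hs']

/-- A trajectory is determined by its initial state and its control. -/
theorem unique (hg : g.IsNormalized α) (ht : t ∈ Icc 0 g.T) (hX : g.IsTraj t U X)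
    (hY : g.IsTraj t U Y) (h0 : X t = Y t) : EqOn X Y (Icc t g.T) := by
  obtain ⟨Φ, Ψ, h⟩ := exists_fundamentalPair hg.T_pos.le hg.A_bdd
  intro s hs
  rw [h.eq_of_isPrimitiveOn ht hX.state hs, h.eq_of_isPrimitiveOn ht hY.state hs, h0]

theorem exists_traj (hg : g.IsNormalized α) (ht : t ∈ Icc 0 g.T) (hU : IsL2Path t g.T U)
    (x : Fin n → ℝ) : ∃ X, g.IsTraj t U X ∧ X t = x := by
  obtain ⟨Φ, Ψ, h⟩ := exists_fundamentalPair hg.T_pos.le hg.A_bdd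
  refine ⟨_, ⟨hU, h.isPrimitiveOn_formula ht (Ψ t *ᵥ x)
    ((hU.mulVec ht.1 hg.B_bdd).intervalIntegrable ht.2)⟩, ?_⟩
  have : (Ψ t *ᵥ x + fun i => ∫ r in t..t, (Ψ r *ᵥ (g.B r *ᵥ U r)) i) = Ψ t *ᵥ x := by
    ext i; simp
  rw [this, Matrix.mulVec_mulVec, h.left_mul_right ht, Matrix.one_mulVec]

end IsTraj

/-- `(V, Y, η)` solves, on `[t,T]`, the Hamiltonian system of the game: the state equation, the
adjoint equation with its terminal condition, and the stationarity condition. -/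
structure IsHamiltonian (g : LQGame n m₁ m₂) (t : ℝ) (V : ℝ → Fin m₁ ⊕ Fin m₂ → ℝ)
    (Y η : ℝ → Fin n → ℝ) : Prop where
  traj : g.IsTraj t V Y
  adjoint : ∀ i, IsPrimitiveOn t g.T (fun s => η s i)
    (fun s => (-((g.A s)ᵀ *ᵥ η s + g.Q s *ᵥ Y s + (g.S s)ᵀ *ᵥ V s)) i)
  terminal : η g.T = g.G *ᵥ Y g.T
  stationary : ∀ s ∈ Icc t g.T, (g.B s)ᵀ *ᵥ η s + g.S s *ᵥ Y s + g.R s *ᵥ V s = 0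

/-- Duality with the adjoint equation: against a solution of the Hamiltonian system the cost form
only sees the initial state. -/
theorem IsHamiltonian.costForm_eq {g : LQGame n m₁ m₂} {t : ℝ}
    {U V : ℝ → Fin m₁ ⊕ Fin m₂ → ℝ} {X Y η : ℝ → Fin n → ℝ} (h : g.IsHamiltonian t V Y η)
    (ht : t ∈ Icc 0 g.T) (hX : g.IsTraj t U X) :
    g.costForm t U X V Y = X t ⬝ᵥ η t := by
  have hi := (IsPrimitiveOn.dotProduct hX.state h.adjoint ht.2).sub_eq ht.2
  rw [costForm, ← h.terminal]
  have : ∫ s in t..g.T, Sum.elim (X s) (U s) ⬝ᵥ (g.costMatrix s *ᵥ Sum.elim (Y s) (V s)) =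
      -∫ s in t..g.T, ((g.A s *ᵥ X s + g.B s *ᵥ U s) ⬝ᵥ η s +
        X s ⬝ᵥ (-((g.A s)ᵀ *ᵥ η s + g.Q s *ᵥ Y s + (g.S s)ᵀ *ᵥ V s))) := by
    rw [← intervalIntegral.integral_neg]
    refine intervalIntegral.integral_congr fun s hs => ?_
    rw [uIcc_of_le ht.2] at hs
    have h0 : U s ⬝ᵥ ((g.B s)ᵀ *ᵥ η s + g.S s *ᵥ Y s + g.R s *ᵥ V s) = 0 := by
      rw [h.stationary s hs, dotProduct_zero]
    rw [dotProduct_costMatrix_mulVec]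
    simp only [add_dotProduct, dotProduct_add, dotProduct_neg, mulVec_dotProduct_eq] at h0 ⊢
    linarith
  rw [this]
  linarith

end LQGame

/-! ### The Riccati equation -/

namespace LQGame

variable {n m₁ m₂ : ℕ} {g : LQGame n m₁ m₂} {α t : ℝ}

/-- A symmetric solution of the Riccati equation, continuous on the whole line and written as a
primitive on `[0,T]`. -/
structure IsRiccati (g : LQGame n m₁ m₂) (P : ℝ → Matrix (Fin n) (Fin n) ℝ) : Prop where
  continuous : ∀ i j, Continuous fun s => P s i j
  symm : ∀ s ∈ Icc 0 g.T, (P s)ᵀ = P s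
  primitive : ∀ i j, IsPrimitiveOn 0 g.T (fun s => P s i j) (fun s => (-g.riccatiRHS s (P s)) i j)
  terminal : P g.T = g.G

theorem feedback_bdd (hg : g.IsNormalized α) {P : ℝ → Matrix (Fin n) (Fin n) ℝ}
    (hP : ∀ i j, Continuous fun s => P s i j) : IsBddMeasMat g.T (g.feedback P) :=
  (hg.R_inv_bdd.mul ((hg.B_bdd.transpose.mul (.of_continuous hP)).add hg.S_bdd)).neg

theorem closedLoop_bdd (hg : g.IsNormalized α) {P : ℝ → Matrix (Fin n) (Fin n) ℝ}
    (hP : ∀ i j, Continuous fun s => P s i j) :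
    IsBddMeasMat g.T (fun s => g.A s + g.B s * g.feedback P s) :=
  hg.A_bdd.add (hg.B_bdd.mul (feedback_bdd hg hP))

theorem riccatiRHS_bdd (hg : g.IsNormalized α) {P : ℝ → Matrix (Fin n) (Fin n) ℝ}
    (hP : ∀ i j, Continuous fun s => P s i j) :
    IsBddMeasMat g.T (fun s => g.riccatiRHS s (P s)) := by
  have h := IsBddMeasMat.of_continuous (T := g.T) hP
  exact (((h.mul hg.A_bdd).add (hg.A_bdd.transpose.mul h)).add hg.Q_bdd).sub
    ((((h.mul hg.B_bdd).add hg.S_bdd.transpose).mul hg.R_inv_bdd).mul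
      ((hg.B_bdd.transpose.mul h).add hg.S_bdd))

/-- Completion of the square: along a symmetric solution of the Riccati equation the derivative of
`⟨X, P Y⟩` plus the polarized running cost is `⟨U - Θ X, R (V - Θ Y)⟩`. -/
theorem riccati_square (hg : g.IsNormalized α) {P : ℝ → Matrix (Fin n) (Fin n) ℝ} {s : ℝ}
    (hP : (P s)ᵀ = P s) (X Y : Fin n → ℝ) (U V : Fin m₁ ⊕ Fin m₂ → ℝ) :
    (g.A s *ᵥ X + g.B s *ᵥ U) ⬝ᵥ (P s *ᵥ Y) + X ⬝ᵥ ((-g.riccatiRHS s (P s)) *ᵥ Y +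
        P s *ᵥ (g.A s *ᵥ Y + g.B s *ᵥ V)) +
      Sum.elim X U ⬝ᵥ (g.costMatrix s *ᵥ Sum.elim Y V) =
    (U - g.feedback P s *ᵥ X) ⬝ᵥ (g.R s *ᵥ (V - g.feedback P s *ᵥ Y)) := by
  set N := (g.B s)ᵀ * P s + g.S s with hN
  have hNt : Nᵀ = P s * g.B s + (g.S s)ᵀ := by
    rw [hN, Matrix.transpose_add, Matrix.transpose_mul, hP, Matrix.transpose_transpose]
  have h1 : g.R s *ᵥ (g.feedback P s *ᵥ Y) = -(N *ᵥ Y) := by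
    rw [feedback, Matrix.mulVec_mulVec, Matrix.mul_neg, ← Matrix.mul_assoc, hg.R_mul_inv,
      Matrix.one_mul, Matrix.neg_mulVec]
  have h2 : ∀ w, (g.feedback P s *ᵥ X) ⬝ᵥ w = -(X ⬝ᵥ ((Nᵀ * (g.R s)⁻¹) *ᵥ w)) := by
    intro w
    rw [mulVec_dotProduct_eq, feedback, Matrix.transpose_neg, Matrix.transpose_mul, hg.R_inv_symm,
      Matrix.neg_mulVec, dotProduct_neg]
  have h3 : ∀ w, (Nᵀ * (g.R s)⁻¹) *ᵥ (g.R s *ᵥ w) = Nᵀ *ᵥ w := by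
    intro w
    rw [Matrix.mulVec_mulVec, Matrix.mul_assoc, hg.inv_mul_R, Matrix.mul_one]
  have h4 : g.riccatiRHS s (P s) =
      P s * g.A s + (g.A s)ᵀ * P s + g.Q s - Nᵀ * (g.R s)⁻¹ * N := by
    rw [riccatiRHS, hNt]
  rw [dotProduct_costMatrix_mulVec, Matrix.mulVec_sub, h1, sub_neg_eq_add, sub_dotProduct, h2,
    Matrix.mulVec_add (Nᵀ * (g.R s)⁻¹), h3, h4]
  rw [Matrix.mulVec_mulVec _ (Nᵀ * (g.R s)⁻¹) N, hNt]
  have hNY : N *ᵥ Y = ((g.B s)ᵀ * P s) *ᵥ Y + g.S s *ᵥ Y := by rw [hN, Matrix.add_mulVec]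
  rw [hNY]
  simp only [add_dotProduct, dotProduct_add, dotProduct_neg, mulVec_dotProduct_eq,
    Matrix.neg_mulVec, Matrix.sub_mulVec, Matrix.add_mulVec, dotProduct_sub,
    Matrix.mulVec_mulVec, Matrix.mulVec_add]
  ring

theorem IsRiccati.costForm_eq {P : ℝ → Matrix (Fin n) (Fin n) ℝ} (hP : g.IsRiccati P)
    (hg : g.IsNormalized α) (ht : t ∈ Icc 0 g.T) {U V : ℝ → Fin m₁ ⊕ Fin m₂ → ℝ}
    {X Y : ℝ → Fin n → ℝ} (hX : g.IsTraj t U X) (hY : g.IsTraj t V Y) :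
    g.costForm t U X V Y = X t ⬝ᵥ (P t *ᵥ Y t) +
      ∫ s in t..g.T, (U s - g.feedback P s *ᵥ X s) ⬝ᵥ
        (g.R s *ᵥ (V s - g.feedback P s *ᵥ Y s)) := by
  have hp := IsPrimitiveOn.dotProduct hX.state
    (IsPrimitiveOn.mulVec (fun i j => (hP.primitive i j).mono ht) hY.state ht.2) ht.2
  have hi := hp.sub_eq ht.2
  have e : ∀ s ∈ uIcc t g.T, (U s - g.feedback P s *ᵥ X s) ⬝ᵥ
        (g.R s *ᵥ (V s - g.feedback P s *ᵥ Y s)) =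
      ((g.A s *ᵥ X s + g.B s *ᵥ U s) ⬝ᵥ (P s *ᵥ Y s) + X s ⬝ᵥ ((-g.riccatiRHS s (P s)) *ᵥ Y s +
        P s *ᵥ (g.A s *ᵥ Y s + g.B s *ᵥ V s))) +
      Sum.elim (X s) (U s) ⬝ᵥ (g.costMatrix s *ᵥ Sum.elim (Y s) (V s)) := by
    intro s hs
    rw [uIcc_of_le ht.2] at hs
    exact (riccati_square hg (hP.symm s ⟨ht.1.trans hs.1, hs.2⟩) _ _ _ _).symm
  rw [intervalIntegral.integral_congr e, intervalIntegral.integral_add hp.1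
    (IsTraj.intervalIntegrable_cost hg ht hX hY), costForm, ← hP.terminal]
  have hi' : ∫ s in t..g.T, ((g.A s *ᵥ X s + g.B s *ᵥ U s) ⬝ᵥ (P s *ᵥ Y s) +
      X s ⬝ᵥ ((-g.riccatiRHS s (P s)) *ᵥ Y s + P s *ᵥ (g.A s *ᵥ Y s + g.B s *ᵥ V s))) =
      X g.T ⬝ᵥ (P g.T *ᵥ Y g.T) - X t ⬝ᵥ (P t *ᵥ Y t) := hi
  rw [hi']
  ring

/-- A solution of the closed-loop equation with an additional input `v` is a trajectory under the
control `Θ X + v`. -/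
theorem IsRiccati.isTraj_closedLoop {P : ℝ → Matrix (Fin n) (Fin n) ℝ} (hP : g.IsRiccati P)
    (hg : g.IsNormalized α) (ht : t ∈ Icc 0 g.T) {X : ℝ → Fin n → ℝ} {v : ℝ → Fin m₁ ⊕ Fin m₂ → ℝ}
    (hv : IsL2Path t g.T v)
    (hX : ∀ i, IsPrimitiveOn t g.T (fun s => X s i)
      (fun s => ((g.A s + g.B s * g.feedback P s) *ᵥ X s + g.B s *ᵥ v s) i)) :
    g.IsTraj t (fun s => g.feedback P s *ᵥ X s + v s) X := by
  have hX2 : IsL2Path t g.T X := isL2Path_of_continuousOn fun i => (hX i).continuousOn ht.2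
  refine ⟨(hX2.mulVec ht.1 (feedback_bdd hg hP.continuous)).add hv, fun i => ?_⟩
  refine (hX i).congr_deriv (fun s _ => ?_) ht.2
  rw [Matrix.mulVec_add, Matrix.add_mulVec, ← Matrix.mulVec_mulVec, add_assoc]

theorem IsRiccati.exists_closedLoop {P : ℝ → Matrix (Fin n) (Fin n) ℝ} (hP : g.IsRiccati P)
    (hg : g.IsNormalized α) (ht : t ∈ Icc 0 g.T) (x : Fin n → ℝ) :
    ∃ X : ℝ → Fin n → ℝ, (∀ i, Continuous fun s => X s i) ∧ X t = x ∧
      g.IsTraj t (fun s => g.feedback P s *ᵥ X s) X := by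
  obtain ⟨Φ, Ψ, h⟩ := exists_fundamentalPair hg.T_pos.le (closedLoop_bdd hg hP.continuous)
  refine ⟨fun s => Φ s *ᵥ (Ψ t *ᵥ x), fun i => ?_, ?_, ?_⟩
  · simp only [Matrix.mulVec, dotProduct]
    exact continuous_finsetSum _ fun j _ => (h.continuous_left i j).mul continuous_const
  · change Φ t *ᵥ (Ψ t *ᵥ x) = x
    rw [Matrix.mulVec_mulVec, h.left_mul_right ht, Matrix.one_mulVec]
  · have h0 : IsL2Path t g.T (fun _ => (0 : Fin m₁ ⊕ Fin m₂ → ℝ)) := fun _ => MemLp.zero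
    have := hP.isTraj_closedLoop hg ht (X := fun s => Φ s *ᵥ (Ψ t *ᵥ x)) h0 fun i => by
      have := h.isPrimitiveOn_formula ht (Ψ t *ᵥ x) (f := fun _ => 0) (by simp) i
      have e : ∀ s : ℝ, (Ψ t *ᵥ x + fun i => ∫ r in t..s, (Ψ r *ᵥ (0 : Fin n → ℝ)) i) =
          Ψ t *ᵥ x := fun s => by ext i; simp
      simpa only [e, Matrix.mulVec_zero (g.B _)] using this
    simpa using this

/-- Two symmetric solutions of the Riccati equation give the same mixed cost of their closed-loop
trajectories, hence coincide. -/
theorem IsRiccati.unique {P P' : ℝ → Matrix (Fin n) (Fin n) ℝ} (hP : g.IsRiccati P)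
    (hP' : g.IsRiccati P') (hg : g.IsNormalized α) : EqOn P' P (Icc 0 g.T) := by
  intro t ht
  refine Matrix.ext_of_mulVec_single fun j => funext fun i => ?_
  obtain ⟨X, _, hX0, hX⟩ := hP.exists_closedLoop hg ht (Pi.single i 1)
  obtain ⟨Y, _, hY0, hY⟩ := hP'.exists_closedLoop hg ht (Pi.single j 1)
  have h1 := hP.costForm_eq hg ht hX hY
  have h2 := hP'.costForm_eq hg ht hX hY
  simp only [sub_self, zero_dotProduct, Matrix.mulVec_zero, dotProduct_zero,
    intervalIntegral.integral_zero, add_zero, hX0, hY0, single_one_dotProduct] at h1 h2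
  rw [← h1, ← h2]

theorem IsRiccati.isRiccatiSolution {P : ℝ → Matrix (Fin n) (Fin n) ℝ}
    (hP : g.IsRiccati P) : g.IsRiccatiSolution P := by
  refine ⟨(continuous_matrix hP.continuous).continuousOn, hP.symm, fun t ht i j => ?_⟩
  have h := ((hP.primitive i j).mono ht).sub_eq ht.2
  rw [hP.terminal] at h
  simp only [Matrix.neg_apply, intervalIntegral.integral_neg] at h
  linarith

theorem exists_isRiccati_eqOn (hg : g.IsNormalized α) {P : ℝ → Matrix (Fin n) (Fin n) ℝ}
    (hP : g.IsRiccatiSolution P) : ∃ P', g.IsRiccati P' ∧ EqOn P' P (Icc 0 g.T) := by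
  have hT := hg.T_pos.le
  obtain ⟨hc, hs, he⟩ := hP
  set P' : ℝ → Matrix (Fin n) (Fin n) ℝ := IccExtend hT ((Icc 0 g.T).domRestrict P) with hP'
  have hE : EqOn P' P (Icc 0 g.T) := fun s hs => by
    rw [hP', IccExtend_of_mem hT _ hs]; rfl
  have hP'c : Continuous P' := (continuousOn_iff_continuous_domRestrict.1 hc).Icc_extend'
  have hent : ∀ i j, Continuous fun s => P' s i j := fun i j => hP'c.matrix_elem i j
  refine ⟨P', ⟨hent, fun s h => by rw [hE h]; exact hs s h, fun i j => ?_, ?_⟩, hE⟩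
  · obtain ⟨C, hC⟩ := (riccatiRHS_bdd hg hent i j).ae_bound le_rfl
    have hint : IntervalIntegrable (fun s => g.riccatiRHS s (P' s) i j) volume 0 g.T :=
      (intervalIntegrable_iff_integrableOn_Icc_of_le hT).2
        (Measure.integrableOn_of_bounded (M := C) (by simp)
          (riccatiRHS_bdd hg hent i j).1.aestronglyMeasurable hC)
    have hE' : ∀ t ∈ Icc 0 g.T,
        P' t i j = g.G i j + ∫ s in t..g.T, g.riccatiRHS s (P' s) i j := by
      intro t ht
      rw [hE ht, he t ht i j]
      congr 1
      refine intervalIntegral.integral_congr fun s hs => ?_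
      rw [uIcc_of_le ht.2] at hs
      rw [hE ⟨ht.1.trans hs.1, hs.2⟩]
    refine ⟨hint.neg, fun s hs => ?_⟩
    have hs1 : IntervalIntegrable (fun s => g.riccatiRHS s (P' s) i j) volume 0 s :=
      hint.mono_set (by
        rw [uIcc_of_le hs.1, uIcc_of_le hT]; exact Icc_subset_Icc_right hs.2)
    have hs2 : IntervalIntegrable (fun s => g.riccatiRHS s (P' s) i j) volume s g.T :=
      hint.mono_set (by
        rw [uIcc_of_le hs.2, uIcc_of_le hT]; exact Icc_subset_Icc_left hs.1)
    have := intervalIntegral.integral_add_adjacent_intervals hs1 hs2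
    simp only [Matrix.neg_apply, intervalIntegral.integral_neg]
    rw [hE' s hs, hE' 0 ⟨le_rfl, hT⟩, ← this]
    ring
  · have hTm : g.T ∈ Icc 0 g.T := ⟨hT, le_rfl⟩
    ext i j
    rw [hE hTm, he _ hTm]
    simp

end LQGame

/-! ### The Hamiltonian system and the existence of a Riccati solution -/

namespace LQGame

variable {n m₁ m₂ : ℕ} {g : LQGame n m₁ m₂} {α t : ℝ}

/-- The coefficient matrix of the Hamiltonian system, after elimination of the control by the
stationarity condition `u = -R⁻¹ (Bᵀ η + S X)`. -/
def hamiltonianMatrix (g : LQGame n m₁ m₂) (s : ℝ) : Matrix (Fin n ⊕ Fin n) (Fin n ⊕ Fin n) ℝ :=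
  fromBlocks (g.A s - g.B s * ((g.R s)⁻¹ * g.S s)) (-(g.B s * ((g.R s)⁻¹ * (g.B s)ᵀ)))
    (-(g.Q s - (g.S s)ᵀ * ((g.R s)⁻¹ * g.S s)))
    (-((g.A s)ᵀ - (g.S s)ᵀ * ((g.R s)⁻¹ * (g.B s)ᵀ)))

theorem hamiltonianMatrix_bdd (hg : g.IsNormalized α) : IsBddMeasMat g.T g.hamiltonianMatrix :=
  .fromBlocks (hg.A_bdd.sub (hg.B_bdd.mul (hg.R_inv_bdd.mul hg.S_bdd)))
    (hg.B_bdd.mul (hg.R_inv_bdd.mul hg.B_bdd.transpose)).neg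
    (hg.Q_bdd.sub (hg.S_bdd.transpose.mul (hg.R_inv_bdd.mul hg.S_bdd))).neg
    (hg.A_bdd.transpose.sub (hg.S_bdd.transpose.mul (hg.R_inv_bdd.mul hg.B_bdd.transpose))).neg

/-- The control gain of the Hamiltonian flow `(M, N)`. -/
def hamiltonianGain (g : LQGame n m₁ m₂) (M N : ℝ → Matrix (Fin n) (Fin n) ℝ) (s : ℝ) :
    Matrix (Fin m₁ ⊕ Fin m₂) (Fin n) ℝ :=
  -((g.R s)⁻¹ * ((g.B s)ᵀ * N s + g.S s * M s))

/-- The matrix solution `(M, N)` of the Hamiltonian system with terminal value `(I, G)`. -/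
structure IsHamiltonianFlow (g : LQGame n m₁ m₂) (M N : ℝ → Matrix (Fin n) (Fin n) ℝ) : Prop where
  continuous_state : ∀ i j, Continuous fun s => M s i j
  continuous_costate : ∀ i j, Continuous fun s => N s i j
  state : ∀ i j, IsPrimitiveOn 0 g.T (fun s => M s i j)
    (fun s => (g.A s * M s + g.B s * g.hamiltonianGain M N s) i j)
  costate : ∀ i j, IsPrimitiveOn 0 g.T (fun s => N s i j)
    (fun s => (-((g.A s)ᵀ * N s + g.Q s * M s + (g.S s)ᵀ * g.hamiltonianGain M N s)) i j)
  terminal_state : M g.T = 1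
  terminal_costate : N g.T = g.G
  injective : ∀ t ∈ Icc 0 g.T, ∀ ξ, M t *ᵥ ξ = 0 → N t *ᵥ ξ = 0 → ξ = 0

theorem exists_isHamiltonianFlow (hg : g.IsNormalized α) : ∃ M N, g.IsHamiltonianFlow M N := by
  have hT : g.T ∈ Icc 0 g.T := ⟨hg.T_pos.le, le_rfl⟩
  obtain ⟨Φ, Ψ, h⟩ := exists_fundamentalPair hg.T_pos.le (hamiltonianMatrix_bdd hg)
  set C : Matrix (Fin n ⊕ Fin n) (Fin n) ℝ :=
    Ψ g.T * fromRows (1 : Matrix (Fin n) (Fin n) ℝ) g.G with hC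
  set Z : ℝ → Matrix (Fin n ⊕ Fin n) (Fin n) ℝ := fun s => Φ s * C with hZ
  have hZc : ∀ i j, Continuous fun s => Z s i j := fun i j => by
    simp only [hZ, Matrix.mul_apply]
    exact continuous_finsetSum _ fun k _ => (h.continuous_left i k).mul continuous_const
  have hZp : ∀ i j, IsPrimitiveOn 0 g.T (fun s => Z s i j)
      (fun s => (g.hamiltonianMatrix s * Z s) i j) := fun i j =>
    (IsPrimitiveOn.matrix_mul_const h.left C i j).congr_deriv
      (fun s _ => by rw [Matrix.mul_assoc]) hg.T_pos.le
  have hZT : Z g.T = fromRows (1 : Matrix (Fin n) (Fin n) ℝ) g.G := by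
    change Φ g.T * C = _
    rw [hC, ← Matrix.mul_assoc, h.left_mul_right hT, Matrix.one_mul]
  have hHZ : ∀ s, g.hamiltonianMatrix s * Z s =
      fromRows (g.A s * (Z s).toRows₁ + g.B s * g.hamiltonianGain (fun s => (Z s).toRows₁)
        (fun s => (Z s).toRows₂) s)
      (-((g.A s)ᵀ * (Z s).toRows₂ + g.Q s * (Z s).toRows₁ + (g.S s)ᵀ *
        g.hamiltonianGain (fun s => (Z s).toRows₁) (fun s => (Z s).toRows₂) s)) := by
    intro s
    conv_lhs =>
      rw [← Matrix.fromRows_toRows (Z s), hamiltonianMatrix, Matrix.fromBlocks_mul_fromRows]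
    simp only [hamiltonianGain, Matrix.sub_mul, Matrix.mul_add, Matrix.mul_neg, Matrix.neg_mul,
      Matrix.mul_assoc]
    congr 1 <;> abel
  refine ⟨fun s => (Z s).toRows₁, fun s => (Z s).toRows₂, fun i j => hZc (.inl i) j,
    fun i j => hZc (.inr i) j, fun i j => ?_, fun i j => ?_, ?_, ?_, fun t ht ξ h1 h2 => ?_⟩
  · exact (hZp (.inl i) j).congr_deriv (fun s _ => by rw [hHZ]; rfl) hg.T_pos.le
  · exact (hZp (.inr i) j).congr_deriv (fun s _ => by rw [hHZ]; rfl) hg.T_pos.le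
  · rw [hZT, Matrix.toRows₁_fromRows]
  · rw [hZT, Matrix.toRows₂_fromRows]
  · have h3 : Z t *ᵥ ξ = 0 := by
      rw [← Matrix.fromRows_toRows (Z t), Matrix.fromRows_mulVec, h1, h2]
      ext (i | i) <;> rfl
    have h4 : C *ᵥ ξ = 0 := by
      have : Ψ t *ᵥ (Z t *ᵥ ξ) = C *ᵥ ξ := by
        rw [Matrix.mulVec_mulVec, hZ, ← Matrix.mul_assoc, h.right_mul_left t ht, Matrix.one_mul]
      rw [← this, h3, Matrix.mulVec_zero]
    have h5 : Z g.T *ᵥ ξ = 0 := by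
      rw [hZ, ← Matrix.mulVec_mulVec, h4, Matrix.mulVec_zero]
    rw [hZT, Matrix.fromRows_mulVec, Matrix.one_mulVec] at h5
    ext i
    exact congrFun h5 (.inl i)

variable {M N : ℝ → Matrix (Fin n) (Fin n) ℝ}

theorem IsHamiltonianFlow.isHamiltonian (h : g.IsHamiltonianFlow M N) (hg : g.IsNormalized α)
    (ht : t ∈ Icc 0 g.T) (ξ : Fin n → ℝ) :
    g.IsHamiltonian t (fun s => g.hamiltonianGain M N s *ᵥ ξ) (fun s => M s *ᵥ ξ)
      (fun s => N s *ᵥ ξ) := by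
  have hξ : ∀ i, IsPrimitiveOn t g.T (fun _ => ξ i) (fun _ => (0 : Fin n → ℝ) i) :=
    fun i => IsPrimitiveOn.const _
  have hgain : IsBddMeasMat g.T (g.hamiltonianGain M N) :=
    (hg.R_inv_bdd.mul ((hg.B_bdd.transpose.mul (.of_continuous h.continuous_costate)).add
      (hg.S_bdd.mul (.of_continuous h.continuous_state)))).neg
  have hξ2 : IsL2Path t g.T (fun _ => ξ) := isL2Path_of_continuousOn fun i => continuousOn_const
  refine ⟨⟨hξ2.mulVec ht.1 hgain, fun i => ?_⟩, fun i => ?_, ?_, fun s _ => ?_⟩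
  · refine (IsPrimitiveOn.mulVec (fun i j => (h.state i j).mono ht) hξ ht.2 i).congr_deriv
      (fun s _ => ?_) ht.2
    simp only [Matrix.add_mulVec, Matrix.mulVec_mulVec, Matrix.mulVec_zero, add_zero]
  · refine (IsPrimitiveOn.mulVec (fun i j => (h.costate i j).mono ht) hξ ht.2 i).congr_deriv
      (fun s _ => ?_) ht.2
    simp only [Matrix.add_mulVec, Matrix.neg_mulVec, Matrix.mulVec_mulVec, Matrix.mulVec_zero,
      add_zero]
  · rw [h.terminal_costate, h.terminal_state, Matrix.one_mulVec]
  · simp only [hamiltonianGain, Matrix.mulVec_mulVec, Matrix.mul_neg]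
    rw [← Matrix.mul_assoc, hg.R_mul_inv, Matrix.one_mul, Matrix.neg_mulVec, ← Matrix.add_mulVec]
    exact add_neg_cancel _

/-- If on every `[t,T]` the Hamiltonian system has no nontrivial solution starting from the state
`0`, the state component `M` of the Hamiltonian flow is invertible and `P = N M⁻¹` solves the
Riccati equation. -/
theorem IsHamiltonianFlow.exists_isRiccati (h : g.IsHamiltonianFlow M N) (hg : g.IsNormalized α)
    (hnd : ∀ t ∈ Icc 0 g.T, ∀ V Y η, g.IsHamiltonian t V Y η → Y t = 0 → η t = 0) :
    ∃ P, g.IsRiccati P := by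
  have hT0 := hg.T_pos.le
  have hT : g.T ∈ Icc 0 g.T := ⟨hT0, le_rfl⟩
  have hdet : ∀ s ∈ Icc 0 g.T, (M s).det ≠ 0 := by
    intro s hs h0
    obtain ⟨ξ, hξ, hξ0⟩ := Matrix.exists_mulVec_eq_zero_iff.2 h0
    exact hξ (h.injective s hs ξ hξ0 (hnd s hs _ _ _ (h.isHamiltonian hg hs ξ) hξ0))
  have hMinv : IsBddMeasMat g.T (fun s => (M s)⁻¹) := by
    intro i j
    refine ⟨measurable_matrix_inv_apply (fun i j => (h.continuous_state i j).measurable) i j, ?_⟩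
    have hMc : Continuous M := continuous_matrix h.continuous_state
    have hc : ContinuousOn (fun s => (M s)⁻¹ i j) (Icc 0 g.T) := by
      simp only [Matrix.inv_def, Matrix.smul_apply, Ring.inverse_eq_inv', smul_eq_mul]
      exact (hMc.matrix_det.continuousOn.inv₀ hdet).mul
        (hMc.matrix_adjugate.matrix_elem i j).continuousOn
    obtain ⟨C, hC⟩ := isCompact_Icc.exists_bound_of_continuousOn hc
    exact ⟨C, hC⟩
  have hgain : IsBddMeasMat g.T (g.hamiltonianGain M N) :=
    (hg.R_inv_bdd.mul ((hg.B_bdd.transpose.mul (.of_continuous h.continuous_costate)).add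
      (hg.S_bdd.mul (.of_continuous h.continuous_state)))).neg
  set Θ : ℝ → Matrix (Fin m₁ ⊕ Fin m₂) (Fin n) ℝ :=
    fun s => g.hamiltonianGain M N s * (M s)⁻¹ with hΘ
  have hΘM : ∀ s ∈ Icc 0 g.T, Θ s * M s = g.hamiltonianGain M N s := fun s hs => by
    rw [hΘ, Matrix.mul_assoc, Matrix.nonsing_inv_mul _ (hdet s hs).isUnit, Matrix.mul_one]
  -- `M` is itself a fundamental matrix of the closed-loop equation; its inverse `W` is obtained
  -- from the adjoint equation, which gives its derivative without differentiating an inverse.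
  obtain ⟨Φ, Ψ, hF⟩ := exists_fundamentalPair hT0 (hg.A_bdd.add (hg.B_bdd.mul (hgain.mul hMinv)))
  set W : ℝ → Matrix (Fin n) (Fin n) ℝ := fun s => Φ g.T * Ψ s with hW
  have hWc : ∀ i j, Continuous fun s => W s i j := fun i j => by
    simp only [hW, Matrix.mul_apply]
    exact continuous_finsetSum _ fun k _ => continuous_const.mul (hF.continuous_right k j)
  have hWp : ∀ i j, IsPrimitiveOn 0 g.T (fun s => W s i j)
      (fun s => (-(W s * (g.A s + g.B s * Θ s))) i j) := fun i j =>
    (IsPrimitiveOn.const_matrix_mul (Φ g.T) hF.right i j).congr_deriv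
      (fun s _ => by rw [Matrix.mul_neg, hW, Matrix.mul_assoc]) hT0
  have hWM : ∀ s ∈ Icc 0 g.T, W s * M s = 1 := by
    have hz : ∀ i j, IsPrimitiveOn 0 g.T (fun s => (W s * M s) i j) (fun _ => 0) := fun i j =>
      (IsPrimitiveOn.matrix_mul hWp h.state hT0 i j).congr_deriv (fun s hs => by
        rw [← hΘM s hs, Matrix.neg_mul, ← Matrix.mul_assoc (g.B s) (Θ s) (M s), ← Matrix.add_mul,
          Matrix.mul_assoc, neg_add_cancel]
        rfl) hT0
    intro s hs
    have hWT : W g.T * M g.T = 1 := by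
      rw [h.terminal_state, Matrix.mul_one, hW]
      exact hF.left_mul_right hT
    rw [← hWT]
    ext i j
    rw [(hz i j).eqOn_of_zero s hs, (hz i j).eqOn_of_zero g.T hT]
  have hMW : ∀ s ∈ Icc 0 g.T, M s * W s = 1 := fun s hs => mul_eq_one_comm.1 (hWM s hs)
  have hWT : W g.T = 1 := by
    have := hWM g.T hT
    rwa [h.terminal_state, Matrix.mul_one] at this
  have hfb : ∀ s ∈ Icc 0 g.T, Θ s = -((g.R s)⁻¹ * ((g.B s)ᵀ * (N s * W s) + g.S s)) := by
    intro s hs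
    have e : Θ s = g.hamiltonianGain M N s * W s := by
      rw [← hΘM s hs, Matrix.mul_assoc, hMW s hs, Matrix.mul_one]
    rw [e, hamiltonianGain, Matrix.neg_mul, Matrix.mul_assoc, Matrix.add_mul, Matrix.mul_assoc,
      Matrix.mul_assoc, hMW s hs, Matrix.mul_one]
  refine ⟨fun s => N s * W s, fun i j => ?_, fun s hs => ?_, fun i j => ?_, ?_⟩
  · simp only [Matrix.mul_apply]
    exact continuous_finsetSum _ fun k _ => (h.continuous_costate i k).mul (hWc k j)
  · -- symmetry of the cost form makes `Mᵀ N` symmetric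
    have hsym : ∀ ξ ζ, (M s *ᵥ ξ) ⬝ᵥ (N s *ᵥ ζ) = (M s *ᵥ ζ) ⬝ᵥ (N s *ᵥ ξ) := fun ξ ζ => by
      rw [← (h.isHamiltonian hg hs ζ).costForm_eq hs (h.isHamiltonian hg hs ξ).traj,
        ← (h.isHamiltonian hg hs ξ).costForm_eq hs (h.isHamiltonian hg hs ζ).traj,
        IsTraj.costForm_comm hg]
    have hid : ∀ x : Fin n → ℝ, M s *ᵥ (W s *ᵥ x) = x := fun x => by
      rw [Matrix.mulVec_mulVec, hMW s hs, Matrix.one_mulVec]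
    ext i j
    have := hsym (W s *ᵥ Pi.single i 1) (W s *ᵥ Pi.single j 1)
    rw [hid, hid] at this
    simp only [single_one_dotProduct, Matrix.mulVec_single_one] at this
    exact this.symm
  · refine (IsPrimitiveOn.matrix_mul h.costate hWp hT0 i j).congr_deriv (fun s hs => ?_) hT0
    have e : g.hamiltonianGain M N s * W s = Θ s := by
      rw [← hΘM s hs, Matrix.mul_assoc, hMW s hs, Matrix.mul_one]
    have e1 : (g.Q s * M s) * W s = g.Q s := by
      rw [Matrix.mul_assoc, hMW s hs, Matrix.mul_one]
    have e2 : g.riccatiRHS s (N s * W s) = (N s * W s) * g.A s + (g.A s)ᵀ * (N s * W s) + g.Q s +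
        ((N s * W s) * g.B s + (g.S s)ᵀ) * Θ s := by
      rw [hfb s hs, riccatiRHS, Matrix.mul_neg, ← sub_eq_add_neg, Matrix.mul_assoc _ (g.R s)⁻¹]
    rw [e2, Matrix.neg_mul, Matrix.add_mul, Matrix.add_mul, e1, Matrix.mul_assoc ((g.S s)ᵀ), e]
    refine congrFun (congrFun ?_ i) j
    simp only [Matrix.mul_add, Matrix.add_mul, Matrix.mul_neg, Matrix.mul_assoc]
    abel
  · rw [hWT, Matrix.mul_one, h.terminal_costate]

end LQGame

/-! ### Square-integrable progressively measurable processes -/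

section Processes

variable {Ω : Type*} {mΩ : MeasurableSpace Ω} {μ : Measure Ω} {𝓕 : Filtration ℝ≥0 mΩ} {t T : ℝ}

/-- Real-valued progressively measurable processes on `[t,T]` that are square integrable for
`ds ⊗ P`. -/
structure IsL2Prog (μ : Measure Ω) (𝓕 : Filtration ℝ≥0 mΩ) (t T : ℝ) (f : ℝ → Ω → ℝ) :
    Prop where
  prog : ∀ s ∈ Icc t T,
    Measurable[(inferInstance : MeasurableSpace (Icc t s)).prod (𝓕 s.toNNReal)]
      (fun p : Icc t s × Ω => f p.1 p.2)
  memLp : MemLp (fun p : ℝ × Ω => f p.1 p.2) 2 ((volume.restrict (Icc t T)).prod μ)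

/-- Stopping the time variable at the endpoints of `[t,T]` makes the process jointly measurable. -/
theorem measurable_comp_projIcc {f : ℝ → Ω → ℝ} (htT : t ≤ T)
    (hf : ∀ s ∈ Icc t T,
      Measurable[(inferInstance : MeasurableSpace (Icc t s)).prod (𝓕 s.toNNReal)]
        (fun p : Icc t s × Ω => f p.1 p.2)) :
    Measurable fun p : ℝ × Ω => f (projIcc t T htT p.1) p.2 := by
  have h1 : Measurable fun p : Icc t T × Ω => f p.1 p.2 :=
    (hf T ⟨htT, le_rfl⟩).mono (sup_le_sup le_rfl (MeasurableSpace.comap_mono (𝓕.le _))) le_rfl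
  exact h1.comp
    (((continuous_projIcc (h := htT)).measurable.comp measurable_fst).prodMk measurable_snd)

theorem ae_mem_Icc_prod (μ : Measure Ω) [SFinite μ] (t T : ℝ) :
    ∀ᵐ p ∂((volume.restrict (Icc t T)).prod μ), p.1 ∈ Icc t T :=
  Measure.quasiMeasurePreserving_fst.ae (ae_restrict_mem measurableSet_Icc)

theorem aestronglyMeasurable_of_prog [SFinite μ] {f : ℝ → Ω → ℝ} (htT : t ≤ T)
    (hf : ∀ s ∈ Icc t T,
      Measurable[(inferInstance : MeasurableSpace (Icc t s)).prod (𝓕 s.toNNReal)]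
        (fun p : Icc t s × Ω => f p.1 p.2)) :
    AEStronglyMeasurable (fun p : ℝ × Ω => f p.1 p.2) ((volume.restrict (Icc t T)).prod μ) := by
  refine ⟨_, (measurable_comp_projIcc htT hf).stronglyMeasurable, ?_⟩
  filter_upwards [ae_mem_Icc_prod μ t T] with p hp
  rw [projIcc_of_mem htT hp]

theorem measurable_primitive {Ω' : Type*} [MeasurableSpace Ω'] {s : ℝ} {f : ℝ → Ω' → ℝ}
    (hf : Measurable fun p : Icc t s × Ω' => f p.1 p.2) :
    Measurable fun p : Icc t s × Ω' => ∫ r in t..p.1, f r p.2 := by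
  have hm : Measurable fun z : (Icc t s × Ω') × Icc t s =>
      if (z.2 : ℝ) ≤ z.1.1 then f z.2 z.1.2 else 0 := by
    refine Measurable.ite (measurableSet_le (measurable_subtype_coe.comp measurable_snd)
      (measurable_subtype_coe.comp (measurable_fst.comp measurable_fst))) ?_ measurable_const
    exact hf.comp (measurable_snd.prodMk (measurable_snd.comp measurable_fst))
  have : IsFiniteMeasure ((volume : Measure ℝ).comap ((↑) : Icc t s → ℝ)) :=
    ⟨by
      rw [(MeasurableEmbedding.subtype_coe measurableSet_Icc).comap_apply, image_univ,
        Subtype.range_coe]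
      exact measure_Icc_lt_top⟩
  have := (hm.stronglyMeasurable.integral_prod_right'
    (ν := (volume : Measure ℝ).comap ((↑) : Icc t s → ℝ))).measurable
  convert this using 1
  ext ⟨⟨r, hr⟩, ω⟩
  change ∫ q in t..r, f q ω =
    ∫ q : Icc t s, (if (q : ℝ) ≤ r then f q ω else 0) ∂((volume : Measure ℝ).comap (↑))
  rw [integral_subtype_comap measurableSet_Icc (fun q => if q ≤ r then f q ω else 0),
    intervalIntegral.integral_of_le hr.1, ← integral_Icc_eq_integral_Ioc,
    show Icc t r = Icc t s ∩ Iic r by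
      ext q; simp only [mem_Icc, mem_inter_iff, mem_Iic]
      exact ⟨fun h => ⟨⟨h.1, h.2.trans hr.2⟩, h.2⟩, fun h => ⟨h.1.1, h.2⟩⟩,
    ← setIntegral_indicator measurableSet_Iic]
  rfl

/-- The Cauchy–Schwarz inequality `(∫_t^s h)² ≤ (T - t) ∫_t^T h²`. -/
theorem sq_integral_le {h : ℝ → ℝ} (hh : MemLp h 2 (volume.restrict (Icc t T))) (htT : t ≤ T)
    {s : ℝ} (hs : s ∈ Icc t T) :
    (∫ r in t..s, h r) ^ 2 ≤ (T - t) * ∫ r in Icc t T, h r ^ 2 := by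
  have h1 : IntegrableOn h (Icc t T) := hh.integrable (by norm_num)
  have h2 : IntegrableOn (fun r => h r ^ 2) (Icc t T) := hh.integrable_sq
  set J := ∫ r in Icc t T, |h r| with hJ
  have hle : |∫ r in t..s, h r| ≤ J := by
    rw [intervalIntegral.integral_of_le hs.1]
    refine (abs_integral_le_integral_abs).trans ?_
    exact setIntegral_mono_set h1.abs (.of_forall fun _ => abs_nonneg _)
      (Ioc_subset_Icc_self.trans (Icc_subset_Icc_right hs.2)).eventuallyLE
  have hq : ∀ m : ℝ, 0 ≤ (T - t) * (m * m) + (-2 * J) * m + ∫ r in Icc t T, h r ^ 2 := by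
    intro m
    have : ∫ r in Icc t T, (|h r| - m) ^ 2 =
        (T - t) * (m * m) + (-2 * J) * m + ∫ r in Icc t T, h r ^ 2 := by
      have e : ∀ r, (|h r| - m) ^ 2 = h r ^ 2 + ((-2 * m) * |h r| + m ^ 2) := fun r => by
        rw [sub_sq, sq_abs]; ring
      simp only [e]
      have h3 : IntegrableOn (fun r => (-2 * m) * |h r|) (Icc t T) := h1.abs.const_mul _
      have h4 : IntegrableOn (fun _ => m ^ 2) (Icc t T) := integrable_const _
      have h5 : IntegrableOn (fun r => (-2 * m) * |h r| + m ^ 2) (Icc t T) := h3.add h4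
      rw [integral_add h2 h5, integral_add h3 h4, integral_const_mul,
        setIntegral_const, Real.volume_real_Icc_of_le htT, smul_eq_mul]
      ring
    rw [← this]
    exact integral_nonneg fun r => sq_nonneg _
  have hd := discrim_le_zero hq
  rw [discrim] at hd
  nlinarith [sq_abs (∫ r in t..s, h r), abs_nonneg (∫ r in t..s, h r)]

namespace IsL2Prog

variable {f h : ℝ → Ω → ℝ}

theorem add (hf : IsL2Prog μ 𝓕 t T f) (hh : IsL2Prog μ 𝓕 t T h) :
    IsL2Prog μ 𝓕 t T (fun s ω => f s ω + h s ω) :=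
  ⟨fun s hs => (hf.prog s hs).add (hh.prog s hs), hf.memLp.add hh.memLp⟩

theorem const_mul (c : ℝ) (hf : IsL2Prog μ 𝓕 t T f) :
    IsL2Prog μ 𝓕 t T (fun s ω => c * f s ω) :=
  ⟨fun s hs => (hf.prog s hs).const_mul c, hf.memLp.const_mul c⟩

theorem neg (hf : IsL2Prog μ 𝓕 t T f) : IsL2Prog μ 𝓕 t T (fun s ω => -f s ω) := by
  simpa using hf.const_mul (-1)

theorem measurable_deterministic {φ : ℝ → ℝ} (hφ : Measurable φ) (s : ℝ) :
    Measurable[(inferInstance : MeasurableSpace (Icc t s)).prod (𝓕 s.toNNReal)]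
      (fun p : Icc t s × Ω => φ p.1) :=
  (hφ.comp measurable_subtype_coe).comp
    (@measurable_fst _ _ (inferInstance : MeasurableSpace (Icc t s)) (𝓕 s.toNNReal))

theorem deterministic [IsProbabilityMeasure μ] {φ : ℝ → ℝ} (hφ : Measurable φ)
    (h2 : MemLp φ 2 (volume.restrict (Icc t T))) : IsL2Prog μ 𝓕 t T (fun s _ => φ s) :=
  ⟨fun s _ => measurable_deterministic hφ s, h2.comp_fst μ⟩

theorem mul_bdd [SFinite μ] (ht : 0 ≤ t) {φ : ℝ → ℝ} (hφ : IsBddMeas T φ)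
    (hf : IsL2Prog μ 𝓕 t T f) : IsL2Prog μ 𝓕 t T (fun s ω => φ s * f s ω) := by
  refine ⟨fun s hs => (measurable_deterministic hφ.1 s).mul (hf.prog s hs), ?_⟩
  obtain ⟨C, hC⟩ := hφ.ae_bound ht
  exact hf.memLp.mul (p := ⊤) (q := 2) (r := 2) (memLp_top_of_bound
    (hφ.1.comp measurable_fst).aestronglyMeasurable C (Measure.quasiMeasurePreserving_fst.ae hC))

theorem sum {ι : Type*} (a : Finset ι) {f : ι → ℝ → Ω → ℝ}
    (hf : ∀ i ∈ a, IsL2Prog μ 𝓕 t T (f i)) :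
    IsL2Prog μ 𝓕 t T (fun s ω => ∑ i ∈ a, f i s ω) :=
  ⟨fun s hs => Finset.measurable_sum _ fun i hi => (hf i hi).prog s hs,
    memLp_finsetSum _ fun i hi => (hf i hi).memLp⟩

theorem ae_memLp [SFinite μ] (htT : t ≤ T) (hf : IsL2Prog μ 𝓕 t T f) :
    ∀ᵐ ω ∂μ, MemLp (fun s => f s ω) 2 (volume.restrict (Icc t T)) := by
  filter_upwards [hf.memLp.integrable_sq.prod_left_ae] with ω hω
  refine (memLp_two_iff_integrable_sq ?_).2 hω
  refine ⟨fun s => f (projIcc t T htT s) ω,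
    ((measurable_comp_projIcc htT hf.prog).comp measurable_prodMk_right).stronglyMeasurable, ?_⟩
  filter_upwards [ae_restrict_mem measurableSet_Icc] with s hs
  rw [projIcc_of_mem htT hs]

theorem integrable_integral_mul [SFinite μ] (htT : t ≤ T) (hf : IsL2Prog μ 𝓕 t T f)
    (hh : IsL2Prog μ 𝓕 t T h) : Integrable (fun ω => ∫ s in t..T, f s ω * h s ω) μ := by
  have := (hf.memLp.integrable_mul hh.memLp).integral_prod_right
  simp only [intervalIntegral.integral_of_le htT, ← integral_Icc_eq_integral_Ioc]
  exact this

theorem primitive [IsProbabilityMeasure μ] (htT : t ≤ T) (hf : IsL2Prog μ 𝓕 t T f) :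
    IsL2Prog μ 𝓕 t T (fun s ω => ∫ r in t..s, f r ω) := by
  have hp : ∀ s ∈ Icc t T,
      Measurable[(inferInstance : MeasurableSpace (Icc t s)).prod (𝓕 s.toNNReal)]
        (fun p : Icc t s × Ω => ∫ r in t..p.1, f r p.2) := fun s hs =>
    @measurable_primitive t Ω (𝓕 s.toNNReal) s f (hf.prog s hs)
  refine ⟨hp, ?_⟩
  have hm := aestronglyMeasurable_of_prog (μ := μ) (f := fun s ω => ∫ r in t..s, f r ω) htT hp
  refine (memLp_two_iff_integrable_sq hm).2 ?_
  have hH : Integrable (fun ω => ∫ s in Icc t T, f s ω ^ 2) μ :=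
    hf.memLp.integrable_sq.integral_prod_right
  have hH2 : Integrable (fun p : ℝ × Ω => (T - t) * ∫ s in Icc t T, f s p.2 ^ 2)
      ((volume.restrict (Icc t T)).prod μ) := (hH.comp_snd _).const_mul _
  refine hH2.mono' (hm.pow 2) ?_
  filter_upwards [ae_mem_Icc_prod μ t T,
    Measure.quasiMeasurePreserving_snd.ae (hf.ae_memLp htT)] with p hp1 hp2
  rw [Real.norm_eq_abs, abs_of_nonneg (sq_nonneg _)]
  exact sq_integral_le hp2 htT hp1

end IsL2Prog

/-- A vector-valued process all of whose components are square-integrable processes. -/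
def IsL2ProgVec {ι : Type*} (μ : Measure Ω) (𝓕 : Filtration ℝ≥0 mΩ) (t T : ℝ)
    (f : ℝ → Ω → ι → ℝ) : Prop := ∀ i, IsL2Prog μ 𝓕 t T (fun s ω => f s ω i)

namespace IsL2ProgVec

variable {ι κ : Type*}

theorem add {f h : ℝ → Ω → ι → ℝ} (hf : IsL2ProgVec μ 𝓕 t T f)
    (hh : IsL2ProgVec μ 𝓕 t T h) : IsL2ProgVec μ 𝓕 t T (fun s ω => f s ω + h s ω) :=
  fun i => (hf i).add (hh i)

theorem const_smul (c : ℝ) {f : ℝ → Ω → ι → ℝ} (hf : IsL2ProgVec μ 𝓕 t T f) :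
    IsL2ProgVec μ 𝓕 t T (fun s ω => c • f s ω) := fun i => (hf i).const_mul c

theorem sub {f h : ℝ → Ω → ι → ℝ} (hf : IsL2ProgVec μ 𝓕 t T f)
    (hh : IsL2ProgVec μ 𝓕 t T h) : IsL2ProgVec μ 𝓕 t T (fun s ω => f s ω - h s ω) :=
  fun i => by simpa [sub_eq_add_neg] using (hf i).add (hh i).neg

theorem sumElim {f : ℝ → Ω → ι → ℝ} {h : ℝ → Ω → κ → ℝ} (hf : IsL2ProgVec μ 𝓕 t T f)
    (hh : IsL2ProgVec μ 𝓕 t T h) :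
    IsL2ProgVec μ 𝓕 t T (fun s ω => Sum.elim (f s ω) (h s ω)) := by
  rintro (i | i)
  exacts [hf i, hh i]

theorem mulVec [SFinite μ] [Fintype κ] (ht : 0 ≤ t) {M : ℝ → Matrix ι κ ℝ}
    (hM : IsBddMeasMat T M) {f : ℝ → Ω → κ → ℝ} (hf : IsL2ProgVec μ 𝓕 t T f) :
    IsL2ProgVec μ 𝓕 t T (fun s ω => M s *ᵥ f s ω) := fun i =>
  IsL2Prog.sum _ fun j _ => (hf j).mul_bdd ht (hM i j)

theorem deterministic [IsProbabilityMeasure μ] {φ : ℝ → ι → ℝ}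
    (hφ : ∀ i, Measurable fun s => φ s i) (h2 : IsL2Path t T φ) :
    IsL2ProgVec μ 𝓕 t T (fun s _ => φ s) := fun i => .deterministic (hφ i) (h2 i)

theorem const [IsProbabilityMeasure μ] (x : ι → ℝ) :
    IsL2ProgVec μ 𝓕 t T (fun _ _ => x) :=
  .deterministic (fun _ => measurable_const) (isL2Path_of_continuousOn fun _ => continuousOn_const)

theorem ae_isL2Path [SFinite μ] [Finite ι] (htT : t ≤ T) {f : ℝ → Ω → ι → ℝ}
    (hf : IsL2ProgVec μ 𝓕 t T f) : ∀ᵐ ω ∂μ, IsL2Path t T (fun s => f s ω) :=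
  ae_all_iff.2 fun i => (hf i).ae_memLp htT

theorem integrable_integral_dotProduct [SFinite μ] [Fintype ι] (htT : t ≤ T)
    {f h : ℝ → Ω → ι → ℝ} (hf : IsL2ProgVec μ 𝓕 t T f) (hh : IsL2ProgVec μ 𝓕 t T h) :
    Integrable (fun ω => ∫ s in t..T, f s ω ⬝ᵥ h s ω) μ := by
  have h1 : Integrable (fun ω => ∑ i, ∫ s in t..T, f s ω i * h s ω i) μ :=
    integrable_finsetSum _ fun i _ => (hf i).integrable_integral_mul htT (hh i)
  refine h1.congr ?_
  filter_upwards [hf.ae_isL2Path htT, hh.ae_isL2Path htT] with ω h2 h3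
  rw [← intervalIntegral.integral_finsetSum]
  · rfl
  · intro i _
    exact (intervalIntegrable_iff_integrableOn_Icc_of_le htT).2 ((h2 i).integrable_mul (h3 i))

theorem integrable_dotProduct [Fintype ι] {f h : ℝ → Ω → ι → ℝ}
    (hf : IsL2ProgVec μ 𝓕 t T f) (hh : IsL2ProgVec μ 𝓕 t T h) :
    Integrable (fun p : ℝ × Ω => f p.1 p.2 ⬝ᵥ h p.1 p.2) ((volume.restrict (Icc t T)).prod μ) :=
  integrable_finsetSum _ fun i _ => (hf i).memLp.integrable_mul (hh i).memLp

/-- The variation of constants formula preserves square-integrable progressive measurability. -/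
theorem linearODE [IsProbabilityMeasure μ] [Fintype ι] [DecidableEq ι] {K Φ Ψ : ℝ → Matrix ι ι ℝ}
    (h : IsFundamentalPair T K Φ Ψ) (ht : t ∈ Icc 0 T) (c : ι → ℝ) {f : ℝ → Ω → ι → ℝ}
    (hf : IsL2ProgVec μ 𝓕 t T f) :
    IsL2ProgVec μ 𝓕 t T
      (fun s ω => Φ s *ᵥ (c + fun i => ∫ r in t..s, (Ψ r *ᵥ f r ω) i)) := by
  have h1 : IsL2ProgVec μ 𝓕 t T (fun s ω i => ∫ r in t..s, (Ψ r *ᵥ f r ω) i) := fun i =>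
    IsL2Prog.primitive ht.2 (hf.mulVec ht.1 (.of_continuous h.continuous_right) i)
  exact ((const c).add h1).mulVec ht.1 (.of_continuous h.continuous_left)

end IsL2ProgVec

theorem mem_controls_iff [IsProbabilityMeasure μ] {m : ℕ} (htT : t ≤ T)
    {u : ℝ → Ω → Fin m → ℝ} :
    u ∈ controls μ 𝓕 m t T ↔ IsL2ProgVec μ 𝓕 t T u := by
  have hL : (∀ i, ∀ s ∈ Icc t T,
      Measurable[(inferInstance : MeasurableSpace (Icc t s)).prod (𝓕 s.toNNReal)]
        (fun p : Icc t s × Ω => u p.1 p.2 i)) →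
      (∫⁻ ω, ∫⁻ s in Icc t T, ENNReal.ofReal (u s ω ⬝ᵥ u s ω) ∂volume ∂μ < ⊤ ↔
        ∀ i, MemLp (fun p : ℝ × Ω => u p.1 p.2 i) 2 ((volume.restrict (Icc t T)).prod μ)) := by
    intro hm
    have hm' := fun i => aestronglyMeasurable_of_prog (μ := μ) (f := fun s ω => u s ω i) htT (hm i)
    have hd : AEStronglyMeasurable (fun p : ℝ × Ω => u p.1 p.2 ⬝ᵥ u p.1 p.2)
        ((volume.restrict (Icc t T)).prod μ) :=
      Finset.aestronglyMeasurable_fun_sum _ fun i _ => (hm' i).mul (hm' i)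
    have hnn : ∀ v : Fin m → ℝ, 0 ≤ v ⬝ᵥ v := fun v =>
      Finset.sum_nonneg fun i _ => mul_self_nonneg _
    rw [← lintegral_prod_symm (fun p : ℝ × Ω => ENNReal.ofReal (u p.1 p.2 ⬝ᵥ u p.1 p.2))
      hd.aemeasurable.ennreal_ofReal]
    constructor
    · intro hlt i
      refine (memLp_two_iff_integrable_sq (hm' i)).2 ?_
      have hint : Integrable (fun p : ℝ × Ω => u p.1 p.2 ⬝ᵥ u p.1 p.2)
          ((volume.restrict (Icc t T)).prod μ) :=
        ⟨hd, (hasFiniteIntegral_iff_ofReal (.of_forall fun p => hnn _)).2 hlt⟩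
      refine hint.mono' ((hm' i).pow 2) (.of_forall fun p => ?_)
      rw [Real.norm_eq_abs, abs_of_nonneg (sq_nonneg _), sq]
      exact Finset.single_le_sum (f := fun k => u p.1 p.2 k * u p.1 p.2 k)
        (fun k _ => mul_self_nonneg _) (Finset.mem_univ i)
    · intro h2
      have hint : Integrable (fun p : ℝ × Ω => u p.1 p.2 ⬝ᵥ u p.1 p.2)
          ((volume.restrict (Icc t T)).prod μ) :=
        integrable_finsetSum _ fun i _ => (h2 i).integrable_mul (h2 i)
      exact (hasFiniteIntegral_iff_ofReal (.of_forall fun p => hnn _)).1 hint.2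
  constructor
  · rintro ⟨h1, h2⟩ i
    have hm : ∀ i, ∀ s ∈ Icc t T,
        Measurable[(inferInstance : MeasurableSpace (Icc t s)).prod (𝓕 s.toNNReal)]
          (fun p : Icc t s × Ω => u p.1 p.2 i) := fun i s hs =>
      (measurable_pi_apply i).comp (h1 s hs)
    exact ⟨hm i, (hL hm).1 h2 i⟩
  · intro h
    exact ⟨fun s hs => @measurable_pi_lambda _ _ _ (_) _ _ fun i => (h i).prog s hs,
      (hL fun i => (h i).prog).2 fun i => (h i).memLp⟩

end Processes

/-! ### The criterion as a quadratic functional on processes -/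

theorem forall_isPrimitiveOn_iff {ι : Type*} [Fintype ι] {t T : ℝ} (htT : t ≤ T) {X f : ℝ → ι → ℝ}
    (hf : ∀ i, IntervalIntegrable (fun s => f s i) volume t T) :
    (∀ i, IsPrimitiveOn t T (fun s => X s i) (fun s => f s i)) ↔
      ∀ s ∈ Icc t T, X s = X t + ∫ r in t..s, f r := by
  have hint : ∀ s ∈ Icc t T, ∀ i, (∫ r in t..s, f r) i = ∫ r in t..s, f r i := by
    intro s hs i
    rw [intervalIntegral.integral_of_le hs.1, eval_integral fun k =>
      ((intervalIntegrable_iff_integrableOn_Ioc_of_le htT).1 (hf k)).mono_set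
        (Ioc_subset_Ioc_right hs.2), ← intervalIntegral.integral_of_le hs.1]
  constructor
  · intro h s hs
    ext i
    rw [Pi.add_apply, hint s hs]
    exact (h i).2 s hs
  · intro h i
    refine ⟨hf i, fun s hs => ?_⟩
    beta_reduce
    rw [h s hs, Pi.add_apply, hint s hs]

namespace LQGame

variable {n m₁ m₂ : ℕ} {g : LQGame n m₁ m₂} {α t : ℝ}

theorem isStatePath_iff_isTraj (hg : g.IsNormalized α) (ht : t ∈ Icc 0 g.T) {x : Fin n → ℝ}
    {u₁ : ℝ → Fin m₁ → ℝ} {u₂ : ℝ → Fin m₂ → ℝ}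
    (hu : IsL2Path t g.T (fun s => Sum.elim (u₁ s) (u₂ s))) {X : ℝ → Fin n → ℝ} :
    g.IsStatePath t x u₁ u₂ X ↔ g.IsTraj t (fun s => Sum.elim (u₁ s) (u₂ s)) X ∧ X t = x := by
  have htm : t ∈ Icc t g.T := ⟨le_rfl, ht.2⟩
  have e : ∀ r, g.A r *ᵥ X r + g.B₁ r *ᵥ u₁ r + g.B₂ r *ᵥ u₂ r =
      g.A r *ᵥ X r + g.B r *ᵥ Sum.elim (u₁ r) (u₂ r) := fun r => by
    rw [B, Matrix.fromCols_mulVec, Sum.elim_comp_inl, Sum.elim_comp_inr, add_assoc]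
  have hf : ContinuousOn X (Icc t g.T) → ∀ i, IntervalIntegrable
      (fun r => (g.A r *ᵥ X r + g.B r *ᵥ Sum.elim (u₁ r) (u₂ r)) i) volume t g.T := fun hX =>
    (((isL2Path_of_continuousOn fun i => (continuous_apply i).comp_continuousOn hX).mulVec ht.1
      hg.A_bdd).add (hu.mulVec ht.1 hg.B_bdd)).intervalIntegrable ht.2
  simp only [IsStatePath, e]
  constructor
  · rintro ⟨hX, h⟩
    have h0 : X t = x := by rw [h t htm]; simp
    exact ⟨⟨hu, (forall_isPrimitiveOn_iff ht.2 (hf hX)).2 (by rwa [h0])⟩, h0⟩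
  · rintro ⟨h, rfl⟩
    have hX : ContinuousOn X (Icc t g.T) :=
      continuousOn_pi.2 fun i => (h.state i).continuousOn ht.2
    exact ⟨hX, (forall_isPrimitiveOn_iff ht.2 (hf hX)).1 h.state⟩

theorem isClosedLoopPath_iff_isTraj (hg : g.IsNormalized α)
    {P : ℝ → Matrix (Fin n) (Fin n) ℝ} (hP : g.IsRiccati P) (ht : t ∈ Icc 0 g.T)
    {x : Fin n → ℝ} {X : ℝ → Fin n → ℝ} :
    g.IsClosedLoopPath P t x X ↔ g.IsTraj t (fun s => g.feedback P s *ᵥ X s) X ∧ X t = x := by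
  have htm : t ∈ Icc t g.T := ⟨le_rfl, ht.2⟩
  have e : ∀ r, (g.A r + g.B r * g.feedback P r) *ᵥ X r =
      g.A r *ᵥ X r + g.B r *ᵥ (g.feedback P r *ᵥ X r) := fun r => by
    rw [Matrix.add_mulVec, Matrix.mulVec_mulVec]
  have hX2 : ContinuousOn X (Icc t g.T) → IsL2Path t g.T X := fun hX =>
    isL2Path_of_continuousOn fun i => (continuous_apply i).comp_continuousOn hX
  have hu : ContinuousOn X (Icc t g.T) → IsL2Path t g.T (fun s => g.feedback P s *ᵥ X s) :=
    fun hX => (hX2 hX).mulVec ht.1 (feedback_bdd hg hP.continuous)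
  have hf : ContinuousOn X (Icc t g.T) → ∀ i, IntervalIntegrable
      (fun r => (g.A r *ᵥ X r + g.B r *ᵥ (g.feedback P r *ᵥ X r)) i) volume t g.T := fun hX =>
    (((hX2 hX).mulVec ht.1 hg.A_bdd).add ((hu hX).mulVec ht.1 hg.B_bdd)).intervalIntegrable ht.2
  simp only [IsClosedLoopPath, e]
  constructor
  · rintro ⟨hX, h⟩
    have h0 : X t = x := by rw [h t htm]; simp
    exact ⟨⟨hu hX, (forall_isPrimitiveOn_iff ht.2 (hf hX)).2 (by rwa [h0])⟩, h0⟩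
  · rintro ⟨h, rfl⟩
    have hX : ContinuousOn X (Icc t g.T) :=
      continuousOn_pi.2 fun i => (h.state i).continuousOn ht.2
    exact ⟨hX, (forall_isPrimitiveOn_iff ht.2 (hf hX)).1 h.state⟩

theorem IsRiccati.closedLoop_unique {P : ℝ → Matrix (Fin n) (Fin n) ℝ} (hP : g.IsRiccati P)
    (hg : g.IsNormalized α) (ht : t ∈ Icc 0 g.T) {X Y : ℝ → Fin n → ℝ}
    (hX : g.IsTraj t (fun s => g.feedback P s *ᵥ X s) X)
    (hY : g.IsTraj t (fun s => g.feedback P s *ᵥ Y s) Y) (h0 : X t = Y t) :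
    EqOn X Y (Icc t g.T) := by
  obtain ⟨Φ, Ψ, h⟩ := exists_fundamentalPair hg.T_pos.le (closedLoop_bdd hg hP.continuous)
  have hcl : ∀ {Z : ℝ → Fin n → ℝ}, g.IsTraj t (fun s => g.feedback P s *ᵥ Z s) Z → ∀ i,
      IsPrimitiveOn t g.T (fun s => Z s i) (fun s =>
        ((g.A s + g.B s * g.feedback P s) *ᵥ Z s + (fun _ => 0 : ℝ → Fin n → ℝ) s) i) := by
    intro Z hZ i
    refine (hZ.state i).congr_deriv (fun s _ => ?_) ht.2
    beta_reduce
    rw [add_zero, Matrix.add_mulVec, Matrix.mulVec_mulVec]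
  intro s hs
  rw [h.eq_of_isPrimitiveOn ht (hcl hX) hs, h.eq_of_isPrimitiveOn ht (hcl hY) hs, h0]

section Game

variable {Ω : Type*} {mΩ : MeasurableSpace Ω} {μ : Measure Ω} {𝓕 : Filtration ℝ≥0 mΩ}

/-- A pair of control processes `U` with its state process `X`, started at `(t,x)`: both are
square-integrable processes and almost every path is a trajectory. -/
structure IsStochTraj (g : LQGame n m₁ m₂) (μ : Measure Ω) (𝓕 : Filtration ℝ≥0 mΩ) (t : ℝ)
    (x : Fin n → ℝ) (U : ℝ → Ω → Fin m₁ ⊕ Fin m₂ → ℝ) (X : ℝ → Ω → Fin n → ℝ) : Prop where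
  control : IsL2ProgVec μ 𝓕 t g.T U
  state : IsL2ProgVec μ 𝓕 t g.T X
  traj : ∀ᵐ ω ∂μ, g.IsTraj t (fun s => U s ω) (fun s => X s ω)
  init : ∀ᵐ ω ∂μ, X t ω = x

/-- The expected cost form, the polarization of the criterion. -/
def expForm (g : LQGame n m₁ m₂) (μ : Measure Ω) (t : ℝ) (U : ℝ → Ω → Fin m₁ ⊕ Fin m₂ → ℝ)
    (X : ℝ → Ω → Fin n → ℝ) (V : ℝ → Ω → Fin m₁ ⊕ Fin m₂ → ℝ) (Y : ℝ → Ω → Fin n → ℝ) : ℝ :=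
  ∫ ω, g.costForm t (fun s => U s ω) (fun s => X s ω) (fun s => V s ω) (fun s => Y s ω) ∂μ

theorem exists_isStochTraj [IsProbabilityMeasure μ] (hg : g.IsNormalized α)
    (ht : t ∈ Icc 0 g.T) {U : ℝ → Ω → Fin m₁ ⊕ Fin m₂ → ℝ} (hU : IsL2ProgVec μ 𝓕 t g.T U)
    (x : Fin n → ℝ) : ∃ X, g.IsStochTraj μ 𝓕 t x U X := by
  obtain ⟨Φ, Ψ, h⟩ := exists_fundamentalPair hg.T_pos.le hg.A_bdd
  refine ⟨_, hU, .linearODE h ht (Ψ t *ᵥ x) (hU.mulVec ht.1 hg.B_bdd), ?_, .of_forall fun ω => ?_⟩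
  · filter_upwards [hU.ae_isL2Path ht.2] with ω hω
    exact ⟨hω, h.isPrimitiveOn_formula ht (Ψ t *ᵥ x)
      ((hω.mulVec ht.1 hg.B_bdd).intervalIntegrable ht.2)⟩
  · have : (Ψ t *ᵥ x + fun i => ∫ r in t..t, (Ψ r *ᵥ (g.B r *ᵥ U r ω)) i) = Ψ t *ᵥ x := by
      ext i; simp
    rw [this, Matrix.mulVec_mulVec, h.left_mul_right ht, Matrix.one_mulVec]

namespace IsStochTraj

variable {x y : Fin n → ℝ} {U V W : ℝ → Ω → Fin m₁ ⊕ Fin m₂ → ℝ} {X Y Z : ℝ → Ω → Fin n → ℝ}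

theorem add (hX : g.IsStochTraj μ 𝓕 t x U X) (hY : g.IsStochTraj μ 𝓕 t y V Y) :
    g.IsStochTraj μ 𝓕 t (x + y) (fun s ω => U s ω + V s ω) (fun s ω => X s ω + Y s ω) where
  control := hX.control.add hY.control
  state := hX.state.add hY.state
  traj := by filter_upwards [hX.traj, hY.traj] with ω h1 h2 using h1.add h2
  init := by filter_upwards [hX.init, hY.init] with ω h1 h2 using by rw [h1, h2]

theorem const_smul (hX : g.IsStochTraj μ 𝓕 t x U X) (c : ℝ) :
    g.IsStochTraj μ 𝓕 t (c • x) (fun s ω => c • U s ω) (fun s ω => c • X s ω) where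
  control := hX.control.const_smul c
  state := hX.state.const_smul c
  traj := by filter_upwards [hX.traj] with ω h1 using h1.const_smul c
  init := by filter_upwards [hX.init] with ω h1 using by rw [h1]

/-- The product rule turns the terminal cost into a time integral of products of square-integrable
processes. -/
theorem integrable_costForm [IsProbabilityMeasure μ] (hg : g.IsNormalized α) (ht : t ∈ Icc 0 g.T)
    (hX : g.IsStochTraj μ 𝓕 t x U X) (hY : g.IsStochTraj μ 𝓕 t y V Y) :
    Integrable (fun ω => g.costForm t (fun s => U s ω) (fun s => X s ω) (fun s => V s ω)
      (fun s => Y s ω)) μ := by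
  have hG : IsBddMeasMat g.T (fun _ => g.G) := .const _
  have dX := (hX.state.mulVec ht.1 hg.A_bdd).add (hX.control.mulVec ht.1 hg.B_bdd)
  have dY := (hY.state.mulVec ht.1 hg.A_bdd).add (hY.control.mulVec ht.1 hg.B_bdd)
  have i1 := dX.integrable_integral_dotProduct ht.2 (hY.state.mulVec ht.1 hG)
  have i2 := hX.state.integrable_integral_dotProduct ht.2 (dY.mulVec ht.1 hG)
  have i3 := (hX.state.sumElim hX.control).integrable_integral_dotProduct ht.2
    ((hY.state.sumElim hY.control).mulVec ht.1 hg.costMatrix_bdd)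
  refine (((integrable_const (x ⬝ᵥ (g.G *ᵥ y))).add (i1.add i2)).add i3).congr ?_
  filter_upwards [hX.traj, hY.traj, hX.init, hY.init] with ω tX tY x0 y0
  have hGY : ∀ i, IsPrimitiveOn t g.T (fun s => (g.G *ᵥ Y s ω) i)
      (fun s => (g.G *ᵥ (g.A s *ᵥ Y s ω + g.B s *ᵥ V s ω)) i) := fun i => by
    simp only [Matrix.mulVec, dotProduct]
    exact IsPrimitiveOn.sum _ fun j _ => (tY.state j).const_mul _
  have hp := (IsPrimitiveOn.dotProduct tX.state hGY ht.2).sub_eq ht.2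
  have l2 : ∀ {U : ℝ → Fin m₁ ⊕ Fin m₂ → ℝ} {X : ℝ → Fin n → ℝ}, g.IsTraj t U X →
      IsL2Path t g.T (fun s => g.A s *ᵥ X s + g.B s *ᵥ U s) := fun h =>
    ((h.state_memLp ht.2).mulVec ht.1 hg.A_bdd).add (h.control.mulVec ht.1 hg.B_bdd)
  rw [intervalIntegral.integral_add
    ((l2 tX).intervalIntegrable_dotProduct ht.2 ((tY.state_memLp ht.2).mulVec ht.1 hG))
    ((tX.state_memLp ht.2).intervalIntegrable_dotProduct ht.2 ((l2 tY).mulVec ht.1 hG)),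
    x0, y0] at hp
  simp only [Pi.add_apply, costForm]
  linarith

theorem expForm_add_right [IsProbabilityMeasure μ] (hg : g.IsNormalized α) (ht : t ∈ Icc 0 g.T)
    {z : Fin n → ℝ} (hX : g.IsStochTraj μ 𝓕 t x U X) (hY : g.IsStochTraj μ 𝓕 t y V Y)
    (hZ : g.IsStochTraj μ 𝓕 t z W Z) :
    g.expForm μ t U X (fun s ω => V s ω + W s ω) (fun s ω => Y s ω + Z s ω) =
      g.expForm μ t U X V Y + g.expForm μ t U X W Z := by
  rw [expForm, expForm, expForm, ← integral_add (integrable_costForm hg ht hX hY)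
    (integrable_costForm hg ht hX hZ)]
  refine integral_congr_ae ?_
  filter_upwards [hX.traj, hY.traj, hZ.traj] with ω h1 h2 h3
  exact IsTraj.costForm_add_right hg ht h2 h3 h1

theorem expForm_line [IsProbabilityMeasure μ] (hg : g.IsNormalized α) (ht : t ∈ Icc 0 g.T)
    (hX : g.IsStochTraj μ 𝓕 t x U X) (hY : g.IsStochTraj μ 𝓕 t y V Y) (c : ℝ) :
    g.expForm μ t (fun s ω => U s ω + c • V s ω) (fun s ω => X s ω + c • Y s ω)
        (fun s ω => U s ω + c • V s ω) (fun s ω => X s ω + c • Y s ω) =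
      g.expForm μ t U X U X + 2 * c * g.expForm μ t U X V Y +
        c ^ 2 * g.expForm μ t V Y V Y := by
  have i1 := integrable_costForm hg ht hX hX
  have i2 := (integrable_costForm hg ht hX hY).const_mul (2 * c)
  have i3 := (integrable_costForm hg ht hY hY).const_mul (c ^ 2)
  have i12 := i1.fun_add i2
  simp only [expForm]
  rw [← integral_const_mul, ← integral_const_mul, ← integral_add i1 i2, ← integral_add i12 i3]
  refine integral_congr_ae ?_
  filter_upwards [hX.traj, hY.traj] with ω h1 h2
  exact IsTraj.costForm_line hg ht h1 h2 c

end IsStochTraj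

theorem J_eq_expForm (hg : g.IsNormalized α) (ht : t ∈ Icc 0 g.T) {x : Fin n → ℝ}
    {u₁ : ℝ → Ω → Fin m₁ → ℝ} {u₂ : ℝ → Ω → Fin m₂ → ℝ} {X : ℝ → Ω → Fin n → ℝ}
    (hX : g.IsStochTraj μ 𝓕 t x (fun s ω => Sum.elim (u₁ s ω) (u₂ s ω)) X) :
    g.J μ t x u₁ u₂ = g.expForm μ t (fun s ω => Sum.elim (u₁ s ω) (u₂ s ω)) X
      (fun s ω => Sum.elim (u₁ s ω) (u₂ s ω)) X := by
  rw [J, expForm]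
  refine integral_congr_ae ?_
  filter_upwards [hX.traj, hX.init] with ω h1 h2
  have hex : ∃ X, g.IsStatePath t x (fun s => u₁ s ω) (fun s => u₂ s ω) X :=
    ⟨_, (isStatePath_iff_isTraj hg ht h1.control).2 ⟨h1, h2⟩⟩
  have hsp := hex.choose_spec
  have hst : g.statePath t x (fun s => u₁ s ω) (fun s => u₂ s ω) = hex.choose := by
    rw [statePath, dif_pos hex]
  obtain ⟨h3, h4⟩ := (isStatePath_iff_isTraj hg ht h1.control).1 hsp
  rw [hst]
  change g.costForm t _ hex.choose _ hex.choose = _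
  have heq := h3.unique hg ht h1 (h4.trans h2.symm)
  exact IsTraj.costForm_congr ht.2 (.of_forall fun _ => rfl) heq (.of_forall fun _ => rfl) heq

/-- The criterion is quadratic along lines of controls. -/
theorem J_line [IsProbabilityMeasure μ] (hg : g.IsNormalized α) (ht : t ∈ Icc 0 g.T)
    {x : Fin n → ℝ} {u₁ h₁ : ℝ → Ω → Fin m₁ → ℝ} {u₂ h₂ : ℝ → Ω → Fin m₂ → ℝ}
    {X Y : ℝ → Ω → Fin n → ℝ}
    (hX : g.IsStochTraj μ 𝓕 t x (fun s ω => Sum.elim (u₁ s ω) (u₂ s ω)) X)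
    (hY : g.IsStochTraj μ 𝓕 t 0 (fun s ω => Sum.elim (h₁ s ω) (h₂ s ω)) Y) (c : ℝ) :
    g.J μ t x (fun s ω => u₁ s ω + c • h₁ s ω) (fun s ω => u₂ s ω + c • h₂ s ω) =
      g.J μ t x u₁ u₂ +
      2 * c * g.expForm μ t (fun s ω => Sum.elim (u₁ s ω) (u₂ s ω)) X
        (fun s ω => Sum.elim (h₁ s ω) (h₂ s ω)) Y +
      c ^ 2 * g.expForm μ t (fun s ω => Sum.elim (h₁ s ω) (h₂ s ω)) Y
        (fun s ω => Sum.elim (h₁ s ω) (h₂ s ω)) Y := by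
  have e : (fun s ω => Sum.elim (u₁ s ω + c • h₁ s ω) (u₂ s ω + c • h₂ s ω)) =
      fun s ω => Sum.elim (u₁ s ω) (u₂ s ω) + c • Sum.elim (h₁ s ω) (h₂ s ω) := by
    funext s ω
    ext (i | i) <;> rfl
  have hL := hX.add (hY.const_smul c)
  rw [smul_zero, add_zero] at hL
  have hJ := J_eq_expForm (u₁ := fun s ω => u₁ s ω + c • h₁ s ω)
    (u₂ := fun s ω => u₂ s ω + c • h₂ s ω) hg ht (by rw [e]; exact hL)
  rw [hJ, J_eq_expForm hg ht hX, ← IsStochTraj.expForm_line hg ht hX hY c]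
  simp only [congrFun (congrFun e _) _]

end Game

end LQGame

/-! ### Consequences of finite values -/

theorem nonneg_of_forall_le_quadratic {a b q c : ℝ} (h : ∀ l : ℝ, c ≤ a + 2 * l * b + l ^ 2 * q) :
    0 ≤ q ∧ (q = 0 → b = 0) := by
  constructor
  · by_contra! hq
    -- for large `l` the quadratic term dominates
    have h1 := h (1 + (|a - c| + 2 * |b|) / (-q))
    set k := (|a - c| + 2 * |b|) / (-q) with hk
    have hk0 : 0 ≤ k := by
      have : 0 < -q := by linarith
      positivity
    have hkq : k * q = -(|a - c| + 2 * |b|) := by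
      rw [hk, div_mul_eq_mul_div, div_neg, mul_div_assoc, div_self hq.ne, mul_one]
    nlinarith [le_abs_self (a - c), le_abs_self b, neg_abs_le b, abs_nonneg b, abs_nonneg (a - c),
      mul_nonneg hk0 (abs_nonneg b), mul_nonneg hk0 (abs_nonneg (a - c))]
  · rintro rfl
    by_contra hb
    have h1 := h ((c - a - 1) / (2 * b))
    have : 2 * ((c - a - 1) / (2 * b)) * b = c - a - 1 := by field_simp
    linarith

theorem eq_zero_of_forall_nonneg_quadratic {b q : ℝ} (h : ∀ l : ℝ, 0 ≤ 2 * l * b + l ^ 2 * q) :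
    b = 0 := by
  have h1 : ∀ l : ℝ, 0 ≤ q * (l * l) + (2 * b) * l + 0 := fun l => by
    have := h l
    nlinarith
  have hd := discrim_le_zero h1
  rw [discrim] at hd
  nlinarith [sq_nonneg b]

/-- A square-integrable path has a Borel version. -/
theorem IsL2Path.exists_measurable {ι : Type*} [Finite ι] {t T : ℝ} {z : ℝ → ι → ℝ}
    (hz : IsL2Path t T z) : ∃ w : ℝ → ι → ℝ, (∀ i, Measurable fun s => w s i) ∧
      IsL2Path t T w ∧ ∀ᵐ s ∂(volume.restrict (Icc t T)), z s = w s := by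
  have hae : ∀ i, (fun s => z s i) =ᵐ[volume.restrict (Icc t T)] (hz i).1.mk :=
    fun i => (hz i).1.ae_eq_mk
  refine ⟨fun s i => (hz i).1.mk _ s, fun i => (hz i).1.stronglyMeasurable_mk.measurable,
    fun i => (hz i).ae_eq (hae i), ?_⟩
  filter_upwards [ae_all_iff.2 hae] with s hs
  funext i
  exact hs i

namespace LQGame

variable {n m₁ m₂ : ℕ} {g : LQGame n m₁ m₂} {α t : ℝ}

section Game

variable {Ω : Type*} {mΩ : MeasurableSpace Ω} {μ : Measure Ω} {𝓕 : Filtration ℝ≥0 mΩ}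

theorem exists_le_J_of_lowerValue_ne_bot {x : Fin n → ℝ} (h : g.lowerValue μ 𝓕 t x ≠ ⊥) :
    ∃ u₂ ∈ controls μ 𝓕 m₂ t g.T, ∃ c : ℝ, ∀ u₁ ∈ controls μ 𝓕 m₁ t g.T,
      c ≤ g.J μ t x u₁ u₂ := by
  by_contra! hc
  refine h (eq_bot_iff.2 (iSup₂_le fun u₂ hu₂ => ?_))
  refine EReal.le_of_forall_lt_iff_le.1 fun c _ => ?_
  obtain ⟨u₁, hu₁, hlt⟩ := hc u₂ hu₂ c
  exact (iInf₂_le u₁ hu₁).trans (EReal.coe_le_coe_iff.2 hlt.le)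

theorem exists_J_le_of_upperValue_ne_top {x : Fin n → ℝ} (h : g.upperValue μ 𝓕 t x ≠ ⊤) :
    ∃ u₁ ∈ controls μ 𝓕 m₁ t g.T, ∃ c : ℝ, ∀ u₂ ∈ controls μ 𝓕 m₂ t g.T,
      g.J μ t x u₁ u₂ ≤ c := by
  by_contra! hc
  refine h (eq_top_iff.2 (le_iInf₂ fun u₁ hu₁ => ?_))
  refine EReal.ge_of_forall_gt_iff_ge.1 fun c _ => ?_
  obtain ⟨u₂, hu₂, hlt⟩ := hc u₁ hu₁ c
  exact (EReal.coe_le_coe_iff.2 hlt.le).trans (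
    le_iSup₂ (f := fun u₂ _ => (g.J μ t x u₁ u₂ : EReal)) u₂ hu₂)

theorem sumElim_mem [IsProbabilityMeasure μ] (htT : t ≤ g.T) {u₁ : ℝ → Ω → Fin m₁ → ℝ}
    {u₂ : ℝ → Ω → Fin m₂ → ℝ} (h₁ : u₁ ∈ controls μ 𝓕 m₁ t g.T)
    (h₂ : u₂ ∈ controls μ 𝓕 m₂ t g.T) :
    IsL2ProgVec μ 𝓕 t g.T (fun s ω => Sum.elim (u₁ s ω) (u₂ s ω)) :=
  ((mem_controls_iff htT).1 h₁).sumElim ((mem_controls_iff htT).1 h₂)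

/-- A deterministic trajectory from the state `0` is, up to the choice of versions, a trajectory
process. -/
theorem IsTraj.exists_process [IsProbabilityMeasure μ] (hg : g.IsNormalized α)
    (ht : t ∈ Icc 0 g.T) {V W : ℝ → Fin m₁ ⊕ Fin m₂ → ℝ} {Y : ℝ → Fin n → ℝ}
    (hY : g.IsTraj t V Y) (h0 : Y t = 0)
    (hVW : ∀ᵐ s ∂(volume.restrict (Icc t g.T)), V s = W s)
    (hW : ∀ i, Measurable fun s => W s i) :
    ∃ Y', g.IsStochTraj μ 𝓕 t 0 (fun s _ => W s) Y' ∧ ∀ᵐ ω ∂μ,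
      (∀ U X, g.costForm t U X W (fun s => Y' s ω) = g.costForm t U X V Y) ∧
        g.costForm t W (fun s => Y' s ω) W (fun s => Y' s ω) = g.costForm t V Y V Y := by
  have hY' := hY.congr_control ht.2 hVW
  obtain ⟨Y', h⟩ := exists_isStochTraj (μ := μ) (𝓕 := 𝓕) hg ht
    (IsL2ProgVec.deterministic hW hY'.control) 0
  refine ⟨Y', h, ?_⟩
  filter_upwards [h.traj, h.init] with ω h1 h2
  have heq := h1.unique hg ht hY' (h2.trans h0.symm)
  have hWV : ∀ᵐ s ∂(volume.restrict (Icc t g.T)), W s = V s := by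
    filter_upwards [hVW] with s hs using hs.symm
  exact ⟨fun U X => costForm_congr ht.2 (.of_forall fun _ => rfl) (fun _ _ => rfl) hWV heq,
    costForm_congr ht.2 hWV heq hWV heq⟩

/-- Finiteness of the lower value makes the cost form positive semidefinite on the trajectories
from `0` driven by the first player; on its kernel the first-order term vanishes against some
control of the second player. -/
theorem costForm_nonneg_of_lowerValue [IsProbabilityMeasure μ] (hg : g.IsNormalized α)
    (ht : t ∈ Icc 0 g.T) {x : Fin n → ℝ} (hv : g.lowerValue μ 𝓕 t x ≠ ⊥) {v : ℝ → Fin m₁ → ℝ}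
    {Y : ℝ → Fin n → ℝ} (hY : g.IsTraj t (fun s => Sum.elim (v s) 0) Y) (h0 : Y t = 0) :
    0 ≤ g.costForm t (fun s => Sum.elim (v s) 0) Y (fun s => Sum.elim (v s) 0) Y ∧
    (g.costForm t (fun s => Sum.elim (v s) 0) Y (fun s => Sum.elim (v s) 0) Y = 0 →
      ∃ (u : ℝ → Ω → Fin m₂ → ℝ) (X : ℝ → Ω → Fin n → ℝ),
        g.IsStochTraj μ 𝓕 t x (fun s ω => Sum.elim 0 (u s ω)) X ∧
        ∫ ω, g.costForm t (fun s => Sum.elim 0 (u s ω)) (fun s => X s ω)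
          (fun s => Sum.elim (v s) 0) Y ∂μ = 0) := by
  obtain ⟨u, hu, c, hc⟩ := exists_le_J_of_lowerValue_ne_bot hv
  obtain ⟨w, hwm, hw2, hvw⟩ :=
    IsL2Path.exists_measurable (z := v) fun i => hY.control (.inl i)
  obtain ⟨Y', hp, hcost⟩ := hY.exists_process (μ := μ) (𝓕 := 𝓕) (W := fun s => Sum.elim (w s) 0)
    hg ht h0 (by filter_upwards [hvw] with s hs using by rw [hs])
    (by rintro (i | i); exacts [hwm i, measurable_const])
  have h0c : (fun _ _ => 0 : ℝ → Ω → Fin m₁ → ℝ) ∈ controls μ 𝓕 m₁ t g.T :=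
    (mem_controls_iff ht.2).2 (.const 0)
  obtain ⟨X, hX⟩ := exists_isStochTraj hg ht (sumElim_mem ht.2 h0c hu) x
  have e1 : g.expForm μ t (fun s ω => Sum.elim 0 (u s ω)) X (fun s _ => Sum.elim (w s) 0) Y' =
      ∫ ω, g.costForm t (fun s => Sum.elim 0 (u s ω)) (fun s => X s ω)
          (fun s => Sum.elim (v s) 0) Y ∂μ := by
    refine integral_congr_ae ?_
    filter_upwards [hcost] with ω h1 using h1.1 _ _
  have e2 : g.expForm μ t (fun s _ => Sum.elim (w s) 0) Y' (fun s _ => Sum.elim (w s) 0) Y' =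
      g.costForm t (fun s => Sum.elim (v s) 0) Y (fun s => Sum.elim (v s) 0) Y := by
    rw [expForm, integral_congr_ae (g := fun _ => g.costForm t (fun s => Sum.elim (v s) 0) Y
      (fun s => Sum.elim (v s) 0) Y) (by filter_upwards [hcost] with ω h1 using h1.2)]
    simp
  have hq := nonneg_of_forall_le_quadratic (c := c) fun l => by
    have hJ := J_line (h₁ := fun s _ => w s) (h₂ := fun _ _ => 0) hg ht hX hp l
    rw [e1, e2] at hJ
    refine (hc _ ?_).trans_eq ((congrArg (g.J μ t x _) ?_).trans hJ)
    · exact (mem_controls_iff ht.2).2 ((IsL2ProgVec.const 0).add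
        ((IsL2ProgVec.deterministic hwm hw2).const_smul l))
    · funext s ω; simp
  exact ⟨hq.1, fun h => ⟨u, X, hX, hq.2 h⟩⟩

/-- The counterpart of `costForm_nonneg_of_lowerValue` for the second player. -/
theorem costForm_nonpos_of_upperValue [IsProbabilityMeasure μ] (hg : g.IsNormalized α)
    (ht : t ∈ Icc 0 g.T) {x : Fin n → ℝ} (hv : g.upperValue μ 𝓕 t x ≠ ⊤) {v : ℝ → Fin m₂ → ℝ}
    {Y : ℝ → Fin n → ℝ} (hY : g.IsTraj t (fun s => Sum.elim 0 (v s)) Y) (h0 : Y t = 0) :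
    g.costForm t (fun s => Sum.elim 0 (v s)) Y (fun s => Sum.elim 0 (v s)) Y ≤ 0 ∧
    (g.costForm t (fun s => Sum.elim 0 (v s)) Y (fun s => Sum.elim 0 (v s)) Y = 0 →
      ∃ (u : ℝ → Ω → Fin m₁ → ℝ) (X : ℝ → Ω → Fin n → ℝ),
        g.IsStochTraj μ 𝓕 t x (fun s ω => Sum.elim (u s ω) 0) X ∧
        ∫ ω, g.costForm t (fun s => Sum.elim (u s ω) 0) (fun s => X s ω)
          (fun s => Sum.elim 0 (v s)) Y ∂μ = 0) := by
  obtain ⟨u, hu, c, hc⟩ := exists_J_le_of_upperValue_ne_top hv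
  obtain ⟨w, hwm, hw2, hvw⟩ :=
    IsL2Path.exists_measurable (z := v) fun i => hY.control (.inr i)
  obtain ⟨Y', hp, hcost⟩ := hY.exists_process (μ := μ) (𝓕 := 𝓕) (W := fun s => Sum.elim 0 (w s))
    hg ht h0 (by filter_upwards [hvw] with s hs using by rw [hs])
    (by rintro (i | i); exacts [measurable_const, hwm i])
  have h0c : (fun _ _ => 0 : ℝ → Ω → Fin m₂ → ℝ) ∈ controls μ 𝓕 m₂ t g.T :=
    (mem_controls_iff ht.2).2 (.const 0)
  obtain ⟨X, hX⟩ := exists_isStochTraj hg ht (sumElim_mem ht.2 hu h0c) x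
  have e1 : g.expForm μ t (fun s ω => Sum.elim (u s ω) 0) X (fun s _ => Sum.elim 0 (w s)) Y' =
      ∫ ω, g.costForm t (fun s => Sum.elim (u s ω) 0) (fun s => X s ω)
          (fun s => Sum.elim 0 (v s)) Y ∂μ := by
    refine integral_congr_ae ?_
    filter_upwards [hcost] with ω h1 using h1.1 _ _
  have e2 : g.expForm μ t (fun s _ => Sum.elim 0 (w s)) Y' (fun s _ => Sum.elim 0 (w s)) Y' =
      g.costForm t (fun s => Sum.elim 0 (v s)) Y (fun s => Sum.elim 0 (v s)) Y := by
    rw [expForm, integral_congr_ae (g := fun _ => g.costForm t (fun s => Sum.elim 0 (v s)) Y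
      (fun s => Sum.elim 0 (v s)) Y) (by filter_upwards [hcost] with ω h1 using h1.2)]
    simp
  set b := ∫ ω, g.costForm t (fun s => Sum.elim (u s ω) 0) (fun s => X s ω)
    (fun s => Sum.elim 0 (v s)) Y ∂μ with hb
  set q := g.costForm t (fun s => Sum.elim 0 (v s)) Y (fun s => Sum.elim 0 (v s)) Y with hqdef
  have hq := nonneg_of_forall_le_quadratic (c := -c) (a := -g.J μ t x u fun _ _ => 0) (b := -b)
    (q := -q) fun l => by
      have hJ := J_line (h₁ := fun _ _ => 0) (h₂ := fun s _ => w s) hg ht hX hp l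
      rw [e1, e2] at hJ
      have h1 := hc (fun s ω => 0 + l • w s) ((mem_controls_iff ht.2).2
        ((IsL2ProgVec.const 0).add ((IsL2ProgVec.deterministic hwm hw2).const_smul l)))
      have h2 : (fun s ω => u s ω + l • (0 : Fin m₁ → ℝ)) = u := by funext s ω; simp
      rw [h2] at hJ
      linarith
  exact ⟨by linarith [hq.1], fun h => ⟨u, X, hX, by linarith [hq.2 (by rw [h, neg_zero])]⟩⟩

/-- If both values are finite at time `t`, a solution of the Hamiltonian system with state `0` at
time `t` has costate `0` at time `t`. Its control splits as `v = (v₁, 0) + (0, v₂)`, and the cost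
form vanishes between `v` and all trajectories from `0`. The sign conditions put both parts in the
kernels of the diagonal blocks, and finiteness kills the remaining linear term in the initial
state. -/
theorem IsHamiltonian.costate_eq_zero [IsProbabilityMeasure μ] (hg : g.IsNormalized α)
    (hfin : g.FiniteValues μ 𝓕) (ht : t ∈ Icc 0 g.T) {V : ℝ → Fin m₁ ⊕ Fin m₂ → ℝ}
    {Y η : ℝ → Fin n → ℝ} (h : g.IsHamiltonian t V Y η) (h0 : Y t = 0) : η t = 0 := by
  set v₁ : ℝ → Fin m₁ → ℝ := fun s i => V s (.inl i) with hv₁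
  set v₂ : ℝ → Fin m₂ → ℝ := fun s i => V s (.inr i) with hv₂
  have hL1 : IsL2Path t g.T (fun s => Sum.elim (v₁ s) (0 : Fin m₂ → ℝ)) := by
    rintro (i | i)
    exacts [h.traj.control (.inl i), MemLp.zero]
  obtain ⟨Y₁, hY₁, hY₁0⟩ := IsTraj.exists_traj hg ht hL1 0
  have hY₂ : g.IsTraj t (fun s => Sum.elim (0 : Fin m₁ → ℝ) (v₂ s))
      (fun s => Y s + (-1 : ℝ) • Y₁ s) := by
    have := h.traj.add (hY₁.const_smul (-1))
    convert this using 1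
    funext s
    ext (i | i) <;> simp [hv₁, hv₂]
  set Y₂ : ℝ → Fin n → ℝ := fun s => Y s + (-1 : ℝ) • Y₁ s with hY₂def
  have hY₂0 : Y₂ t = 0 := by simp [hY₂def, h0, hY₁0]
  have hVs : V = fun s => Sum.elim (v₁ s) (0 : Fin m₂ → ℝ) + Sum.elim (0 : Fin m₁ → ℝ) (v₂ s) := by
    funext s
    ext (i | i) <;> simp [hv₁, hv₂]
  have hYs : Y = fun s => Y₁ s + Y₂ s := by
    funext s
    simp [hY₂def]
  -- splitting of the cost form against the Hamiltonian solution
  have hsplit : ∀ U X, g.IsTraj t U X → g.costForm t U X (fun s => Sum.elim (v₁ s) 0) Y₁ +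
      g.costForm t U X (fun s => Sum.elim 0 (v₂ s)) Y₂ = X t ⬝ᵥ η t := by
    intro U X hX
    rw [← h.costForm_eq ht hX, hVs, hYs, IsTraj.costForm_add_right hg ht hY₁ hY₂ hX]
  have s1 := hsplit _ _ hY₁
  have s2 := hsplit _ _ hY₂
  rw [hY₁0, zero_dotProduct] at s1
  rw [hY₂0, zero_dotProduct, IsTraj.costForm_comm hg] at s2
  have n1 := (costForm_nonneg_of_lowerValue hg ht (hfin t ht 0).1.1 hY₁ hY₁0).1
  have n2 := (costForm_nonpos_of_upperValue hg ht (hfin t ht 0).2.2 hY₂ hY₂0).1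
  have q1 : g.costForm t (fun s => Sum.elim (v₁ s) 0) Y₁ (fun s => Sum.elim (v₁ s) 0) Y₁ = 0 := by
    linarith
  have q2 : g.costForm t (fun s => Sum.elim 0 (v₂ s)) Y₂ (fun s => Sum.elim 0 (v₂ s)) Y₂ = 0 := by
    linarith
  -- Cauchy–Schwarz for the two semidefinite diagonal blocks
  have k1 : ∀ (u : ℝ → Fin m₁ → ℝ) X, g.IsTraj t (fun s => Sum.elim (u s) 0) X → X t = 0 →
      g.costForm t (fun s => Sum.elim (u s) 0) X (fun s => Sum.elim 0 (v₂ s)) Y₂ = 0 := by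
    intro u X hX hX0
    have hs := hsplit _ _ hX
    rw [hX0, zero_dotProduct] at hs
    have hq := nonneg_of_forall_le_quadratic (c := 0)
      (a := g.costForm t (fun s => Sum.elim (u s) 0) X (fun s => Sum.elim (u s) 0) X)
      (b := g.costForm t (fun s => Sum.elim (u s) 0) X (fun s => Sum.elim (v₁ s) 0) Y₁)
      (q := g.costForm t (fun s => Sum.elim (v₁ s) 0) Y₁ (fun s => Sum.elim (v₁ s) 0) Y₁)
      fun l => by
        rw [← IsTraj.costForm_line hg ht hX hY₁ l]
        have e : (fun s => Sum.elim (u s) (0 : Fin m₂ → ℝ) + l • Sum.elim (v₁ s) (0 : Fin m₂ → ℝ)) =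
            fun s => Sum.elim (u s + l • v₁ s) (0 : Fin m₂ → ℝ) := by
          funext s
          ext (i | i) <;> simp
        have hl := hX.add (hY₁.const_smul l)
        rw [e] at hl ⊢
        exact (costForm_nonneg_of_lowerValue hg ht (hfin t ht 0).1.1 hl
          (by simp [hX0, hY₁0])).1
    linarith [hq.2 q1]
  have k2 : ∀ (u : ℝ → Fin m₂ → ℝ) X, g.IsTraj t (fun s => Sum.elim 0 (u s)) X → X t = 0 →
      g.costForm t (fun s => Sum.elim 0 (u s)) X (fun s => Sum.elim (v₁ s) 0) Y₁ = 0 := by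
    intro u X hX hX0
    have hs := hsplit _ _ hX
    rw [hX0, zero_dotProduct] at hs
    have hq := nonneg_of_forall_le_quadratic (c := 0)
      (a := -g.costForm t (fun s => Sum.elim 0 (u s)) X (fun s => Sum.elim 0 (u s)) X)
      (b := -g.costForm t (fun s => Sum.elim 0 (u s)) X (fun s => Sum.elim 0 (v₂ s)) Y₂)
      (q := -g.costForm t (fun s => Sum.elim 0 (v₂ s)) Y₂ (fun s => Sum.elim 0 (v₂ s)) Y₂)
      fun l => by
        have hline := IsTraj.costForm_line hg ht hX hY₂ l
        have e : (fun s => Sum.elim (0 : Fin m₁ → ℝ) (u s) + l • Sum.elim (0 : Fin m₁ → ℝ) (v₂ s)) =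
            fun s => Sum.elim (0 : Fin m₁ → ℝ) (u s + l • v₂ s) := by
          funext s
          ext (i | i) <;> simp
        have hl := hX.add (hY₂.const_smul l)
        rw [e] at hl hline
        have := (costForm_nonpos_of_upperValue hg ht (hfin t ht 0).2.2 hl
          (by simp [hX0, hY₂0])).1
        linarith
    linarith [hq.2 (by rw [q2, neg_zero])]
  -- the uncontrolled trajectory from `x`
  refine dotProduct_eq_zero _ fun x => ?_
  rw [dotProduct_comm]
  obtain ⟨X, hX, hX0⟩ := IsTraj.exists_traj (U := fun _ => 0) hg ht (fun _ => MemLp.zero) x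
  have hs := hsplit _ _ hX
  rw [hX0] at hs
  rw [← hs]
  obtain ⟨u₂, Z₂, hZ₂, hi₂⟩ :=
    (costForm_nonneg_of_lowerValue hg ht (hfin t ht x).1.1 hY₁ hY₁0).2 q1
  obtain ⟨u₁, Z₁, hZ₁, hi₁⟩ :=
    (costForm_nonpos_of_upperValue hg ht (hfin t ht x).2.2 hY₂ hY₂0).2 q2
  have c1 : g.costForm t (fun _ => 0) X (fun s => Sum.elim (v₁ s) 0) Y₁ = 0 := by
    rw [← hi₂, integral_congr_ae (g := fun _ => g.costForm t (fun _ => 0) X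
      (fun s => Sum.elim (v₁ s) 0) Y₁)]
    · simp
    filter_upwards [hZ₂.traj, hZ₂.init] with ω t1 t2
    have td := t1.add (hX.const_smul (-1))
    have e : (fun s => Sum.elim (0 : Fin m₁ → ℝ) (u₂ s ω) +
        (-1 : ℝ) • (0 : Fin m₁ ⊕ Fin m₂ → ℝ)) =
          fun s => Sum.elim (0 : Fin m₁ → ℝ) (u₂ s ω) := by
      funext s; simp
    have ha := IsTraj.costForm_add_left hg ht t1 (hX.const_smul (-1)) hY₁
    rw [e] at td ha
    rw [k2 _ _ td (by simp [t2, hX0]), IsTraj.costForm_smul_left] at ha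
    linarith
  have c2 : g.costForm t (fun _ => 0) X (fun s => Sum.elim 0 (v₂ s)) Y₂ = 0 := by
    rw [← hi₁, integral_congr_ae (g := fun _ => g.costForm t (fun _ => 0) X
      (fun s => Sum.elim 0 (v₂ s)) Y₂)]
    · simp
    filter_upwards [hZ₁.traj, hZ₁.init] with ω t1 t2
    have td := t1.add (hX.const_smul (-1))
    have e : (fun s => Sum.elim (u₁ s ω) (0 : Fin m₂ → ℝ) +
        (-1 : ℝ) • (0 : Fin m₁ ⊕ Fin m₂ → ℝ)) =
          fun s => Sum.elim (u₁ s ω) (0 : Fin m₂ → ℝ) := by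
      funext s; simp
    have ha := IsTraj.costForm_add_left hg ht t1 (hX.const_smul (-1)) hY₂
    rw [e] at td ha
    rw [k1 _ _ td (by simp [t2, hX0]), IsTraj.costForm_smul_left] at ha
    linarith
  rw [c1, c2, add_zero]

end Game

end LQGame

/-! ### The saddle point -/

namespace LQGame

variable {n m₁ m₂ : ℕ} {g : LQGame n m₁ m₂} {α t : ℝ}

section Game

variable {Ω : Type*} {mΩ : MeasurableSpace Ω} {μ : Measure Ω} {𝓕 : Filtration ℝ≥0 mΩ}

/-- `V⁻ ≥ inf J(·, u₂) ≥ J(u₁, u₂) ≥ sup J(u₁, ·) ≥ V⁺` at a saddle point `(u₁, u₂)`, so neither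
value can be infinite. -/
theorem IsSaddlePoint.values_finite {x : Fin n → ℝ} {u₁ : ℝ → Ω → Fin m₁ → ℝ}
    {u₂ : ℝ → Ω → Fin m₂ → ℝ} (h : g.IsSaddlePoint μ 𝓕 t x u₁ u₂) :
    (g.lowerValue μ 𝓕 t x ≠ ⊥ ∧ g.lowerValue μ 𝓕 t x ≠ ⊤) ∧
      (g.upperValue μ 𝓕 t x ≠ ⊥ ∧ g.upperValue μ 𝓕 t x ≠ ⊤) := by
  obtain ⟨h₁, h₂, hs⟩ := h
  have l1 : (g.J μ t x u₁ u₂ : EReal) ≤ g.lowerValue μ 𝓕 t x :=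
    (le_iInf₂ fun v₁ hv₁ => EReal.coe_le_coe_iff.2 (hs v₁ hv₁ u₂ h₂).2).trans
      (le_iSup₂ (f := fun u₂ _ => ⨅ u₁ ∈ controls μ 𝓕 m₁ t g.T, (g.J μ t x u₁ u₂ : EReal)) u₂ h₂)
  have l2 : g.upperValue μ 𝓕 t x ≤ g.J μ t x u₁ u₂ :=
    (iInf₂_le (f := fun u₁ _ => ⨆ u₂ ∈ controls μ 𝓕 m₂ t g.T, (g.J μ t x u₁ u₂ : EReal))
      u₁ h₁).trans
      (iSup₂_le fun v₂ hv₂ => EReal.coe_le_coe_iff.2 (hs u₁ h₁ v₂ hv₂).1)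
  have l3 : g.lowerValue μ 𝓕 t x ≤ g.upperValue μ 𝓕 t x :=
    iSup₂_le fun v₂ hv₂ => le_iInf₂ fun v₁ hv₁ => (iInf₂_le v₁ hv₁).trans
      (le_iSup₂ (f := fun v₂ _ => (g.J μ t x v₁ v₂ : EReal)) v₂ hv₂)
  exact ⟨⟨((EReal.bot_lt_coe _).trans_le l1).ne', ((l3.trans l2).trans_lt (EReal.coe_lt_top _)).ne⟩,
    ((EReal.bot_lt_coe _).trans_le (l1.trans l3)).ne', (l2.trans_lt (EReal.coe_lt_top _)).ne⟩

/-- The first-order condition at a saddle point. -/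
theorem IsSaddlePoint.expForm_eq_zero [IsProbabilityMeasure μ] (hg : g.IsNormalized α)
    (ht : t ∈ Icc 0 g.T) {x : Fin n → ℝ} {u₁ : ℝ → Ω → Fin m₁ → ℝ} {u₂ : ℝ → Ω → Fin m₂ → ℝ}
    (h : g.IsSaddlePoint μ 𝓕 t x u₁ u₂) {X Z : ℝ → Ω → Fin n → ℝ}
    {H : ℝ → Ω → Fin m₁ ⊕ Fin m₂ → ℝ}
    (hX : g.IsStochTraj μ 𝓕 t x (fun s ω => Sum.elim (u₁ s ω) (u₂ s ω)) X)
    (hZ : g.IsStochTraj μ 𝓕 t 0 H Z) :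
    g.expForm μ t (fun s ω => Sum.elim (u₁ s ω) (u₂ s ω)) X H Z = 0 := by
  obtain ⟨h₁, h₂, hs⟩ := h
  have p₁ := (mem_controls_iff ht.2).1 h₁
  have p₂ := (mem_controls_iff ht.2).1 h₂
  -- split the direction into the parts of the two players
  set H₁ : ℝ → Ω → Fin m₁ → ℝ := fun s ω i => H s ω (.inl i) with hH₁
  set H₂ : ℝ → Ω → Fin m₂ → ℝ := fun s ω i => H s ω (.inr i) with hH₂
  have q₁ : IsL2ProgVec μ 𝓕 t g.T H₁ := fun i => hZ.control (.inl i)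
  have q₂ : IsL2ProgVec μ 𝓕 t g.T H₂ := fun i => hZ.control (.inr i)
  obtain ⟨Z₁, hZ₁⟩ := exists_isStochTraj hg ht (q₁.sumElim (.const (0 : Fin m₂ → ℝ))) 0
  have hZ₂ := hZ.add (hZ₁.const_smul (-1))
  have e₂ : (fun s ω => H s ω + (-1 : ℝ) • Sum.elim (H₁ s ω) (0 : Fin m₂ → ℝ)) =
      fun s ω => Sum.elim (0 : Fin m₁ → ℝ) (H₂ s ω) := by
    funext s ω
    ext (i | i) <;> simp [hH₁, hH₂]
  rw [e₂, smul_zero, add_zero] at hZ₂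
  have eH : H = fun s ω => Sum.elim (H₁ s ω) (0 : Fin m₂ → ℝ) +
      Sum.elim (0 : Fin m₁ → ℝ) (H₂ s ω) := by
    funext s ω
    ext (i | i) <;> simp [hH₁, hH₂]
  have eZ : Z = fun s ω => Z₁ s ω + (Z s ω + (-1 : ℝ) • Z₁ s ω) := by
    funext s ω
    simp
  rw [eH, eZ, IsStochTraj.expForm_add_right hg ht hX hZ₁ hZ₂]
  have k₁ : g.expForm μ t (fun s ω => Sum.elim (u₁ s ω) (u₂ s ω)) X
      (fun s ω => Sum.elim (H₁ s ω) (0 : Fin m₂ → ℝ)) Z₁ = 0 := by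
    refine eq_zero_of_forall_nonneg_quadratic
      (q := g.expForm μ t (fun s ω => Sum.elim (H₁ s ω) 0) Z₁
        (fun s ω => Sum.elim (H₁ s ω) 0) Z₁) fun l => ?_
    have hJ := J_line hg ht hX hZ₁ l
    have := (hs _ ((mem_controls_iff ht.2).2 (p₁.add (q₁.const_smul l))) u₂ h₂).2
    have e : (fun s ω => u₂ s ω + l • (0 : Fin m₂ → ℝ)) = u₂ := by funext s ω; simp
    rw [e] at hJ
    linarith
  have k₂ := eq_zero_of_forall_nonneg_quadratic
      (b := -g.expForm μ t (fun s ω => Sum.elim (u₁ s ω) (u₂ s ω)) X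
        (fun s ω => Sum.elim (0 : Fin m₁ → ℝ) (H₂ s ω)) fun s ω => Z s ω + (-1 : ℝ) • Z₁ s ω)
      (q := -g.expForm μ t (fun s ω => Sum.elim 0 (H₂ s ω)) (fun s ω => Z s ω + (-1 : ℝ) • Z₁ s ω)
        (fun s ω => Sum.elim 0 (H₂ s ω)) fun s ω => Z s ω + (-1 : ℝ) • Z₁ s ω) fun l => by
    have hJ := J_line hg ht hX hZ₂ l
    have := (hs u₁ h₁ _ ((mem_controls_iff ht.2).2 (p₂.add (q₂.const_smul l)))).1
    have e : (fun s ω => u₁ s ω + l • (0 : Fin m₁ → ℝ)) = u₁ := by funext s ω; simp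
    rw [e] at hJ
    linarith
  rw [k₁, neg_eq_zero.1 k₂, add_zero]

namespace IsRiccati

variable {P : ℝ → Matrix (Fin n) (Fin n) ℝ} {x : Fin n → ℝ} {X : ℝ → Fin n → ℝ}

theorem isStochTraj_closedLoop [IsProbabilityMeasure μ] (hP : g.IsRiccati P)
    (hg : g.IsNormalized α) (ht : t ∈ Icc 0 g.T) (hc : ∀ i, Continuous fun s => X s i)
    (hX : g.IsTraj t (fun s => g.feedback P s *ᵥ X s) X) :
    g.IsStochTraj μ 𝓕 t (X t) (fun s _ => g.feedback P s *ᵥ X s) (fun s _ => X s) := by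
  have h : IsL2ProgVec μ 𝓕 t g.T (fun s _ => X s) :=
    .deterministic (fun i => (hc i).measurable) (hX.state_memLp ht.2)
  exact ⟨h.mulVec ht.1 (feedback_bdd hg hP.continuous), h, .of_forall fun _ => hX,
    .of_forall fun _ => rfl⟩

/-- The closed-loop control is stationary for the criterion. -/
theorem expForm_closedLoop_eq_zero (hP : g.IsRiccati P) (hg : g.IsNormalized α)
    (ht : t ∈ Icc 0 g.T) (hX : g.IsTraj t (fun s => g.feedback P s *ᵥ X s) X)
    {H : ℝ → Ω → Fin m₁ ⊕ Fin m₂ → ℝ} {Z : ℝ → Ω → Fin n → ℝ}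
    (hZ : g.IsStochTraj μ 𝓕 t 0 H Z) :
    g.expForm μ t (fun s _ => g.feedback P s *ᵥ X s) (fun s _ => X s) H Z = 0 := by
  refine integral_eq_zero_of_ae ?_
  filter_upwards [hZ.traj, hZ.init] with ω h1 h2
  rw [hP.costForm_eq hg ht hX h1, h2]
  simp

theorem isSaddlePoint [IsProbabilityMeasure μ] (hP : g.IsRiccati P) (hg : g.IsNormalized α)
    (hfin : g.FiniteValues μ 𝓕) (ht : t ∈ Icc 0 g.T) (hc : ∀ i, Continuous fun s => X s i)
    (hX : g.IsTraj t (fun s => g.feedback P s *ᵥ X s) X) :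
    g.IsSaddlePoint μ 𝓕 t (X t) (fun s _ i => (g.feedback P s *ᵥ X s) (.inl i))
      (fun s _ i => (g.feedback P s *ᵥ X s) (.inr i)) := by
  have hXp := hP.isStochTraj_closedLoop (μ := μ) (𝓕 := 𝓕) hg ht hc hX
  set u₁ : ℝ → Ω → Fin m₁ → ℝ := fun s _ i => (g.feedback P s *ᵥ X s) (.inl i) with hu₁
  set u₂ : ℝ → Ω → Fin m₂ → ℝ := fun s _ i => (g.feedback P s *ᵥ X s) (.inr i) with hu₂
  have p₁ : IsL2ProgVec μ 𝓕 t g.T u₁ := fun i => hXp.control (.inl i)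
  have p₂ : IsL2ProgVec μ 𝓕 t g.T u₂ := fun i => hXp.control (.inr i)
  have e : (fun s ω => Sum.elim (u₁ s ω) (u₂ s ω)) = fun s _ => g.feedback P s *ᵥ X s := by
    funext s ω
    ext (i | i) <;> rfl
  rw [← e] at hXp
  refine ⟨(mem_controls_iff ht.2).2 p₁, (mem_controls_iff ht.2).2 p₂, fun v₁ hv₁ v₂ hv₂ => ⟨?_, ?_⟩⟩
  · have q := ((mem_controls_iff ht.2).1 hv₂).sub p₂
    obtain ⟨Z, hZ⟩ := exists_isStochTraj hg ht
      ((IsL2ProgVec.const (0 : Fin m₁ → ℝ)).sumElim q) 0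
    have hJ := J_line hg ht hXp hZ 1
    rw [e, hP.expForm_closedLoop_eq_zero hg ht hX hZ] at hJ
    have e1 : (fun s ω => u₁ s ω + (1 : ℝ) • (0 : Fin m₁ → ℝ)) = u₁ := by funext s ω; simp
    have e2 : (fun s ω => u₂ s ω + (1 : ℝ) • (v₂ s ω - u₂ s ω)) = v₂ := by funext s ω; simp
    rw [e1, e2] at hJ
    have hq : g.expForm μ t (fun s ω => Sum.elim (0 : Fin m₁ → ℝ) (v₂ s ω - u₂ s ω)) Z
        (fun s ω => Sum.elim (0 : Fin m₁ → ℝ) (v₂ s ω - u₂ s ω)) Z ≤ 0 := by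
      refine integral_nonpos_of_ae ?_
      filter_upwards [hZ.traj, hZ.init] with ω h1 h2
      exact (costForm_nonpos_of_upperValue hg ht (hfin t ht 0).2.2 h1 h2).1
    linarith
  · have q := ((mem_controls_iff ht.2).1 hv₁).sub p₁
    obtain ⟨Z, hZ⟩ := exists_isStochTraj hg ht
      (q.sumElim (IsL2ProgVec.const (0 : Fin m₂ → ℝ))) 0
    have hJ := J_line hg ht hXp hZ 1
    rw [e, hP.expForm_closedLoop_eq_zero hg ht hX hZ] at hJ
    have e1 : (fun s ω => u₂ s ω + (1 : ℝ) • (0 : Fin m₂ → ℝ)) = u₂ := by funext s ω; simp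
    have e2 : (fun s ω => u₁ s ω + (1 : ℝ) • (v₁ s ω - u₁ s ω)) = v₁ := by funext s ω; simp
    rw [e1, e2] at hJ
    have hq : 0 ≤ g.expForm μ t (fun s ω => Sum.elim (v₁ s ω - u₁ s ω) (0 : Fin m₂ → ℝ)) Z
        (fun s ω => Sum.elim (v₁ s ω - u₁ s ω) (0 : Fin m₂ → ℝ)) Z := by
      refine integral_nonneg_of_ae ?_
      filter_upwards [hZ.traj, hZ.init] with ω h1 h2
      exact (costForm_nonneg_of_lowerValue hg ht (hfin t ht 0).1.1 h1 h2).1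
    linarith

/-- If the cost form vanishes between a control process and all directions, the process is in
feedback form. Test with the direction whose deviation from the feedback is
`(z₁, -z₂)`, where `z = (z₁, z₂)` is the deviation of the process, and use coercivity. -/
theorem eq_feedback_of_expForm_eq_zero [IsProbabilityMeasure μ] (hP : g.IsRiccati P)
    (hg : g.IsNormalized α) (ht : t ∈ Icc 0 g.T) {U : ℝ → Ω → Fin m₁ ⊕ Fin m₂ → ℝ}
    {Y : ℝ → Ω → Fin n → ℝ} (hY : g.IsStochTraj μ 𝓕 t x U Y)
    (h0 : ∀ H Z, g.IsStochTraj μ 𝓕 t 0 H Z → g.expForm μ t U Y H Z = 0) :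
    ∀ᵐ p ∂((volume.restrict (Icc t g.T)).prod μ),
      U p.1 p.2 = g.feedback P p.1 *ᵥ Y p.1 p.2 := by
  have hΘ := feedback_bdd hg hP.continuous
  set z : ℝ → Ω → Fin m₁ ⊕ Fin m₂ → ℝ := fun s ω => U s ω - g.feedback P s *ᵥ Y s ω with hz
  have hz2 : IsL2ProgVec μ 𝓕 t g.T z := hY.control.sub (hY.state.mulVec ht.1 hΘ)
  have hf2 : IsL2ProgVec μ 𝓕 t g.T (fun s ω => flip (z s ω)) := by
    rintro (i | i)
    exacts [hz2 (.inl i), (hz2 (.inr i)).neg]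
  obtain ⟨Φ, Ψ, h⟩ := exists_fundamentalPair hg.T_pos.le (closedLoop_bdd hg hP.continuous)
  have hBf := hf2.mulVec ht.1 hg.B_bdd
  have hZ2 := IsL2ProgVec.linearODE h ht 0 hBf
  set Z : ℝ → Ω → Fin n → ℝ :=
    fun s ω => Φ s *ᵥ (0 + fun i => ∫ r in t..s, (Ψ r *ᵥ (g.B r *ᵥ flip (z r ω))) i) with hZ
  have hZp : g.IsStochTraj μ 𝓕 t 0 (fun s ω => g.feedback P s *ᵥ Z s ω + flip (z s ω)) Z := by
    refine ⟨(hZ2.mulVec ht.1 hΘ).add hf2, hZ2, ?_, .of_forall fun ω => ?_⟩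
    · filter_upwards [hf2.ae_isL2Path ht.2] with ω hω
      exact hP.isTraj_closedLoop hg ht hω
        (h.isPrimitiveOn_formula ht 0 ((hω.mulVec ht.1 hg.B_bdd).intervalIntegrable ht.2))
    · have : (0 + fun i => ∫ r in t..t, (Ψ r *ᵥ (g.B r *ᵥ flip (z r ω))) i) = (0 : Fin n → ℝ) := by
        ext i; simp
      rw [hZ]
      beta_reduce
      rw [this, Matrix.mulVec_zero]
  have hi := hf2.integrable_dotProduct (hz2.mulVec ht.1 hg.R_bdd)
  have key : ∫ p : ℝ × Ω, flip (z p.1 p.2) ⬝ᵥ (g.R p.1 *ᵥ z p.1 p.2)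
      ∂((volume.restrict (Icc t g.T)).prod μ) = 0 := by
    rw [integral_prod_symm _ hi, ← h0 _ _ hZp]
    refine integral_congr_ae ?_
    filter_upwards [hY.traj, hZp.traj, hZp.init] with ω h1 h2 h3
    rw [hP.costForm_eq hg ht h1 h2, h3, Matrix.mulVec_zero, dotProduct_zero, zero_add,
      intervalIntegral.integral_of_le ht.2, ← integral_Icc_eq_integral_Ioc]
    refine integral_congr_ae (.of_forall fun s => ?_)
    beta_reduce
    rw [add_sub_cancel_left, dotProduct_comm, mulVec_dotProduct_eq, hg.R_symm]
  have hnn : ∀ p : ℝ × Ω, 0 ≤ z p.1 p.2 ⬝ᵥ z p.1 p.2 := fun p =>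
    Finset.sum_nonneg fun i _ => mul_self_nonneg _
  have hae := (integral_eq_zero_iff_of_nonneg
    (fun p => (mul_nonneg hg.α_pos.le (hnn p)).trans (hg.R_coercive p.1 _)) hi).1 key
  filter_upwards [hae] with p hp
  have h1 := hg.R_coercive p.1 (z p.1 p.2)
  have h2 : z p.1 p.2 ⬝ᵥ z p.1 p.2 = 0 := by
    refine le_antisymm ?_ (hnn p)
    have : flip (z p.1 p.2) ⬝ᵥ (g.R p.1 *ᵥ z p.1 p.2) = 0 := hp
    rw [this] at h1
    exact nonpos_of_mul_nonpos_right h1 hg.α_pos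
  exact sub_eq_zero.1 (dotProduct_self_eq_zero.1 h2)

theorem eq_closedLoop_of_isSaddlePoint [IsProbabilityMeasure μ] (hP : g.IsRiccati P)
    (hg : g.IsNormalized α) (ht : t ∈ Icc 0 g.T)
    (hX : g.IsTraj t (fun s => g.feedback P s *ᵥ X s) X)
    {v₁ : ℝ → Ω → Fin m₁ → ℝ} {v₂ : ℝ → Ω → Fin m₂ → ℝ}
    (h : g.IsSaddlePoint μ 𝓕 t (X t) v₁ v₂) :
    ∀ᵐ p ∂((volume.restrict (Icc t g.T)).prod μ),
      Sum.elim (v₁ p.1 p.2) (v₂ p.1 p.2) = g.feedback P p.1 *ᵥ X p.1 := by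
  obtain ⟨Y, hY⟩ := exists_isStochTraj hg ht (sumElim_mem ht.2 h.1 h.2.1) (X t)
  have h1 := hP.eq_feedback_of_expForm_eq_zero hg ht hY fun H Z hZ =>
    h.expForm_eq_zero hg ht hY hZ
  have h2 := Measure.ae_ae_of_ae_prod
    (Measure.measurePreserving_swap.quasiMeasurePreserving.ae h1)
  have h3 : ∀ᵐ ω ∂μ, EqOn (fun s => Y s ω) X (Icc t g.T) := by
    filter_upwards [h2, hY.traj, hY.init] with ω k1 k2 k3
    exact hP.closedLoop_unique hg ht (k2.congr_control ht.2 k1) hX k3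
  filter_upwards [h1, Measure.quasiMeasurePreserving_snd.ae h3, ae_mem_Icc_prod μ t g.T]
    with p k1 k2 k3
  rw [k1, ← k2 k3]

end IsRiccati

theorem exists_isRiccati [IsProbabilityMeasure μ] (hg : g.IsNormalized α)
    (hfin : g.FiniteValues μ 𝓕) : ∃ P, g.IsRiccati P := by
  obtain ⟨M, N, h⟩ := exists_isHamiltonianFlow hg
  exact h.exists_isRiccati hg fun t ht V Y η hη h0 => hη.costate_eq_zero hg hfin ht h0

theorem exists_solution_of_isNormalized [IsProbabilityMeasure μ] (hg : g.IsNormalized α)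
    (hfin : g.FiniteValues μ 𝓕) :
    ∃ P : ℝ → Matrix (Fin n) (Fin n) ℝ, g.IsRiccatiSolution P ∧
      (∀ P', g.IsRiccatiSolution P' → EqOn P' P (Icc 0 g.T)) ∧
      ∀ t ∈ Icc 0 g.T, ∀ x : Fin n → ℝ,
        ∃ X : ℝ → Fin n → ℝ, g.IsClosedLoopPath P t x X ∧
          (∀ X', g.IsClosedLoopPath P t x X' → EqOn X' X (Icc t g.T)) ∧
          ∃ u₁ u₂, g.IsUniqueSaddlePoint μ 𝓕 t x u₁ u₂ ∧
            ∀ᵐ p ∂((volume.restrict (Icc t g.T)).prod μ),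
              Sum.elim (u₁ p.1 p.2) (u₂ p.1 p.2) = g.feedback P p.1 *ᵥ X p.1 := by
  obtain ⟨P, hP⟩ := exists_isRiccati hg hfin
  refine ⟨P, hP.isRiccatiSolution, fun P' hP' => ?_, fun t ht x => ?_⟩
  · obtain ⟨P'', h1, h2⟩ := exists_isRiccati_eqOn hg hP'
    exact h2.symm.trans (hP.unique h1 hg)
  · obtain ⟨X, hc, rfl, hX⟩ := hP.exists_closedLoop hg ht x
    refine ⟨X, (isClosedLoopPath_iff_isTraj hg hP ht).2 ⟨hX, rfl⟩, fun X' hX' => ?_, _, _,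
      ⟨hP.isSaddlePoint hg hfin ht hc hX, fun v₁ v₂ hv => ?_⟩, .of_forall fun p => ?_⟩
    · obtain ⟨h1, h2⟩ := (isClosedLoopPath_iff_isTraj hg hP ht).1 hX'
      exact hP.closedLoop_unique hg ht h1 hX h2
    · filter_upwards [hP.eq_closedLoop_of_isSaddlePoint hg ht hX hv] with p hp
      exact ⟨funext fun i => congrFun hp (.inl i), funext fun i => congrFun hp (.inr i)⟩
    · ext (i | i) <;> rfl

end Game

end LQGame

/-! ### Reduction to Borel coefficients -/

theorem exists_measurableSet_of_ae {X : Type*} [MeasurableSpace X] {ν : Measure X} {p : X → Prop}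
    (h : ∀ᵐ s ∂ν, p s) : ∃ Z, MeasurableSet Z ∧ (∀ᵐ s ∂ν, s ∈ Z) ∧ ∀ s ∈ Z, p s := by
  obtain ⟨N, hN, hNm, hN0⟩ := exists_measurable_superset_of_null (ae_iff.1 h)
  refine ⟨Nᶜ, hNm.compl, compl_mem_ae_iff.2 hN0, fun s hs => ?_⟩
  by_contra hp
  exact hs (hN hp)

/-- An essentially bounded function is measurable and bounded on a conull measurable set. -/
theorem IsLInfty.exists_isBddMeasMat_piecewise {p q : ℕ} {T : ℝ}
    {M : ℝ → Matrix (Fin p) (Fin q) ℝ} (hM : IsLInfty T M) :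
    ∃ W : Set ℝ, (∀ᵐ s ∂(volume.restrict (Icc 0 T)), s ∈ W) ∧
      ∀ (Z : Set ℝ) [DecidablePred (· ∈ Z)] (c : Matrix (Fin p) (Fin q) ℝ),
        MeasurableSet Z → Z ⊆ W → IsBddMeasMat T (Z.piecewise M fun _ => c) := by
  have h1 : ∀ i j, ∀ᵐ s ∂(volume.restrict (Icc 0 T)),
      M s i j = (hM i j).1.mk _ s ∧
        |M s i j| ≤ (eLpNorm (fun s => M s i j) ⊤ (volume.restrict (Icc 0 T))).toReal := by
    intro i j
    filter_upwards [(hM i j).1.ae_eq_mk, enorm_ae_le_eLpNormEssSup (fun s => M s i j) _]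
      with s k1 k2
    refine ⟨k1, ?_⟩
    rw [← eLpNorm_exponent_top] at k2
    simpa using ENNReal.toReal_mono (hM i j).2.ne k2
  refine ⟨_, ae_all_iff.2 fun i => ae_all_iff.2 (h1 i), fun Z _ c hZ hZW i j => ⟨?_, ?_⟩⟩
  · have : (fun s => Z.piecewise M (fun _ => c) s i j) =
        Z.piecewise ((hM i j).1.mk _) fun _ => c i j := by
      funext s
      by_cases hs : s ∈ Z
      · simp only [piecewise_eq_of_mem _ _ _ hs]
        exact (hZW hs i j).1
      · simp only [piecewise_eq_of_notMem _ _ _ hs]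
    rw [this]
    exact (hM i j).1.stronglyMeasurable_mk.measurable.piecewise hZ measurable_const
  · refine ⟨max (eLpNorm (fun s => M s i j) ⊤ (volume.restrict (Icc 0 T))).toReal |c i j|,
      fun s _ => ?_⟩
    by_cases hs : s ∈ Z
    · simp only [piecewise_eq_of_mem _ _ _ hs]
      exact (hZW hs i j).2.trans (le_max_left _ _)
    · simp only [piecewise_eq_of_notMem _ _ _ hs]
      exact le_max_right _ _

namespace LQGame

variable {n m₁ m₂ : ℕ} {g : LQGame n m₁ m₂} {α t : ℝ} {Z : Set ℝ}

open Classical in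
/-- The game whose coefficients are those of `g` on the set `Z`, and constant outside `Z` with
`R₁₁ = α I`, `R₂₂ = -α I`, all others zero. -/
def modify (g : LQGame n m₁ m₂) (Z : Set ℝ) (α : ℝ) : LQGame n m₁ m₂ where
  T := g.T
  A := Z.piecewise g.A fun _ => 0
  B₁ := Z.piecewise g.B₁ fun _ => 0
  B₂ := Z.piecewise g.B₂ fun _ => 0
  G := g.G
  Q := Z.piecewise g.Q fun _ => 0
  S₁ := Z.piecewise g.S₁ fun _ => 0
  S₂ := Z.piecewise g.S₂ fun _ => 0
  R₁₁ := Z.piecewise g.R₁₁ fun _ => α • 1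
  R₁₂ := Z.piecewise g.R₁₂ fun _ => 0
  R₂₁ := Z.piecewise g.R₂₁ fun _ => 0
  R₂₂ := Z.piecewise g.R₂₂ fun _ => -(α • 1)

theorem posSemidef_sub_smul_of_le {p : ℕ} {M : Matrix (Fin p) (Fin p) ℝ} {a b : ℝ} (hab : b ≤ a)
    (h : (M - a • (1 : Matrix (Fin p) (Fin p) ℝ)).PosSemidef) :
    (M - b • (1 : Matrix (Fin p) (Fin p) ℝ)).PosSemidef := by
  have := h.add ((Matrix.PosSemidef.one (n := Fin p) (R := ℝ)).smul (sub_nonneg.2 hab))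
  convert this using 1
  rw [sub_smul]
  abel

theorem IsRegular.exists_isNormalized (hg : g.IsRegular) (h₁ : IsUniformlyPos g.T g.R₁₁)
    (h₂ : IsUniformlyNeg g.T g.R₂₂) :
    ∃ Z α, (∀ᵐ s ∂(volume.restrict (Icc 0 g.T)), s ∈ Z) ∧ (g.modify Z α).IsNormalized α := by
  classical
  obtain ⟨α₁, hα₁, p₁⟩ := h₁
  obtain ⟨α₂, hα₂, p₂⟩ := h₂
  obtain ⟨WA, aA, bA⟩ := hg.A_mem.exists_isBddMeasMat_piecewise
  obtain ⟨WB₁, aB₁, bB₁⟩ := hg.B₁_mem.exists_isBddMeasMat_piecewise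
  obtain ⟨WB₂, aB₂, bB₂⟩ := hg.B₂_mem.exists_isBddMeasMat_piecewise
  obtain ⟨WQ, aQ, bQ⟩ := hg.Q_mem.exists_isBddMeasMat_piecewise
  obtain ⟨WS₁, aS₁, bS₁⟩ := hg.S₁_mem.exists_isBddMeasMat_piecewise
  obtain ⟨WS₂, aS₂, bS₂⟩ := hg.S₂_mem.exists_isBddMeasMat_piecewise
  obtain ⟨W₁₁, a₁₁, b₁₁⟩ := hg.R₁₁_mem.exists_isBddMeasMat_piecewise
  obtain ⟨W₁₂, a₁₂, b₁₂⟩ := hg.R₁₂_mem.exists_isBddMeasMat_piecewise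
  obtain ⟨W₂₁, a₂₁, b₂₁⟩ := hg.R₂₁_mem.exists_isBddMeasMat_piecewise
  obtain ⟨W₂₂, a₂₂, b₂₂⟩ := hg.R₂₂_mem.exists_isBddMeasMat_piecewise
  obtain ⟨Z, hZm, hZ, hp⟩ := exists_measurableSet_of_ae
    (aA.and <| aB₁.and <| aB₂.and <| aQ.and <| aS₁.and <| aS₂.and <| a₁₁.and <| a₁₂.and <|
      a₂₁.and <| a₂₂.and <| p₁.and <| p₂.and <| hg.Q_symm.and <| hg.R₁₁_symm.and <|
      hg.R₁₂_transpose.and hg.R₂₂_symm)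
  choose cA cB₁ cB₂ cQ cS₁ cS₂ c₁₁ c₁₂ c₂₁ c₂₂ q₁ q₂ sQ s₁₁ s₁₂ s₂₂ using hp
  have h0 : ∀ p : ℕ, (0 : Matrix (Fin p) (Fin p) ℝ).PosSemidef := fun p => .zero
  refine ⟨Z, min α₁ α₂, hZ, hg.T_pos, ?_, ?_, ?_, hg.G_symm, ?_, fun s => ?_, ?_, ?_, ?_, ?_, ?_,
    ?_, fun s => ?_, fun s => ?_, fun s => ?_, lt_min hα₁ hα₂, fun s => ?_, fun s => ?_⟩
  · exact bA Z _ hZm cA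
  · exact bB₁ Z _ hZm cB₁
  · exact bB₂ Z _ hZm cB₂
  · exact bQ Z _ hZm cQ
  · by_cases hs : s ∈ Z
    · simpa [modify, hs] using (sQ s hs).eq
    · simp [modify, hs]
  · exact bS₁ Z _ hZm cS₁
  · exact bS₂ Z _ hZm cS₂
  · exact b₁₁ Z _ hZm c₁₁
  · exact b₁₂ Z _ hZm c₁₂
  · exact b₂₁ Z _ hZm c₂₁
  · exact b₂₂ Z _ hZm c₂₂
  · by_cases hs : s ∈ Z
    · simpa [modify, hs] using (s₁₁ s hs).eq
    · simp [modify, hs]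
  · by_cases hs : s ∈ Z
    · simpa [modify, hs] using s₁₂ s hs
    · simp [modify, hs]
  · by_cases hs : s ∈ Z
    · simpa [modify, hs] using (s₂₂ s hs).eq
    · simp [modify, hs]
  · by_cases hs : s ∈ Z
    · simpa only [modify, piecewise_eq_of_mem _ _ _ hs] using
        posSemidef_sub_smul_of_le (min_le_left _ _) (q₁ s hs)
    · simpa only [modify, piecewise_eq_of_notMem _ _ _ hs, sub_self] using h0 m₁
  · by_cases hs : s ∈ Z
    · simpa only [modify, piecewise_eq_of_mem _ _ _ hs] using
        posSemidef_sub_smul_of_le (min_le_right _ _) (q₂ s hs)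
    · simpa only [modify, piecewise_eq_of_notMem _ _ _ hs, neg_neg, sub_self] using h0 m₂

theorem integral_congr_of_ae_mem {E : Type*} [NormedAddCommGroup E] [NormedSpace ℝ E] {T : ℝ}
    (hZ : ∀ᵐ s ∂(volume.restrict (Icc 0 T)), s ∈ Z) {s : ℝ} (ht : t ∈ Icc 0 T) (hs : s ∈ Icc 0 T)
    {f f' : ℝ → E} (h : ∀ r ∈ Z, f r = f' r) : ∫ r in t..s, f r = ∫ r in t..s, f' r := by
  refine intervalIntegral.integral_congr_ae ?_
  filter_upwards [(ae_restrict_iff' measurableSet_Icc).1 hZ] with r hr hrs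
  exact h r (hr ⟨(le_min ht.1 hs.1).trans hrs.1.le, hrs.2.trans (max_le ht.2 hs.2)⟩)

theorem feedback_modify (P : ℝ → Matrix (Fin n) (Fin n) ℝ) {s : ℝ} (hs : s ∈ Z) :
    (g.modify Z α).feedback P s = g.feedback P s := by
  simp [feedback, R, B, S, modify, hs]

theorem isRiccatiSolution_modify
    (hZ : ∀ᵐ s ∂(volume.restrict (Icc 0 g.T)), s ∈ Z)
    (hg : 0 < g.T) {P : ℝ → Matrix (Fin n) (Fin n) ℝ} :
    (g.modify Z α).IsRiccatiSolution P ↔ g.IsRiccatiSolution P := by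
  have hT : g.T ∈ Icc 0 g.T := ⟨hg.le, le_rfl⟩
  refine and_congr Iff.rfl (and_congr Iff.rfl (forall₄_congr fun t ht i j => ?_))
  rw [integral_congr_of_ae_mem (f := fun s => g.riccatiRHS s (P s) i j)
    (f' := fun s => (g.modify Z α).riccatiRHS s (P s) i j) hZ ht hT]
  · rfl
  · intro r hr
    simp [riccatiRHS, R, B, S, modify, hr]

theorem isClosedLoopPath_modify
    (hZ : ∀ᵐ s ∂(volume.restrict (Icc 0 g.T)), s ∈ Z)
    (ht : t ∈ Icc 0 g.T) {P : ℝ → Matrix (Fin n) (Fin n) ℝ}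
    {x : Fin n → ℝ} {X : ℝ → Fin n → ℝ} :
    (g.modify Z α).IsClosedLoopPath P t x X ↔ g.IsClosedLoopPath P t x X := by
  refine and_congr Iff.rfl (forall₂_congr fun s hs => ?_)
  rw [integral_congr_of_ae_mem (f' := fun r => (g.A r + g.B r * g.feedback P r) *ᵥ X r) hZ ht
    ⟨ht.1.trans hs.1, hs.2⟩]
  intro r hr
  rw [feedback_modify P hr]
  simp [B, modify, hr]

theorem statePath_modify (hZ : ∀ᵐ s ∂(volume.restrict (Icc 0 g.T)), s ∈ Z)
    (ht : t ∈ Icc 0 g.T) : (g.modify Z α).statePath t = g.statePath t := by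
  have key : ∀ p q : (ℝ → Fin n → ℝ) → Prop, p = q →
      (open Classical in if h : ∃ X, p X then h.choose else 0) =
        (open Classical in if h : ∃ X, q X then h.choose else 0) := by
    rintro p _ rfl
    rfl
  funext x u₁ u₂
  refine key _ _ (funext fun X => propext ?_)
  refine and_congr Iff.rfl (forall₂_congr fun s hs => ?_)
  rw [integral_congr_of_ae_mem
    (f' := fun r => g.A r *ᵥ X r + g.B₁ r *ᵥ u₁ r + g.B₂ r *ᵥ u₂ r) hZ ht
    ⟨ht.1.trans hs.1, hs.2⟩]
  intro r hr
  simp [modify, hr]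

section Game

variable {Ω : Type*} {mΩ : MeasurableSpace Ω} {μ : Measure Ω} {𝓕 : Filtration ℝ≥0 mΩ}

theorem J_modify (hZ : ∀ᵐ s ∂(volume.restrict (Icc 0 g.T)), s ∈ Z)
    (ht : t ∈ Icc 0 g.T) : (g.modify Z α).J μ t = g.J μ t := by
  funext x u₁ u₂
  rw [J, J, statePath_modify hZ ht]
  congr 1
  funext ω
  rw [pathCost, pathCost]
  congr 1
  refine integral_congr_of_ae_mem hZ ht ⟨ht.1.trans ht.2, le_rfl⟩ fun r hr => ?_
  simp [runningCost, R, S, modify, hr]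

theorem finiteValues_modify (hZ : ∀ᵐ s ∂(volume.restrict (Icc 0 g.T)), s ∈ Z) :
    (g.modify Z α).FiniteValues μ 𝓕 ↔ g.FiniteValues μ 𝓕 := by
  refine forall₂_congr fun t ht => ?_
  have hJ : (g.modify Z α).J μ t = g.J μ t := J_modify hZ ht
  unfold lowerValue upperValue
  rw [hJ]
  rfl

theorem isUniqueSaddlePoint_modify
    (hZ : ∀ᵐ s ∂(volume.restrict (Icc 0 g.T)), s ∈ Z)
    (ht : t ∈ Icc 0 g.T) {x : Fin n → ℝ}
    {u₁ : ℝ → Ω → Fin m₁ → ℝ} {u₂ : ℝ → Ω → Fin m₂ → ℝ} :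
    (g.modify Z α).IsUniqueSaddlePoint μ 𝓕 t x u₁ u₂ ↔ g.IsUniqueSaddlePoint μ 𝓕 t x u₁ u₂ := by
  have hJ : (g.modify Z α).J μ t = g.J μ t := J_modify hZ ht
  unfold IsUniqueSaddlePoint IsSaddlePoint
  rw [hJ]
  rfl

end Game

end LQGame

end

theorem mainTheorem3 {n m₁ m₂ : ℕ} {Ω : Type*} {mΩ : MeasurableSpace Ω}
    (μ : Measure Ω) [IsProbabilityMeasure μ] (𝓕 : Filtration ℝ≥0 mΩ)
    (g : LQGame n m₁ m₂) (hg : g.IsRegular)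
    (hR₁₁ : IsUniformlyPos g.T g.R₁₁) (hR₂₂ : IsUniformlyNeg g.T g.R₂₂) :
    (g.FiniteValues μ 𝓕 ↔
      ∀ t ∈ Icc 0 g.T, ∀ x : Fin n → ℝ, ∃ u₁ u₂, g.IsUniqueSaddlePoint μ 𝓕 t x u₁ u₂) ∧
    (g.FiniteValues μ 𝓕 →
      ∃ P : ℝ → Matrix (Fin n) (Fin n) ℝ, g.IsRiccatiSolution P ∧
        (∀ P', g.IsRiccatiSolution P' → EqOn P' P (Icc 0 g.T)) ∧
        ∀ t ∈ Icc 0 g.T, ∀ x : Fin n → ℝ,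
          ∃ X : ℝ → Fin n → ℝ, g.IsClosedLoopPath P t x X ∧
            (∀ X', g.IsClosedLoopPath P t x X' → EqOn X' X (Icc t g.T)) ∧
            ∃ u₁ u₂, g.IsUniqueSaddlePoint μ 𝓕 t x u₁ u₂ ∧
              ∀ᵐ p ∂((volume.restrict (Icc t g.T)).prod μ),
                Sum.elim (u₁ p.1 p.2) (u₂ p.1 p.2) = g.feedback P p.1 *ᵥ X p.1) := by
  obtain ⟨Z, α, hZ, hn⟩ := hg.exists_isNormalized hR₁₁ hR₂₂
  have main : g.FiniteValues μ 𝓕 →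
      ∃ P : ℝ → Matrix (Fin n) (Fin n) ℝ, g.IsRiccatiSolution P ∧
        (∀ P', g.IsRiccatiSolution P' → EqOn P' P (Icc 0 g.T)) ∧
        ∀ t ∈ Icc 0 g.T, ∀ x : Fin n → ℝ,
          ∃ X : ℝ → Fin n → ℝ, g.IsClosedLoopPath P t x X ∧
            (∀ X', g.IsClosedLoopPath P t x X' → EqOn X' X (Icc t g.T)) ∧
            ∃ u₁ u₂, g.IsUniqueSaddlePoint μ 𝓕 t x u₁ u₂ ∧
              ∀ᵐ p ∂((volume.restrict (Icc t g.T)).prod μ),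
                Sum.elim (u₁ p.1 p.2) (u₂ p.1 p.2) = g.feedback P p.1 *ᵥ X p.1 := by
    intro hfin
    obtain ⟨P, hP, hPu, hX⟩ :=
      LQGame.exists_solution_of_isNormalized hn ((LQGame.finiteValues_modify hZ).2 hfin)
    have hric := fun {P} => LQGame.isRiccatiSolution_modify (α := α) (P := P) hZ hg.T_pos
    refine ⟨P, hric.1 hP, fun P' hP' => hPu P' (hric.2 hP'), fun t ht x => ?_⟩
    obtain ⟨X, h1, h2, u₁, u₂, h3, h4⟩ := hX t ht x
    refine ⟨X, (LQGame.isClosedLoopPath_modify hZ ht).1 h1,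
      fun X' hX' => h2 X' ((LQGame.isClosedLoopPath_modify hZ ht).2 hX'), u₁, u₂,
      (LQGame.isUniqueSaddlePoint_modify hZ ht).1 h3, ?_⟩
    have hZt : ∀ᵐ s ∂(volume.restrict (Icc t g.T)), s ∈ Z :=
      ae_mono (Measure.restrict_mono (Icc_subset_Icc_left ht.1) le_rfl) hZ
    filter_upwards [h4, Measure.quasiMeasurePreserving_fst.ae hZt] with p k1 k2
    rw [k1, LQGame.feedback_modify P k2]
  refine ⟨⟨fun hfin t ht x => ?_, fun h t ht x => ?_⟩, main⟩
  · obtain ⟨P, -, -, hX⟩ := main hfin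
    obtain ⟨X, -, -, u₁, u₂, hu, -⟩ := hX t ht x
    exact ⟨u₁, u₂, hu⟩
  · obtain ⟨u₁, u₂, hu⟩ := h t ht x
    exact hu.1.values_finite
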